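/- Let $n\ge 3$, $L=n(n-1)/2$, $\mathbb I=\{(i,j):1\le i<j\le n\}$, and write $\langle A,B\rangle=\mathrm{Tr}(A^\top B)$, $\|\cdot\|_{\mathrm F}$ for the Frobenius norm and $\|\cdot\|$ for the operator norm. For $\alpha=(i,j)\in\mathbb I$ let $w_\alpha=e_{ii}+e_{jj}-e_{ij}-e_{ji}$ and let $v_\alpha=-\tfrac12(ab^\top+ba^\top)$ with $a=e_i-\tfrac1n\mathbf 1$, $b=e_j-\tfrac1n\mathbf 1$, be the dual basis element. For $\Omega=(\alpha_1,\dots,\alpha_m)\in\mathbb I^m$ put $\mathcal R_\Omega(Y)=\sum_{k=1}^m\langle Y,w_{\alpha_k}\rangle v_{\alpha_k}$. For a symmetric matrix $Y$ let $P_Y$ be the orthogonal projection onto its column space and $\mathcal P_{\mathbb T_Y}Z=P_YZ+ZP_Y-P_YZP_Y$ (for $Y$ of rank $r$, the projection onto the tangent space at $Y$ of the rank-$r$ matrices). Let $\mathcal H_r(\sum_{i=1}^n\lambda_iu_iu_i^\top)=\sum_{i=1}^r\lambda_iu_iu_i^\top$ for a spectral decomposition with $|\lambda_1|\ge\dots\ge|\lambda_n|$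 (ties broken arbitrarily). Let $X\in\mathbb R^{n\times n}$ be symmetric with $X\mathbf 1=0$, of rank $r\ge1$ and condition number $\kappa=\|X\|/\sigma_r(X)$, where $\sigma_r(X)$ is the smallest nonzero singular value. Suppose that $X$ is $\nu$-incoherent for some $\nu\ge1$, that is, for all $\alpha=(i,j)\in\mathbb I$ and both for $\mathcal Q Z=P_XZ$ and for $\mathcal Q=\mathcal P_{\mathbb T_X}$, $$\|\mathcal Q e_{ij}\|_{\mathrm F}\le\sqrt{\tfrac{\nu r}{128n}},\qquad \|\mathcal Q w_\alpha\|_{\mathrm F}\le\sqrt{\tfrac{\nu r}{8n}},\qquad \|\mathcal Q v_\alpha\|_{\mathrm F}\le\sqrt{\tfrac{\nu r}{2n}},$$ and that $\max_{i,j}|X_{ij}|\le\mu_1\sqrt{r/n^2}\,\|X\|$. Let $\beta>1$ and $0<\varepsilon_0<\tfrac1{22}$, so that $\delta=\frac{18\varepsilon_0}{1-4\varepsilon_0}<1$, and let $\Omega$ consist of $m\le L$ indices drawn independently and uniformly, with replacement, from $\mathbb I$, where $$m\ge\max\left\{\frac83\,\frac{\sqrt{\beta\nu^3r}}{\varepsilon_0},\;170\,\kappa\,\mu_1\,n^{3/4}\right\}\frac{\sqrt{\beta\nu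 r^3}}{\varepsilon_0}\,n\log n .$$ Consider the algorithm $X_0=\frac Lm\mathcal H_r(\mathcal R_\Omega(X))$ and, for $l=0,1,\dots$, $$G_l=\mathcal R_\Omega(X-X_l),\qquad \alpha_l=\max\left\{\frac{\|\mathcal P_{\mathbb T_l}G_l\|_{\mathrm F}^2}{\langle\mathcal P_{\mathbb T_l}G_l,\mathcal R_\Omega\mathcal P_{\mathbb T_l}G_l\rangle},0\right\},\qquad X_{l+1}=\mathcal H_r\left(X_l+\alpha_l\mathcal P_{\mathbb T_l}G_l\right),$$ where $\mathbb T_l=\mathbb T_{X_l}$ and a quotient with denominator $0$ is read as $0$. Then, with probability at least $1-10n^{1-\beta}$, the algorithm converges linearly to $X$: for all $l\ge0$, $$\|X_{l+1}-X\|_{\mathrm F}\le\delta\,\|X_l-X\|_{\mathrm F}.$$ -/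

import Mathlib

open MeasureTheory ProbabilityTheory

namespace EDG

/-- The trace inner product `⟨A, B⟩ = Tr(Aᵀ B)`. -/
def ip {n : ℕ} (A B : Matrix (Fin n) (Fin n) ℝ) : ℝ :=
  (A.transpose * B).trace

/-- The Frobenius norm. -/
noncomputable def frob {n : ℕ} (A : Matrix (Fin n) (Fin n) ℝ) : ℝ :=
  Real.sqrt (ip A A)

/-- The operator (spectral) norm of a matrix acting on Euclidean space. -/
noncomputable def opNorm {n : ℕ} (A : Matrix (Fin n) (Fin n) ℝ) : ℝ :=
  ‖Matrix.toEuclideanCLM (n := Fin n) (𝕜 := ℝ) A‖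

/-- The condition number `‖X‖ / σ_r(X)` of a rank-`r` matrix; Mathlib numbers singular values
from `0` in decreasing order, so that `σ_r` has index `r - 1`. -/
noncomputable def condNumber {n : ℕ} (r : ℕ) (X : Matrix (Fin n) (Fin n) ℝ) : ℝ :=
  opNorm X / (Matrix.toEuclideanLin X).singularValues (r - 1)

/-- The index set of pairs `(i, j)` with `i < j`. -/
abbrev Pair (n : ℕ) : Type := {a : Fin n × Fin n // a.1 < a.2}

/-- The number `L = n (n - 1) / 2` of pairs. -/
noncomputable def numPairs (n : ℕ) : ℝ := (n : ℝ) * ((n : ℝ) - 1) / 2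

/-- The standard matrix unit `e_{ij}`. -/
def unitMat {n : ℕ} (i j : Fin n) : Matrix (Fin n) (Fin n) ℝ :=
  Matrix.single i j 1

/-- The basis matrix `w_α = e_{ii} + e_{jj} - e_{ij} - e_{ji}` for `α = (i, j)`. -/
def w {n : ℕ} (a : Pair n) : Matrix (Fin n) (Fin n) ℝ :=
  unitMat a.1.1 a.1.1 + unitMat a.1.2 a.1.2 - unitMat a.1.1 a.1.2 - unitMat a.1.2 a.1.1

/-- The centered coordinate vector `e_i - (1/n) 1`. -/
noncomputable def centered {n : ℕ} (i : Fin n) : Fin n → ℝ :=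
  fun k => (if k = i then 1 else 0) - 1 / (n : ℝ)

/-- The dual basis matrix `v_α = -(1/2) (a bᵀ + b aᵀ)`, with `a`, `b` the centered coordinate
vectors of the two indices of `α`. -/
noncomputable def v {n : ℕ} (a : Pair n) : Matrix (Fin n) (Fin n) ℝ :=
  (-(1 / 2 : ℝ)) • (Matrix.vecMulVec (centered a.1.1) (centered a.1.2)
    + Matrix.vecMulVec (centered a.1.2) (centered a.1.1))

/-- The subspace `𝕊` of symmetric matrices with zero row sums. -/
def IsCentered {n : ℕ} (Y : Matrix (Fin n) (Fin n) ℝ) : Prop :=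
  Y.IsSymm ∧ ∀ i, ∑ j, Y i j = 0

/-- The sampling operator `R_Ω(Y) = ∑_{α ∈ Ω} ⟨Y, w_α⟩ v_α`, where `Ω` is a list of `m` indices
and repeated indices are counted with multiplicity. -/
noncomputable def sampling {n m : ℕ} (ω : Fin m → Pair n) (Y : Matrix (Fin n) (Fin n) ℝ) :
    Matrix (Fin n) (Fin n) ℝ :=
  ∑ k, ip Y (w (ω k)) • v (ω k)

/-- The matrix `P_U` of the orthogonal projection onto the column space of `X`
(so `P_U = U Uᵀ` for a thin spectral decomposition `X = U D Uᵀ`). -/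
noncomputable def colProj {n : ℕ} (X : Matrix (Fin n) (Fin n) ℝ) : Matrix (Fin n) (Fin n) ℝ :=
  (Matrix.toEuclideanCLM (n := Fin n) (𝕜 := ℝ)).symm
    (LinearMap.range (Matrix.toEuclideanLin X)).starProjection

/-- The projection `P_𝕋 Y = P_U Y + Y P_U - P_U Y P_U` onto the tangent space at a symmetric
matrix `X` of the manifold of matrices of the same rank. -/
noncomputable def tanProj {n : ℕ} (X Y : Matrix (Fin n) (Fin n) ℝ) : Matrix (Fin n) (Fin n) ℝ :=
  colProj X * Y + Y * colProj X - colProj X * Y * colProj X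

/-- `Z` is a value of the hard thresholding operator `H_r` at the symmetric matrix `Y`: for some
spectral decomposition `Y = ∑ λ_i u_i u_iᵀ` with `|λ_1| ≥ ... ≥ |λ_n|`, it is the sum of the first
`r` terms. The value is unique unless `|λ_r| = |λ_{r+1}|`; every way to break ties is allowed. -/
def IsHardThreshold {n : ℕ} (r : ℕ) (Y Z : Matrix (Fin n) (Fin n) ℝ) : Prop :=
  ∃ (u : OrthonormalBasis (Fin n) ℝ (EuclideanSpace ℝ (Fin n))) (lam : Fin n → ℝ),
    Antitone (fun i => |lam i|) ∧
    Y = ∑ i, lam i • Matrix.vecMulVec (u i).ofLp (u i).ofLp ∧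
    Z = ∑ i with i.val < r, lam i • Matrix.vecMulVec (u i).ofLp (u i).ofLp

/-- The step size at the iterate `Xl`, for `G = R_Ω(X - Xl)`. -/
noncomputable def stepSize {n m : ℕ} (ω : Fin m → Pair n) (X Xl : Matrix (Fin n) (Fin n) ℝ) : ℝ :=
  max (frob (tanProj Xl (sampling ω (X - Xl))) ^ 2 /
    ip (tanProj Xl (sampling ω (X - Xl))) (sampling ω (tanProj Xl (sampling ω (X - Xl))))) 0

/-- The point `W_l = X_l + α_l P_{𝕋_l} R_Ω(X - X_l)` reached before thresholding. -/
noncomputable def gradStep {n m : ℕ} (ω : Fin m → Pair n) (X Xl : Matrix (Fin n) (Fin n) ℝ) :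
    Matrix (Fin n) (Fin n) ℝ :=
  Xl + stepSize ω X Xl • tanProj Xl (sampling ω (X - Xl))

/-- `x` is a sequence of iterates of Riemannian pseudo-gradient descent with the samples `ω` and
the target rank `r`, started at the one-step hard thresholding `(L/m) H_r(R_Ω(X))`. -/
structure IsRun {n m : ℕ} (r : ℕ) (ω : Fin m → Pair n) (X : Matrix (Fin n) (Fin n) ℝ)
    (x : ℕ → Matrix (Fin n) (Fin n) ℝ) : Prop where
  init : ∃ Z, IsHardThreshold r (sampling ω X) Z ∧ x 0 = (numPairs n / (m : ℝ)) • Z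
  step : ∀ l, IsHardThreshold r (gradStep ω X (x l)) (x (l + 1))

/-- The incoherence condition with parameter `ν` for a rank-`r` matrix `X`. -/
structure IsIncoherent {n : ℕ} (r : ℕ) (ν : ℝ) (X : Matrix (Fin n) (Fin n) ℝ) : Prop where
  one_le : 1 ≤ ν
  col_unit : ∀ a : Pair n,
    frob (colProj X * unitMat a.1.1 a.1.2) ≤ Real.sqrt (ν * r / (128 * n))
  col_w : ∀ a : Pair n, frob (colProj X * w a) ≤ Real.sqrt (ν * r / (8 * n))
  col_v : ∀ a : Pair n, frob (colProj X * v a) ≤ Real.sqrt (ν * r / (2 * n))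
  tan_unit : ∀ a : Pair n,
    frob (tanProj X (unitMat a.1.1 a.1.2)) ≤ Real.sqrt (ν * r / (128 * n))
  tan_w : ∀ a : Pair n, frob (tanProj X (w a)) ≤ Real.sqrt (ν * r / (8 * n))
  tan_v : ∀ a : Pair n, frob (tanProj X (v a)) ≤ Real.sqrt (ν * r / (2 * n))

/-- The law of `m` indices drawn independently and uniformly, with replacement, from all pairs. -/
noncomputable def sampleLaw (n m : ℕ) : Measure (Fin m → Pair n) :=
  Measure.pi fun _ => uniformOn (Set.univ : Set (Pair n))

/-! The families `w`, `v` are dual to each other, and runs of the algorithm exist. -/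

lemma ip_w {n : ℕ} (Y : Matrix (Fin n) (Fin n) ℝ) (a : Pair n) :
    ip Y (w a) = Y a.1.1 a.1.1 + Y a.1.2 a.1.2 - Y a.1.1 a.1.2 - Y a.1.2 a.1.1 := by
  simp [ip, w, unitMat, mul_add, mul_sub, Matrix.trace_mul_single]

theorem ip_v_w {n : ℕ} (a b : Pair n) : ip (v a) (w b) = if a = b then 1 else 0 := by
  obtain ⟨⟨i, j⟩, hij⟩ := a
  obtain ⟨⟨k, l⟩, hkl⟩ := b
  simp only [ip_w, v, centered, Matrix.smul_apply, Matrix.add_apply, Matrix.vecMulVec_apply,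
    smul_eq_mul, Subtype.mk.injEq, Prod.mk.injEq]
  dsimp only at hij hkl
  by_cases h1 : k = i <;> by_cases h2 : l = j <;> by_cases h3 : k = j <;> by_cases h4 : l = i <;>
    first
    | (exfalso; omega)
    | (simp [h1, h2, h3, h4, eq_comm]; try ring_nf) <;> grind

theorem isCentered_v {n : ℕ} (a : Pair n) : IsCentered (v a) := by
  have hn : (n : ℝ) ≠ 0 := by
    have := a.1.1.pos
    positivity
  have hc : ∀ i : Fin n, ∑ k, centered i k = 0 := by
    intro i
    simp [centered, Finset.sum_sub_distrib, hn]
  refine ⟨?_, fun i => ?_⟩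
  · ext i j
    simp [v, Matrix.vecMulVec_apply]
    ring
  · simp only [v, Matrix.smul_apply, Matrix.add_apply, Matrix.vecMulVec_apply, smul_eq_mul]
    rw [← Finset.mul_sum, Finset.sum_add_distrib, ← Finset.mul_sum, ← Finset.mul_sum, hc, hc]
    ring

theorem exists_isHardThreshold {n : ℕ} (r : ℕ) {Y : Matrix (Fin n) (Fin n) ℝ} (hY : Y.IsSymm) :
    ∃ Z, IsHardThreshold r Y Z := by
  have hH : Y.IsHermitian := by
    rw [Matrix.IsHermitian, Matrix.conjTranspose_eq_transpose_of_trivial]; exact hY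
  let σ := Tuple.sort (fun i => -|hH.eigenvalues i|)
  have hσ := Tuple.monotone_sort (fun i => -|hH.eigenvalues i|)
  refine ⟨_, hH.eigenvectorBasis.reindex σ.symm, hH.eigenvalues ∘ σ, ?_, ?_, rfl⟩
  · intro i j hij
    have := hσ hij
    simp only [Function.comp] at this ⊢
    exact neg_le_neg_iff.mp this
  · have key : Y = ∑ i, hH.eigenvalues i • Matrix.vecMulVec (hH.eigenvectorBasis i).ofLp
        (hH.eigenvectorBasis i).ofLp := by
      conv_lhs => rw [hH.spectral_theorem]
      ext i j
      simp [Unitary.conjStarAlgAut_apply, Matrix.mul_apply, Matrix.sum_apply,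
        Matrix.vecMulVec_apply, Matrix.diagonal_apply, Matrix.star_apply]
      refine Finset.sum_congr rfl fun k _ => by ring
    conv_lhs => rw [key]
    simp only [Function.comp, OrthonormalBasis.reindex_apply, Equiv.symm_symm]
    exact (Equiv.sum_comp σ (fun i => hH.eigenvalues i • Matrix.vecMulVec
      (hH.eigenvectorBasis i).ofLp (hH.eigenvectorBasis i).ofLp)).symm

theorem IsHardThreshold.isSymm {n r : ℕ} {Y Z : Matrix (Fin n) (Fin n) ℝ}
    (h : IsHardThreshold r Y Z) : Z.IsSymm := by
  obtain ⟨u, lam, -, -, rfl⟩ := h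
  ext i j
  simp [Matrix.sum_apply, Matrix.vecMulVec_apply, mul_comm]

theorem colProj_isSymm {n : ℕ} (X : Matrix (Fin n) (Fin n) ℝ) : (colProj X).IsSymm := by
  have h : star (colProj X) = colProj X := by
    apply (Matrix.toEuclideanCLM (n := Fin n) (𝕜 := ℝ)).injective
    have h1 := (Matrix.toEuclideanCLM (n := Fin n) (𝕜 := ℝ)).map_star' (colProj X)
    have h2 : Matrix.toEuclideanCLM (n := Fin n) (𝕜 := ℝ) (colProj X)
        = (LinearMap.range (Matrix.toEuclideanLin X)).starProjection :=
      (Matrix.toEuclideanCLM (n := Fin n) (𝕜 := ℝ)).apply_symm_apply _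
    refine h1.trans ?_
    refine (congrArg star h2).trans ?_
    rw [(isSelfAdjoint_starProjection _).star_eq]
    exact h2.symm
  rwa [Matrix.star_eq_conjTranspose, Matrix.conjTranspose_eq_transpose_of_trivial] at h

theorem sampling_isSymm {n m : ℕ} (ω : Fin m → Pair n) (Y : Matrix (Fin n) (Fin n) ℝ) :
    (sampling ω Y).IsSymm := by
  have h : ∀ a : Pair n, (v a).transpose = v a := fun a => (isCentered_v a).1
  simp [Matrix.IsSymm, sampling, Matrix.transpose_sum, h]

theorem gradStep_isSymm {n m : ℕ} (ω : Fin m → Pair n) (X : Matrix (Fin n) (Fin n) ℝ)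
    {Y : Matrix (Fin n) (Fin n) ℝ} (hY : Y.IsSymm) : (gradStep ω X Y).IsSymm := by
  have h1 := sampling_isSymm ω (X - Y)
  have h2 := colProj_isSymm Y
  unfold Matrix.IsSymm at *
  simp only [gradStep, tanProj, Matrix.transpose_add, Matrix.transpose_smul, Matrix.transpose_sub,
    Matrix.transpose_mul, h1, h2, hY, Matrix.mul_assoc]
  congr 3
  exact add_comm _ _

theorem exists_isRun {n m : ℕ} (r : ℕ) (ω : Fin m → Pair n) (X : Matrix (Fin n) (Fin n) ℝ) :
    ∃ x, IsRun r ω X x := by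
  obtain ⟨Z, hZ⟩ := exists_isHardThreshold r (sampling_isSymm ω X)
  have hs : ∀ Y : {Y : Matrix (Fin n) (Fin n) ℝ // Y.IsSymm},
      ∃ T : {Y : Matrix (Fin n) (Fin n) ℝ // Y.IsSymm}, IsHardThreshold r (gradStep ω X Y.1) T.1 :=
    fun Y => by
      obtain ⟨T, hT⟩ := exists_isHardThreshold r (gradStep_isSymm ω X Y.2)
      exact ⟨⟨T, hT.isSymm⟩, hT⟩
  choose f hf using hs
  have h0 : ((numPairs n / (m : ℝ)) • Z).IsSymm := by
    have := hZ.isSymm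
    unfold Matrix.IsSymm at *
    rw [Matrix.transpose_smul, this]
  exact ⟨fun l => (f^[l] ⟨_, h0⟩).1, ⟨Z, hZ, rfl⟩, fun l => by
    rw [Function.iterate_succ_apply']; exact hf _⟩

end EDG

namespace EDG

/-! ### The Golden–Thompson inequality -/

section Trotter

open NormedSpace Filter Topology

variable {𝔸 : Type*} [NormedRing 𝔸]

/-! Write p = m/L, P = P_X, Q = P_Y for an iterate Y, and σ for the smallest nonzero singular value
of X. For centered A, B one has ⟨A, R_Ω B⟩ = ∑_k ⟨A, v⟩⟨B, w⟩ over the sampled pairs, and its mean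
is p⟨A, B⟩ because v and w are dual bases (`sum_ip_v_mul_ip_w`). The proof separates a deterministic
contraction, valid for every `GoodSample`, from the probability of such a sample.

Contraction (`GoodSample.step`). Split E = Y − X into A₀, its projection to the tangent space at Y,
and N = E − A₀. If ‖E‖ ≤ ησ, the two column spaces are η-close, and N = (1−Q) E · P(1−Q) is at most
η‖E‖. If R_Ω is p up to a relative error 2ε on the tangent space at Y, the step size is nearly 1/p
and the gradient step nearly cancels A₀. Thresholding at most doubles the remaining error, since X
itself has rank r. This gives the factor 18ε/(1−4ε) ≤ 1, so the run never leaves the ball.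

The obstacle is that Y depends on the sample, while concentration is available only on the fixed
tangent space at X. Passing from X to Y (`GoodSample.rip_near`) costs 2η times the size of R_Ω off
that space. If one argument is tangent at X, incoherence spreads its entries (`tangent_entry_sq_le`)
and the diagonal part of the form concentrates. If neither is, the bound is 2τ, with τ² bounding the
row sums of squared multiplicities, but then η enters squared. R_Ω is not self-adjoint, so the two
mixed cases are treated separately.

Probability. Golden–Thompson and the Ahlswede–Winter argument give a matrix Bernstein inequality
(`measureReal_bernstein_le`). It yields the near-isometry on the tangent space at X, the diagonal
estimate, and a bound on ‖R_Ω X − pX‖, which places X_0 in the ball. The multiplicities need a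
separate exponential moment, of squares continued linearly. The n^(3/4) term in the bound on m makes
the initial radius small enough for `SmallRadius` (`sample_size_bounds`, `smallRadius_of_sq_le`). -/

lemma norm_exp_le_exp_norm [NormedAlgebra ℝ 𝔸] [NormOneClass 𝔸] (x : 𝔸) : ‖exp x‖ ≤ Real.exp ‖x‖ := by
  rw [exp_eq_tsum ℝ, Real.exp_eq_exp_ℝ, exp_eq_tsum ℝ]
  refine (norm_tsum_le_tsum_norm (norm_expSeries_summable' (𝕂 := ℝ) x)).trans ?_
  refine (norm_expSeries_summable' (𝕂 := ℝ) x).tsum_le_tsum (fun n => ?_)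
    (expSeries_summable' (𝕂 := ℝ) ‖x‖)
  rw [norm_smul, smul_eq_mul, Real.norm_of_nonneg (by positivity)]
  gcongr
  exact norm_pow_le _ _

/-- Telescoping: exchanging one factor costs ‖x − y‖ times N − 1 factors of size at most c. As c ≥
1, the exponent N − 1 may be relaxed to N. -/
lemma norm_pow_sub_pow_le [NormOneClass 𝔸] (x y : 𝔸) {c : ℝ} (hx : ‖x‖ ≤ c) (hy : ‖y‖ ≤ c)
    (hc : 1 ≤ c) (N : ℕ) : ‖x ^ N - y ^ N‖ ≤ N * c ^ N * ‖x - y‖ := by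
  have hc0 : 0 ≤ c := by linarith
  induction N with
  | zero => simp
  | succ N ih =>
    have h : x ^ (N + 1) - y ^ (N + 1) = x * (x ^ N - y ^ N) + (x - y) * y ^ N := by
      rw [pow_succ' x, pow_succ' y]; noncomm_ring
    have h1 : ‖x * (x ^ N - y ^ N)‖ ≤ c * (N * c ^ N * ‖x - y‖) :=
      (norm_mul_le _ _).trans (mul_le_mul hx ih (norm_nonneg _) hc0)
    have h2 : ‖(x - y) * y ^ N‖ ≤ ‖x - y‖ * (c * c ^ N) := by
      refine (norm_mul_le _ _).trans (mul_le_mul_of_nonneg_left ?_ (norm_nonneg _))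
      have h3 : ‖y ^ N‖ ≤ c ^ N :=
        (norm_pow_le _ _).trans (pow_le_pow_left₀ (norm_nonneg _) hy _)
      nlinarith [pow_nonneg hc0 N]
    rw [h]
    refine (norm_add_le _ _).trans ((add_le_add h1 h2).trans (le_of_eq ?_))
    push_cast; ring

/-- Both e^{ta} e^{tb} and e^{t(a+b)} have value 1 and derivative a + b at t = 0, so they differ by
o(t); here t = 1/N. -/
lemma tendsto_mul_trotter_error [NormedAlgebra ℝ 𝔸] [CompleteSpace 𝔸] (a b : 𝔸) :
    Tendsto (fun N : ℕ => (N : ℝ) *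
      ‖exp ((N : ℝ)⁻¹ • a) * exp ((N : ℝ)⁻¹ • b) - exp ((N : ℝ)⁻¹ • (a + b))‖) atTop (𝓝 0) := by
  have h1 := hasDerivAt_exp_smul_const (𝕂 := ℝ) a 0
  have h2 := hasDerivAt_exp_smul_const (𝕂 := ℝ) b 0
  have h3 := hasDerivAt_exp_smul_const (𝕂 := ℝ) (a + b) 0
  have h := (h1.mul h2).sub h3
  rw [hasDerivAt_iff_tendsto_slope_zero] at h
  simp only [zero_smul, exp_zero, one_mul, mul_one, zero_add, Pi.sub_apply, Pi.mul_apply,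
    sub_self, sub_zero] at h
  have hN : Tendsto (fun N : ℕ => ((N : ℝ))⁻¹) atTop (𝓝[≠] 0) := by
    refine tendsto_nhdsWithin_iff.2 ⟨tendsto_inv_atTop_nhds_zero_nat, ?_⟩
    filter_upwards [eventually_gt_atTop 0] with N hN
    simp; omega
  have := (h.comp hN).norm
  simp only [norm_zero] at this
  refine this.congr fun N => ?_
  simp [Function.comp, norm_smul]

/-- The Lie product formula. -/
theorem tendsto_exp_mul_exp_pow [NormedAlgebra ℝ 𝔸] [CompleteSpace 𝔸] [NormOneClass 𝔸]
    (a b : 𝔸) :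
    Tendsto (fun N : ℕ => (exp ((N : ℝ)⁻¹ • a) * exp ((N : ℝ)⁻¹ • b)) ^ N) atTop
      (𝓝 (exp (a + b))) := by
  rw [tendsto_iff_norm_sub_tendsto_zero]
  set c : ℝ := ‖a‖ + ‖b‖ with hc
  have hc0 : 0 ≤ c := by positivity
  have hlim := (tendsto_mul_trotter_error a b).const_mul (Real.exp c)
  rw [mul_zero] at hlim
  refine squeeze_zero' (Eventually.of_forall fun _ => norm_nonneg _) ?_ hlim
  filter_upwards [eventually_gt_atTop 0] with N hN
  have hN' : (0 : ℝ) < N := by exact_mod_cast hN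
  have hy : exp ((N : ℝ)⁻¹ • (a + b)) ^ N = exp (a + b) := by
    let _ : NormedAlgebra ℚ 𝔸 := NormedAlgebra.restrictScalars ℚ ℝ 𝔸
    rw [← exp_nsmul, ← Nat.cast_smul_eq_nsmul ℝ, smul_smul, mul_inv_cancel₀ hN'.ne', one_smul]
  have hn : ∀ z : 𝔸, ‖exp ((N : ℝ)⁻¹ • z)‖ ≤ Real.exp (‖z‖ / N) := fun z => by
    refine (norm_exp_le_exp_norm _).trans (le_of_eq ?_)
    rw [norm_smul, norm_inv, Real.norm_of_nonneg hN'.le, inv_mul_eq_div]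
  have hx1 : ‖exp ((N : ℝ)⁻¹ • a) * exp ((N : ℝ)⁻¹ • b)‖ ≤ Real.exp (c / N) := by
    refine (norm_mul_le _ _).trans ?_
    rw [hc, add_div, Real.exp_add]
    exact mul_le_mul (hn a) (hn b) (norm_nonneg _) (Real.exp_nonneg _)
  have hy1 : ‖exp ((N : ℝ)⁻¹ • (a + b))‖ ≤ Real.exp (c / N) := by
    refine (hn _).trans (Real.exp_le_exp.2 ?_)
    gcongr
    exact norm_add_le _ _
  have := norm_pow_sub_pow_le _ _ hx1 hy1 (Real.one_le_exp (by positivity)) N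
  rw [hy, ← Real.exp_nat_mul, mul_div_cancel₀ _ hN'.ne'] at this
  linarith

end Trotter

section GoldenThompson

open Matrix Filter Topology

variable {d : Type*} [Fintype d]

lemma sq_trace_mul_le (A B : Matrix d d ℝ) :
    (A * B).trace ^ 2 ≤ (A * Aᵀ).trace * (Bᵀ * B).trace := by
  simp only [Matrix.trace, Matrix.diag, Matrix.mul_apply, Matrix.transpose_apply]
  rw [← Finset.sum_product', ← Finset.sum_product']
  have h3 : ∑ i, ∑ j, B j i * B j i = ∑ x : d × d, B x.2 x.1 ^ 2 := by
    rw [Fintype.sum_prod_type]; simp [sq]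
  rw [h3]
  refine (Finset.sum_mul_sq_le_sq_mul_sq _ _ _).trans (le_of_eq ?_)
  simp [sq]

lemma trace_pow_mul_comm [DecidableEq d] (A B : Matrix d d ℝ) (N : ℕ) :
    ((A * B) ^ N).trace = ((B * A) ^ N).trace := by
  cases N with
  | zero => simp
  | succ N =>
    have h : (A * B) ^ (N + 1) = A * ((B * A) ^ N * B) := by
      induction N with
      | zero => simp
      | succ N ih => rw [pow_succ, ih, pow_succ (B * A)]; simp only [Matrix.mul_assoc]
    rw [h, Matrix.trace_mul_comm, pow_succ, Matrix.mul_assoc]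

/-- The two inequalities are proved together because each feeds the other. The first for M is the
first for M², then the second for MᵀM and MMᵀ, then Cauchy–Schwarz. The second for P, Q is the first
for PQ, then the second for P², Q². Exponents 2^k suffice, since the Lie product formula can be
taken along them. -/
lemma trace_pow_two_pow_le [DecidableEq d] (k : ℕ) :
    (∀ M : Matrix d d ℝ, |(M ^ 2 ^ (k + 1)).trace| ≤ ((M * Mᵀ) ^ 2 ^ k).trace) ∧
    ∀ P Q : Matrix d d ℝ, P.IsSymm → Q.IsSymm →
      ((P * Q) ^ 2 ^ k).trace ≤ (P ^ 2 ^ k * Q ^ 2 ^ k).trace := by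
  induction k with
  | zero =>
    refine ⟨fun M => ?_, fun P Q _ _ => by simp⟩
    have h := sq_trace_mul_le M M
    rw [Matrix.trace_mul_comm Mᵀ M, ← sq (M * Mᵀ).trace] at h
    have h0 : 0 ≤ (M * Mᵀ).trace := by
      have := (Matrix.posSemidef_self_mul_conjTranspose M).trace_nonneg
      simpa using this
    simpa [sq] using abs_le_of_sq_le_sq h h0
  | succ k ih =>
    obtain ⟨hG, hH⟩ := ih
    refine ⟨fun M => ?_, fun P Q hP hQ => ?_⟩
    · have h1 : M ^ 2 ^ (k + 1 + 1) = (M ^ 2) ^ 2 ^ (k + 1) := by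
        rw [← pow_mul, pow_succ' 2 (k + 1)]
      have hPs : (Mᵀ * M).IsSymm := by simp [Matrix.IsSymm]
      have hQs : (M * Mᵀ).IsSymm := by simp [Matrix.IsSymm]
      have h2 : ((M ^ 2 * (M ^ 2)ᵀ) ^ 2 ^ k).trace = (((Mᵀ * M) * (M * Mᵀ)) ^ 2 ^ k).trace := by
        have : M ^ 2 * (M ^ 2)ᵀ = (M * (M * Mᵀ)) * Mᵀ := by
          rw [Matrix.transpose_pow, sq, sq]; simp only [Matrix.mul_assoc]
        rw [this, trace_pow_mul_comm]; simp only [Matrix.mul_assoc]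
      rw [h1]
      refine (hG (M ^ 2)).trans (h2.le.trans ((hH _ _ hPs hQs).trans ?_))
      have h3 := sq_trace_mul_le ((Mᵀ * M) ^ 2 ^ k) ((M * Mᵀ) ^ 2 ^ k)
      rw [Matrix.transpose_pow, Matrix.transpose_pow, hPs.eq, hQs.eq, ← pow_add, ← pow_add,
        ← two_mul, ← pow_succ', trace_pow_mul_comm Mᵀ M, ← sq] at h3
      refine (le_abs_self _).trans (abs_le_of_sq_le_sq h3 ?_)
      have h4 : (M * Mᵀ) ^ 2 ^ (k + 1) = (M * Mᵀ) ^ 2 ^ k * ((M * Mᵀ) ^ 2 ^ k)ᵀ := by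
        rw [Matrix.transpose_pow, hQs.eq, ← pow_add, ← two_mul, ← pow_succ']
      rw [h4]
      have := (Matrix.posSemidef_self_mul_conjTranspose ((M * Mᵀ) ^ 2 ^ k)).trace_nonneg
      simpa using this
    · have h1 := (le_abs_self _).trans (hG (P * Q))
      have h2 : (((P * Q) * (P * Q)ᵀ) ^ 2 ^ k).trace = ((P ^ 2 * Q ^ 2) ^ 2 ^ k).trace := by
        have : (P * Q) * (P * Q)ᵀ = (P * Q ^ 2) * P := by
          rw [Matrix.transpose_mul, hP.eq, hQ.eq, sq]; simp only [Matrix.mul_assoc]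
        rw [this, trace_pow_mul_comm, sq P, Matrix.mul_assoc]
      refine h1.trans (h2.le.trans ((hH _ _ (hP.pow 2) (hQ.pow 2)).trans (le_of_eq ?_)))
      rw [← pow_mul, ← pow_mul, ← pow_succ']

attribute [local instance] Matrix.linftyOpNormedRing Matrix.linftyOpNormedAlgebra

/-- The Golden–Thompson inequality for real symmetric matrices. -/
theorem trace_exp_add_le [DecidableEq d] {A B : Matrix d d ℝ} (hA : A.IsSymm) (hB : B.IsSymm) :
    (NormedSpace.exp (A + B)).trace ≤ (NormedSpace.exp A * NormedSpace.exp B).trace := by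
  -- The identity matrix has norm one only when the index type is nonempty.
  cases isEmpty_or_nonempty d with
  | inl h => simp [Matrix.trace]
  | inr h =>
  have hlim := tendsto_exp_mul_exp_pow A B
  have h2 : Tendsto (fun k : ℕ => 2 ^ k) atTop atTop :=
    tendsto_pow_atTop_atTop_of_one_lt (one_lt_two)
  have htr : Continuous (fun M : Matrix d d ℝ => M.trace) := continuous_id.matrix_trace
  refine le_of_tendsto ((htr.tendsto _).comp (hlim.comp h2)) (Eventually.of_forall fun k => ?_)
  have hs : ∀ {C : Matrix d d ℝ}, C.IsSymm →
      (NormedSpace.exp (((2 ^ k : ℕ) : ℝ)⁻¹ • C)).IsSymm := fun {C} hC =>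
    Matrix.IsSymm.exp (by rw [Matrix.IsSymm, Matrix.transpose_smul, hC.eq])
  have hp : ∀ C : Matrix d d ℝ,
      NormedSpace.exp (((2 ^ k : ℕ) : ℝ)⁻¹ • C) ^ 2 ^ k = NormedSpace.exp C := fun C => by
    rw [← Matrix.exp_nsmul, ← Nat.cast_smul_eq_nsmul ℝ, smul_smul, mul_inv_cancel₀ (by positivity),
      one_smul]
  have := (trace_pow_two_pow_le k).2 _ _ (hs hA) (hs hB)
  rw [hp, hp] at this
  refine le_trans (le_of_eq ?_) this
  rfl

end GoldenThompson

end EDG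

namespace EDG

/-! ### Independent uniform draws from a finite set -/

section Draws

variable {α : Type*} [Fintype α]

/-- If `Φ k` dominates on average `Φ (k + 1)` after one further draw, then the average of `Φ 0`
after `m` draws is at most `Φ m` at the start. -/
lemma sum_pi_le_of_step {M : Type*} [AddCommMonoid M] (x : α → M) (Φ : ℕ → M → ℝ)
    {m : ℕ} (h : ∀ k < m, ∀ s, ∑ a, Φ k (s + x a) ≤ Fintype.card α * Φ (k + 1) s) (s : M) :
    ∑ ω : Fin m → α, Φ 0 (s + ∑ k, x (ω k)) ≤ (Fintype.card α : ℝ) ^ m * Φ m s := by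
  induction m generalizing s with
  | zero => simp
  | succ m ih =>
    specialize ih fun k hk => h k (hk.trans (Nat.lt_succ_self m))
    rw [← (Fin.consEquiv fun _ : Fin (m + 1) => α).sum_comp, Fintype.sum_prod_type]
    calc _ = ∑ a, ∑ ω : Fin m → α, Φ 0 (s + x a + ∑ k, x (ω k)) := by
          refine Finset.sum_congr rfl fun a _ => Finset.sum_congr rfl fun ω _ => ?_
          simp [Fin.consEquiv, Fin.sum_univ_succ, add_assoc]
      _ ≤ ∑ a, (Fintype.card α : ℝ) ^ m * Φ m (s + x a) := Finset.sum_le_sum fun a _ => ih _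
      _ ≤ (Fintype.card α : ℝ) ^ m * (Fintype.card α * Φ (m + 1) s) := by
          rw [← Finset.mul_sum]
          exact mul_le_mul_of_nonneg_left (h m (Nat.lt_succ_self m) s) (by positivity)
      _ = _ := by ring

variable [Nonempty α] [MeasurableSpace α] [MeasurableSingletonClass α]

instance isProbabilityMeasure_pi_uniformOn (m : ℕ) :
    IsProbabilityMeasure (Measure.pi fun _ : Fin m => uniformOn (Set.univ : Set α)) := by
  have : IsProbabilityMeasure (uniformOn (Set.univ : Set α)) :=
    isProbabilityMeasure_uniformOn Set.finite_univ Set.univ_nonempty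
  infer_instance

/-- Markov's inequality, with the expectation written as a normalised sum over the finitely many
samples. -/
lemma measureReal_pi_uniformOn_le {m : ℕ} {s : Set (Fin m → α)} {f : (Fin m → α) → ℝ}
    (hf : ∀ ω, 0 ≤ f ω) (hs : ∀ ω ∈ s, 1 ≤ f ω) {b : ℝ}
    (hb : ∑ ω, f ω ≤ (Fintype.card α : ℝ) ^ m * b) :
    (Measure.pi fun _ : Fin m => uniformOn (Set.univ : Set α)).real s ≤ b := by
  classical
  have : IsProbabilityMeasure (uniformOn (Set.univ : Set α)) :=
    isProbabilityMeasure_uniformOn Set.finite_univ Set.univ_nonempty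
  set μ := Measure.pi fun _ : Fin m => uniformOn (Set.univ : Set α) with hμ
  have hN : (0 : ℝ) < Fintype.card α := by exact_mod_cast Fintype.card_pos
  have h1 : ∀ ω, μ.real {ω} = ((Fintype.card α : ℝ) ^ m)⁻¹ := by
    intro ω
    rw [measureReal_def, hμ, Measure.pi_singleton, ENNReal.toReal_prod]
    have : ∀ a : α, (uniformOn (Set.univ : Set α) {a}).toReal = (Fintype.card α : ℝ)⁻¹ := by
      intro a
      rw [uniformOn_univ]
      simp
    simp [this]
  have h2 : μ.real s = ∑ ω ∈ Finset.univ.filter (· ∈ s), ((Fintype.card α : ℝ) ^ m)⁻¹ := by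
    have h3 : s = ((Finset.univ.filter (· ∈ s) : Finset (Fin m → α)) : Set (Fin m → α)) := by
      ext; simp
    conv_lhs => rw [h3]
    rw [← sum_measureReal_singleton]
    exact Finset.sum_congr rfl fun ω _ => h1 ω
  rw [h2]
  calc _ ≤ ∑ ω, f ω * ((Fintype.card α : ℝ) ^ m)⁻¹ := by
        rw [Finset.sum_filter]
        refine Finset.sum_le_sum fun ω _ => ?_
        split_ifs with h
        · exact le_mul_of_one_le_left (by positivity) (hs ω h)
        · exact mul_nonneg (hf ω) (by positivity)
    _ ≤ b := by
        rw [← Finset.sum_mul, ← div_eq_mul_inv, div_le_iff₀ (by positivity)]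
        linarith

end Draws

/-! ### The matrix Bernstein inequality -/

section Bernstein

open Matrix

variable {d : Type*} [Fintype d] [DecidableEq d]

lemma exists_orthogonal_diagonal {A : Matrix d d ℝ} (hA : A.IsSymm) :
    ∃ (U : Matrix d d ℝ) (l : d → ℝ), U * Uᵀ = 1 ∧ Uᵀ * U = 1 ∧ A = U * diagonal l * Uᵀ := by
  have hH : A.IsHermitian := by
    rw [Matrix.IsHermitian, Matrix.conjTranspose_eq_transpose_of_trivial]; exact hA
  refine ⟨hH.eigenvectorUnitary, hH.eigenvalues, ?_, ?_, ?_⟩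
  · have := Unitary.coe_mul_star_self hH.eigenvectorUnitary
    rwa [Unitary.coe_star, Matrix.star_eq_conjTranspose, Matrix.conjTranspose_eq_transpose_of_trivial] at this
  · have := Unitary.coe_star_mul_self hH.eigenvectorUnitary
    rwa [Matrix.star_eq_conjTranspose, Matrix.conjTranspose_eq_transpose_of_trivial] at this
  · conv_lhs => rw [hH.spectral_theorem]
    simp [Unitary.conjStarAlgAut_apply, Matrix.star_eq_conjTranspose]

lemma exp_orthogonal_diagonal {U : Matrix d d ℝ} (hU : U * Uᵀ = 1) (l : d → ℝ) :
    NormedSpace.exp (U * diagonal l * Uᵀ) = U * diagonal (fun i => Real.exp (l i)) * Uᵀ := by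
  have hi : U⁻¹ = Uᵀ := Matrix.inv_eq_right_inv hU
  have hu : IsUnit U := (Matrix.isUnit_iff_isUnit_det _).2 (Matrix.isUnit_det_of_right_inverse hU)
  have := Matrix.exp_conj U (diagonal l) hu
  rw [hi] at this
  rw [this, Matrix.exp_diagonal]
  congr 3
  ext i
  rw [Pi.coe_exp, Real.exp_eq_exp_ℝ]

lemma posSemidef_orthogonal_diagonal (U : Matrix d d ℝ) {l : d → ℝ} (hl : ∀ i, 0 ≤ l i) :
    (U * diagonal l * Uᵀ).PosSemidef := by
  have := (Matrix.PosSemidef.diagonal (n := d) (R := ℝ) (d := l) hl).mul_mul_conjTranspose_same U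
  rwa [Matrix.conjTranspose_eq_transpose_of_trivial] at this

lemma orthogonal_diagonal_quadForm {U : Matrix d d ℝ} (hU : Uᵀ * U = 1) (l : d → ℝ) (i : d) :
    (fun j => U j i) ⬝ᵥ (U * diagonal l * Uᵀ) *ᵥ (fun j => U j i) = l i ∧
      (fun j => U j i) ⬝ᵥ (fun j => U j i) = 1 := by
  have h0 : (fun j => U j i) = U *ᵥ Pi.single i 1 := by ext; simp
  have hq : ∀ M : Matrix d d ℝ, (U *ᵥ Pi.single i 1) ⬝ᵥ M *ᵥ (U *ᵥ Pi.single i 1)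
      = (Uᵀ * M * U) i i := fun M => by
    rw [Matrix.mulVec_mulVec, Matrix.dotProduct_mulVec, Matrix.vecMul_mulVec]
    simp [Matrix.mul_assoc]
  constructor
  · rw [h0, hq]
    have : Uᵀ * (U * diagonal l * Uᵀ) * U = (Uᵀ * U) * diagonal l * (Uᵀ * U) := by
      simp only [Matrix.mul_assoc]
    rw [this, hU]; simp
  · have := hq 1
    rw [Matrix.one_mulVec, Matrix.mul_one, hU] at this
    rw [h0, this]; simp

lemma posSemidef_exp {A : Matrix d d ℝ} (hA : A.IsSymm) : (NormedSpace.exp A).PosSemidef := by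
  obtain ⟨U, l, hU, -, rfl⟩ := exists_orthogonal_diagonal hA
  rw [exp_orthogonal_diagonal hU]
  exact posSemidef_orthogonal_diagonal U fun i => (Real.exp_pos _).le

/-- The scalar inequality e^t ≤ 1 + t + t² for |t| ≤ 1, applied to each eigenvalue. -/
lemma posSemidef_quadratic_sub_exp {A : Matrix d d ℝ} (hA : A.IsSymm)
    (h1 : ∀ z : d → ℝ, |z ⬝ᵥ A *ᵥ z| ≤ z ⬝ᵥ z) :
    (1 + A + A * A - NormedSpace.exp A).PosSemidef := by
  obtain ⟨U, l, hU, hU', rfl⟩ := exists_orthogonal_diagonal hA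
  have hl : ∀ i, |l i| ≤ 1 := fun i => by
    have h := h1 (fun j => U j i)
    rwa [(orthogonal_diagonal_quadForm hU' l i).1, (orthogonal_diagonal_quadForm hU' l i).2] at h
  rw [exp_orthogonal_diagonal hU]
  have h2 : U * diagonal l * Uᵀ * (U * diagonal l * Uᵀ) = U * diagonal (fun i => l i * l i) * Uᵀ := by
    calc _ = U * diagonal l * (Uᵀ * U) * diagonal l * Uᵀ := by simp only [Matrix.mul_assoc]
      _ = _ := by rw [hU', Matrix.mul_one, Matrix.mul_assoc U, Matrix.diagonal_mul_diagonal]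
  have h3 : (1 : Matrix d d ℝ) = U * diagonal (fun _ => 1) * Uᵀ := by
    rw [Matrix.diagonal_one, Matrix.mul_one, hU]
  rw [h2]
  nth_rw 1 [h3]
  rw [← Matrix.add_mul, ← Matrix.mul_add, ← Matrix.add_mul, ← Matrix.mul_add, ← Matrix.sub_mul,
    ← Matrix.mul_sub, Matrix.diagonal_add, Matrix.diagonal_add, Matrix.diagonal_sub]
  refine posSemidef_orthogonal_diagonal U fun i => ?_
  have := Real.abs_exp_sub_one_sub_id_le (hl i)
  have := (abs_le.1 this).2
  nlinarith

lemma trace_mul_nonneg {A B : Matrix d d ℝ} (hA : A.PosSemidef) (hB : B.PosSemidef) :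
    0 ≤ (A * B).trace := by
  have hAs : A.IsSymm := by
    have := hA.1; rwa [Matrix.IsHermitian, Matrix.conjTranspose_eq_transpose_of_trivial] at this
  obtain ⟨U, l, hU, hU', rfl⟩ := exists_orthogonal_diagonal hAs
  have h1 : (U * diagonal l * Uᵀ * B).trace = ∑ i, l i * (Uᵀ * B * U) i i := by
    rw [Matrix.mul_assoc, Matrix.trace_mul_comm, ← Matrix.mul_assoc, Matrix.trace_mul_comm]
    simp [Matrix.trace, Matrix.diagonal_mul]
  have h2 : (Uᵀ * B * U).PosSemidef := by
    have := hB.conjTranspose_mul_mul_same U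
    rwa [Matrix.conjTranspose_eq_transpose_of_trivial] at this
  rw [h1]
  refine Finset.sum_nonneg fun i _ => mul_nonneg ?_ h2.diag_nonneg
  have h3 := hA.dotProduct_mulVec_nonneg (fun j => U j i)
  simpa [(orthogonal_diagonal_quadForm hU' l i).1] using h3

/-- Some eigenvalue must exceed t, and the other exponentials in the trace are positive. -/
lemma exp_le_trace_exp_of_lt {A : Matrix d d ℝ} (hA : A.IsSymm) {t : ℝ} {z : d → ℝ}
    (hz : t * (z ⬝ᵥ z) < z ⬝ᵥ A *ᵥ z) : Real.exp t ≤ (NormedSpace.exp A).trace := by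
  obtain ⟨U, l, hU, hU', rfl⟩ := exists_orthogonal_diagonal hA
  have hi : ∃ i, t < l i := by
    by_contra! hc
    refine hz.not_ge ?_
    have h := (posSemidef_orthogonal_diagonal U (l := fun i => t - l i)
      (fun i => sub_nonneg.2 (hc i))).dotProduct_mulVec_nonneg z
    have h2 : U * diagonal (fun i => t - l i) * Uᵀ = t • (1 : Matrix d d ℝ) - U * diagonal l * Uᵀ := by
      rw [← Matrix.diagonal_sub, Matrix.mul_sub, Matrix.sub_mul]
      congr 1
      rw [← Matrix.smul_one_eq_diagonal, Matrix.mul_smul, Matrix.smul_mul, Matrix.mul_one, hU]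
    rw [h2, Matrix.sub_mulVec, Matrix.smul_mulVec, Matrix.one_mulVec, dotProduct_sub,
      dotProduct_smul] at h
    simpa using h
  obtain ⟨i, hi⟩ := hi
  rw [exp_orthogonal_diagonal hU, Matrix.trace_mul_comm, ← Matrix.mul_assoc, hU', Matrix.one_mul,
    Matrix.trace_diagonal]
  exact (Real.exp_le_exp.2 hi.le).trans
    (Finset.single_le_sum (f := fun i => Real.exp (l i)) (fun j _ => (Real.exp_pos _).le)
      (Finset.mem_univ i))

variable {α : Type*} [Fintype α]

/-- One step of the Ahlswede–Winter argument. -/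
lemma sum_trace_exp_add_le {S : Matrix d d ℝ} (hS : S.IsSymm) {x : α → Matrix d d ℝ}
    (hx : ∀ a, (x a).IsSymm) (hx0 : ∑ a, x a = 0)
    (hx1 : ∀ a (z : d → ℝ), |z ⬝ᵥ x a *ᵥ z| ≤ z ⬝ᵥ z) {v : ℝ}
    (hv : ∀ z : d → ℝ, ∑ a, (x a *ᵥ z) ⬝ᵥ (x a *ᵥ z) ≤ Fintype.card α * v * (z ⬝ᵥ z)) :
    ∑ a, (NormedSpace.exp (S + x a)).trace
      ≤ Fintype.card α * (Real.exp v * (NormedSpace.exp S).trace) := by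
  have hE := posSemidef_exp hS
  -- Golden–Thompson detaches the new summand and its exponential is replaced by the quadratic
  -- majorant. On summation over a, the linear term vanishes.
  have h1 : ∀ a, (NormedSpace.exp (S + x a)).trace
      ≤ (NormedSpace.exp S * (1 + x a + x a * x a)).trace := fun a => by
    refine (trace_exp_add_le hS (hx a)).trans ?_
    have := trace_mul_nonneg hE (posSemidef_quadratic_sub_exp (hx a) (hx1 a))
    rw [Matrix.mul_sub, Matrix.trace_sub] at this
    linarith
  have h2 : ((Fintype.card α * v) • (1 : Matrix d d ℝ) - ∑ a, x a * x a).PosSemidef := by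
    refine Matrix.PosSemidef.of_dotProduct_mulVec_nonneg ?_ fun z => ?_
    · rw [Matrix.IsHermitian, Matrix.conjTranspose_eq_transpose_of_trivial]
      simp [Matrix.transpose_sum, (hx _).eq]
    · rw [Matrix.sub_mulVec, Matrix.smul_mulVec, Matrix.one_mulVec, dotProduct_sub,
        dotProduct_smul, Matrix.sum_mulVec, dotProduct_sum]
      have : ∀ a, star z ⬝ᵥ (x a * x a) *ᵥ z = (x a *ᵥ z) ⬝ᵥ (x a *ᵥ z) := fun a => by
        rw [← Matrix.mulVec_mulVec, Matrix.dotProduct_mulVec]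
        congr 1
        rw [← Matrix.mulVec_transpose, (hx a).eq]; simp
      simp only [this]
      simpa using hv z
  have h3 := trace_mul_nonneg hE h2
  calc _ ≤ ∑ a, (NormedSpace.exp S * (1 + x a + x a * x a)).trace :=
        Finset.sum_le_sum fun a _ => h1 a
    _ = Fintype.card α * (NormedSpace.exp S).trace
        + (NormedSpace.exp S * ∑ a, x a * x a).trace := by
      rw [← Matrix.trace_sum, ← Finset.mul_sum, Finset.sum_add_distrib, Finset.sum_add_distrib,
        hx0, add_zero, Matrix.mul_add, Matrix.trace_add, Finset.sum_const, Finset.card_univ,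
        Matrix.mul_smul, Matrix.mul_one, Matrix.trace_smul, nsmul_eq_mul]
    _ ≤ Fintype.card α * (NormedSpace.exp S).trace
        + Fintype.card α * v * (NormedSpace.exp S).trace := by
      rw [Matrix.mul_sub, Matrix.trace_sub, Matrix.mul_smul, Matrix.mul_one, Matrix.trace_smul,
        smul_eq_mul] at h3
      linarith
    _ = Fintype.card α * ((v + 1) * (NormedSpace.exp S).trace) := by ring
    _ ≤ _ := by
      gcongr
      · exact hE.trace_nonneg
      · exact Real.add_one_le_exp v

lemma sum_trace_exp_sum_le {x : α → Matrix d d ℝ} (hx : ∀ a, (x a).IsSymm) (hx0 : ∑ a, x a = 0)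
    (hx1 : ∀ a (z : d → ℝ), |z ⬝ᵥ x a *ᵥ z| ≤ z ⬝ᵥ z) {v : ℝ}
    (hv : ∀ z : d → ℝ, ∑ a, (x a *ᵥ z) ⬝ᵥ (x a *ᵥ z) ≤ Fintype.card α * v * (z ⬝ᵥ z)) (m : ℕ) :
    ∑ ω : Fin m → α, (NormedSpace.exp (∑ k, x (ω k))).trace
      ≤ (Fintype.card α : ℝ) ^ m * (Real.exp (m * v) * Fintype.card d) := by
  -- The induction over draws ranges over all matrices s, while the one-step bound needs symmetry.
  -- The potential is therefore evaluated at the symmetric part of s, which changes nothing on sums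
  -- of symmetric matrices.
  have hsym : ∀ s : Matrix d d ℝ, ((1 / 2 : ℝ) • (s + sᵀ)).IsSymm := fun s => by
    simp [Matrix.IsSymm, add_comm]
  have hadd : ∀ (s y : Matrix d d ℝ), y.IsSymm →
      (1 / 2 : ℝ) • (s + y + (s + y)ᵀ) = (1 / 2 : ℝ) • (s + sᵀ) + y := fun s y hy => by
    rw [Matrix.transpose_add, hy.eq]; module
  have h := sum_pi_le_of_step (m := m) x
    (fun k s => Real.exp (k * v) * (NormedSpace.exp ((1 / 2 : ℝ) • (s + sᵀ))).trace)
    (fun k _ s => by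
      simp only [hadd s _ (hx _)]
      rw [← Finset.mul_sum]
      refine (mul_le_mul_of_nonneg_left (sum_trace_exp_add_le (hsym s) hx hx0 hx1 hv)
        (Real.exp_pos _).le).trans (le_of_eq ?_)
      rw [Nat.cast_succ, add_mul, one_mul, Real.exp_add]
      ring) 0
  have hs : ∀ ω : Fin m → α, (1 / 2 : ℝ) • (∑ k, x (ω k) + (∑ k, x (ω k))ᵀ) = ∑ k, x (ω k) :=
    fun ω => by
      rw [Matrix.transpose_sum]
      simp only [(hx _).eq]
      module
  simp only [zero_add, hs] at h
  simpa using h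

lemma dotProduct_self_nonneg_real {p : Type*} [Fintype p] (u : p → ℝ) : 0 ≤ u ⬝ᵥ u :=
  Finset.sum_nonneg fun _ _ => mul_self_nonneg _

/-- The variance is at most the second moment: the two sides differ by N‖c‖², with c the mean image
of z. -/
lemma sum_sub_mean_mulVec_le [Nonempty α] {p q : Type*} [Fintype p] [Fintype q]
    (F : α → Matrix p q ℝ) (z : q → ℝ) :
    ∑ a, ((F a - (Fintype.card α : ℝ)⁻¹ • ∑ b, F b) *ᵥ z) ⬝ᵥ
        ((F a - (Fintype.card α : ℝ)⁻¹ • ∑ b, F b) *ᵥ z)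
      ≤ ∑ a, (F a *ᵥ z) ⬝ᵥ (F a *ᵥ z) := by
  have hN : (0 : ℝ) < Fintype.card α := by exact_mod_cast Fintype.card_pos
  set N : ℝ := (Fintype.card α : ℝ) with hNdef
  set c := (N⁻¹ • ∑ b, F b) *ᵥ z with hc
  have h1 : ∑ b, F b *ᵥ z = N • c := by
    rw [hc, Matrix.smul_mulVec, smul_smul, mul_inv_cancel₀ hN.ne', one_smul, Matrix.sum_mulVec]
  have h2 : ∑ a, (F a *ᵥ z) ⬝ᵥ c = N * (c ⬝ᵥ c) := by
    rw [← sum_dotProduct, h1, smul_dotProduct, smul_eq_mul]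
  have h3 : ∑ a, ((F a - N⁻¹ • ∑ b, F b) *ᵥ z) ⬝ᵥ ((F a - N⁻¹ • ∑ b, F b) *ᵥ z)
      = ∑ a, (F a *ᵥ z) ⬝ᵥ (F a *ᵥ z) - N * (c ⬝ᵥ c) := by
    have : ∀ a, ((F a - N⁻¹ • ∑ b, F b) *ᵥ z) ⬝ᵥ ((F a - N⁻¹ • ∑ b, F b) *ᵥ z)
        = (F a *ᵥ z) ⬝ᵥ (F a *ᵥ z) - 2 * ((F a *ᵥ z) ⬝ᵥ c) + c ⬝ᵥ c := fun a => by
      rw [Matrix.sub_mulVec, ← hc, sub_dotProduct, dotProduct_sub, dotProduct_sub,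
        dotProduct_comm c (F a *ᵥ z)]
      ring
    simp only [this, Finset.sum_add_distrib, Finset.sum_sub_distrib, ← Finset.mul_sum, h2,
      Finset.sum_const, Finset.card_univ, nsmul_eq_mul, ← hNdef]
    ring
  rw [h3]
  have : 0 ≤ c ⬝ᵥ c := Finset.sum_nonneg fun _ _ => mul_self_nonneg _
  nlinarith

/-- Matrix Bernstein inequality for `m` independent uniform draws from a finite family of
rectangular matrices, for the deviation of their sum from its mean as a bilinear form. -/
theorem measureReal_bernstein_le {I J : Type*} [Fintype I] [Fintype J] [DecidableEq I]
    [DecidableEq J] [Nonempty α] [MeasurableSpace α] [MeasurableSingletonClass α]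
    (S : α → Matrix I J ℝ) {R v θ t : ℝ} (m : ℕ) (hθ : 0 < θ) (hRθ : 2 * R * θ ≤ 1)
    (hR : ∀ a (u : I → ℝ) (z : J → ℝ), |u ⬝ᵥ S a *ᵥ z| ≤ R * (√(u ⬝ᵥ u) * √(z ⬝ᵥ z)))
    (hv₁ : ∀ u : I → ℝ, ∑ a, ((S a)ᵀ *ᵥ u) ⬝ᵥ ((S a)ᵀ *ᵥ u) ≤ Fintype.card α * v * (u ⬝ᵥ u))
    (hv₂ : ∀ z : J → ℝ, ∑ a, (S a *ᵥ z) ⬝ᵥ (S a *ᵥ z) ≤ Fintype.card α * v * (z ⬝ᵥ z)) :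
    (Measure.pi fun _ : Fin m => uniformOn (Set.univ : Set α)).real
      {ω | ¬ ∀ (u : I → ℝ) (z : J → ℝ),
        |∑ k, u ⬝ᵥ S (ω k) *ᵥ z - m / Fintype.card α * ∑ a, u ⬝ᵥ S a *ᵥ z|
          ≤ t * (√(u ⬝ᵥ u) * √(z ⬝ᵥ z))}
      ≤ (Fintype.card I + Fintype.card J) * Real.exp (θ ^ 2 * (m * v) - θ * t) := by
  have hN : (0 : ℝ) < Fintype.card α := by exact_mod_cast Fintype.card_pos
  set N : ℝ := (Fintype.card α : ℝ) with hNdef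
  set B : Matrix I J ℝ := N⁻¹ • ∑ a, S a with hB
  set C : α → Matrix I J ℝ := fun a => S a - B with hC
  have hCsum : ∑ a, C a = 0 := by
    simp only [hC, Finset.sum_sub_distrib, Finset.sum_const, Finset.card_univ, hB]
    rw [← Nat.cast_smul_eq_nsmul ℝ, ← hNdef, smul_smul, mul_inv_cancel₀ hN.ne', one_smul, sub_self]
  have hBuz : ∀ u z, u ⬝ᵥ B *ᵥ z = N⁻¹ * ∑ a, u ⬝ᵥ S a *ᵥ z := fun u z => by
    rw [hB, Matrix.smul_mulVec, Matrix.sum_mulVec, dotProduct_smul, dotProduct_sum, smul_eq_mul]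
  -- Centering doubles the uniform bound, hence the hypothesis 2Rθ ≤ 1.
  have hCuz : ∀ a (u : I → ℝ) (z : J → ℝ),
      |u ⬝ᵥ C a *ᵥ z| ≤ 2 * R * (√(u ⬝ᵥ u) * √(z ⬝ᵥ z)) := fun a u z => by
    have h1 : |u ⬝ᵥ B *ᵥ z| ≤ R * (√(u ⬝ᵥ u) * √(z ⬝ᵥ z)) := by
      rw [hBuz, abs_mul, abs_of_pos (inv_pos.2 hN), inv_mul_le_iff₀ hN]
      refine (Finset.abs_sum_le_sum_abs _ _).trans
        ((Finset.sum_le_sum fun a _ => hR a u z).trans (le_of_eq ?_))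
      simp [hNdef]
    have h2 := hR a u z
    have h3 : u ⬝ᵥ C a *ᵥ z = u ⬝ᵥ S a *ᵥ z - u ⬝ᵥ B *ᵥ z := by
      simp [hC, Matrix.sub_mulVec, dotProduct_sub]
    rw [h3]
    refine (abs_sub _ _).trans ?_
    linarith
  -- The self-adjoint dilation turns the bilinear form of a rectangular matrix into a quadratic
  -- form, with value 2θ u·Cw at (u, w).
  set x : α → Matrix (I ⊕ J) (I ⊕ J) ℝ :=
    fun a => θ • Matrix.fromBlocks 0 (C a) (C a)ᵀ 0 with hxdef
  have hxs : ∀ a, (x a).IsSymm := fun a => by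
    simp [hxdef, Matrix.IsSymm, Matrix.fromBlocks_transpose]
  have hxz : ∀ (D : Matrix I J ℝ) (u : I → ℝ) (w : J → ℝ),
      Sum.elim u w ⬝ᵥ (θ • Matrix.fromBlocks 0 D Dᵀ 0) *ᵥ Sum.elim u w
        = 2 * θ * (u ⬝ᵥ D *ᵥ w) := fun D u w => by
    rw [Matrix.smul_mulVec, Matrix.fromBlocks_mulVec, dotProduct_smul]
    simp only [Sum.elim_comp_inl, Sum.elim_comp_inr, Matrix.zero_mulVec, zero_add, add_zero,
      sumElim_dotProduct_sumElim, smul_eq_mul]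
    rw [Matrix.mulVec_transpose, dotProduct_comm w, ← Matrix.dotProduct_mulVec]
    ring
  have hzz : ∀ z : I ⊕ J → ℝ, ∃ u w, z = Sum.elim u w := fun z =>
    ⟨z ∘ Sum.inl, z ∘ Sum.inr, by simp⟩
  have hx1 : ∀ a (z : I ⊕ J → ℝ), |z ⬝ᵥ x a *ᵥ z| ≤ z ⬝ᵥ z := fun a z => by
    obtain ⟨u, w, rfl⟩ := hzz z
    rw [hxz, sumElim_dotProduct_sumElim, abs_mul, abs_of_pos (by positivity)]
    have h1 := hCuz a u w
    have h2 : 2 * (√(u ⬝ᵥ u) * √(w ⬝ᵥ w)) ≤ u ⬝ᵥ u + w ⬝ᵥ w := by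
      nlinarith [sq_nonneg (√(u ⬝ᵥ u) - √(w ⬝ᵥ w)),
        Real.sq_sqrt (dotProduct_self_nonneg_real u), Real.sq_sqrt (dotProduct_self_nonneg_real w)]
    have h3 : 0 ≤ √(u ⬝ᵥ u) * √(w ⬝ᵥ w) := by positivity
    calc 2 * θ * |u ⬝ᵥ C a *ᵥ w| ≤ 2 * θ * (2 * R * (√(u ⬝ᵥ u) * √(w ⬝ᵥ w))) := by gcongr
      _ = (2 * R * θ) * (2 * (√(u ⬝ᵥ u) * √(w ⬝ᵥ w))) := by ring
      _ ≤ 1 * (2 * (√(u ⬝ᵥ u) * √(w ⬝ᵥ w))) := by gcongr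
      _ ≤ _ := by linarith
  have hx0 : ∑ a, x a = 0 := by
    have h1 : ∑ a, Matrix.fromBlocks (0 : Matrix I I ℝ) (C a) (C a)ᵀ (0 : Matrix J J ℝ)
        = Matrix.fromBlocks 0 (∑ a, C a) (∑ a, C a)ᵀ 0 := by
      ext i j
      rcases i with i | i <;> rcases j with j | j <;> simp [Matrix.sum_apply]
    rw [hxdef, ← Finset.smul_sum, h1, hCsum]
    simp
  have hxv : ∀ z : I ⊕ J → ℝ, ∑ a, (x a *ᵥ z) ⬝ᵥ (x a *ᵥ z) ≤ N * (θ ^ 2 * v) * (z ⬝ᵥ z) :=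
    fun z => by
      obtain ⟨u, w, rfl⟩ := hzz z
      have h1 : ∀ a, (x a *ᵥ Sum.elim u w) ⬝ᵥ (x a *ᵥ Sum.elim u w)
          = θ ^ 2 * ((C a *ᵥ w) ⬝ᵥ (C a *ᵥ w) + ((C a)ᵀ *ᵥ u) ⬝ᵥ ((C a)ᵀ *ᵥ u)) := fun a => by
        rw [hxdef]
        simp only [Matrix.smul_mulVec, Matrix.fromBlocks_mulVec, dotProduct_smul, smul_dotProduct,
          Sum.elim_comp_inl, Sum.elim_comp_inr, Matrix.zero_mulVec, zero_add, add_zero,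
          sumElim_dotProduct_sumElim, smul_eq_mul]
        ring
      have h2 := (sum_sub_mean_mulVec_le S w).trans (hv₂ w)
      have h3 := (sum_sub_mean_mulVec_le (fun a => (S a)ᵀ) u).trans (hv₁ u)
      have h4 : ∀ a, (S a)ᵀ - N⁻¹ • ∑ b, (S b)ᵀ = (C a)ᵀ := fun a => by
        simp [hC, hB, Matrix.transpose_sum]
      simp only [← hNdef, h4] at h3
      simp only [h1, ← Finset.mul_sum, Finset.sum_add_distrib, sumElim_dotProduct_sumElim]
      have h5 : 0 ≤ θ ^ 2 := sq_nonneg θ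
      calc _ ≤ θ ^ 2 * (N * v * (w ⬝ᵥ w) + N * v * (u ⬝ᵥ u)) :=
            mul_le_mul_of_nonneg_left (add_le_add h2 h3) h5
        _ = _ := by ring
  have hsum := sum_trace_exp_sum_le hxs hx0 hx1 hxv m
  have hblock : ∀ ω : Fin m → α, ∑ k, x (ω k)
      = θ • Matrix.fromBlocks 0 (∑ k, C (ω k)) (∑ k, C (ω k))ᵀ 0 := fun ω => by
    rw [hxdef, ← Finset.smul_sum]
    congr 1
    ext i j
    rcases i with i | i <;> rcases j with j | j <;> simp [Matrix.sum_apply]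
  have hsymω : ∀ ω : Fin m → α, (∑ k, x (ω k)).IsSymm := fun ω => by
    rw [Matrix.IsSymm, Matrix.transpose_sum]; simp only [(hxs _).eq]
  refine measureReal_pi_uniformOn_le
    (f := fun ω => Real.exp (-(θ * t)) * (NormedSpace.exp (∑ k, x (ω k))).trace)
    (fun ω => mul_nonneg (Real.exp_pos _).le (posSemidef_exp (hsymω ω)).trace_nonneg)
    (fun ω hω => ?_) ?_
  · simp only [Set.mem_ofPred_eq, not_forall, not_le] at hω
    obtain ⟨u, z, huz⟩ := hω
    have hdev : ∑ k, u ⬝ᵥ S (ω k) *ᵥ z - m / N * ∑ a, u ⬝ᵥ S a *ᵥ z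
        = u ⬝ᵥ (∑ k, C (ω k)) *ᵥ z := by
      rw [Matrix.sum_mulVec, dotProduct_sum]
      simp only [hC, Matrix.sub_mulVec, dotProduct_sub, hBuz, Finset.sum_sub_distrib,
        Finset.sum_const, Finset.card_univ, Fintype.card_fin, nsmul_eq_mul]
      ring
    rw [hdev] at huz
    set D := ∑ k, C (ω k) with hD
    have key : ∃ y : I ⊕ J → ℝ, θ * t * (y ⬝ᵥ y) < y ⬝ᵥ (∑ k, x (ω k)) *ᵥ y := by
      have hu : 0 < √(u ⬝ᵥ u) := by
        refine lt_of_le_of_ne (Real.sqrt_nonneg _) fun h => ?_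
        have : u = 0 := dotProduct_self_eq_zero.1
          (le_antisymm (Real.sqrt_eq_zero'.1 h.symm) (dotProduct_self_nonneg_real u))
        simp [this] at huz
      have hz : 0 < √(z ⬝ᵥ z) := by
        refine lt_of_le_of_ne (Real.sqrt_nonneg _) fun h => ?_
        have : z = 0 := dotProduct_self_eq_zero.1
          (le_antisymm (Real.sqrt_eq_zero'.1 h.symm) (dotProduct_self_nonneg_real z))
        simp [this] at huz
      obtain ⟨s, hs1, hs2⟩ : ∃ s : ℝ, s * s = 1 ∧ |u ⬝ᵥ D *ᵥ z| = s * (u ⬝ᵥ D *ᵥ z) := by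
        rcases abs_choice (u ⬝ᵥ D *ᵥ z) with h | h
        · exact ⟨1, by simp, by simpa using h⟩
        · exact ⟨-1, by simp, by simpa using h⟩
      -- Both halves are normalised separately, so the test vector has squared length 2; the sign s
      -- makes the bilinear form positive.
      refine ⟨Sum.elim ((s * (√(u ⬝ᵥ u))⁻¹) • u) ((√(z ⬝ᵥ z))⁻¹ • z), ?_⟩
      rw [hblock, hxz, sumElim_dotProduct_sumElim]
      simp only [Matrix.mulVec_smul, dotProduct_smul, smul_dotProduct, smul_eq_mul]
      have e1 : s * (√(u ⬝ᵥ u))⁻¹ * (s * (√(u ⬝ᵥ u))⁻¹ * (u ⬝ᵥ u)) = 1 := by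
        have := Real.mul_self_sqrt (dotProduct_self_nonneg_real u)
        have h6 : u ⬝ᵥ u = √(u ⬝ᵥ u) * √(u ⬝ᵥ u) := this.symm
        calc _ = (s * s) * ((√(u ⬝ᵥ u))⁻¹ * (√(u ⬝ᵥ u))⁻¹ * (u ⬝ᵥ u)) := by ring
          _ = (√(u ⬝ᵥ u))⁻¹ * (√(u ⬝ᵥ u))⁻¹ * (√(u ⬝ᵥ u) * √(u ⬝ᵥ u)) := by rw [hs1, ← h6, one_mul]
          _ = 1 := by field_simp
      have e2 : (√(z ⬝ᵥ z))⁻¹ * ((√(z ⬝ᵥ z))⁻¹ * (z ⬝ᵥ z)) = 1 := by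
        have h6 : z ⬝ᵥ z = √(z ⬝ᵥ z) * √(z ⬝ᵥ z) := (Real.mul_self_sqrt (dotProduct_self_nonneg_real z)).symm
        calc _ = (√(z ⬝ᵥ z))⁻¹ * ((√(z ⬝ᵥ z))⁻¹ * (√(z ⬝ᵥ z) * √(z ⬝ᵥ z))) := by rw [← h6]
          _ = 1 := by field_simp
      rw [e1, e2]
      have h7 : t < (√(u ⬝ᵥ u))⁻¹ * (√(z ⬝ᵥ z))⁻¹ * (s * (u ⬝ᵥ D *ᵥ z)) := by
        rw [← hs2, ← mul_inv, ← div_eq_inv_mul, lt_div_iff₀ (by positivity)]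
        exact huz
      have h8 := mul_lt_mul_of_pos_left h7 (by positivity : 0 < 2 * θ)
      nlinarith
    obtain ⟨y, hy⟩ := key
    have := exp_le_trace_exp_of_lt (hsymω ω) hy
    calc (1 : ℝ) = Real.exp (-(θ * t)) * Real.exp (θ * t) := by rw [← Real.exp_add]; simp
      _ ≤ _ := by gcongr
  · rw [← Finset.mul_sum]
    refine (mul_le_mul_of_nonneg_left hsum (Real.exp_pos _).le).trans (le_of_eq ?_)
    rw [Fintype.card_sum, Nat.cast_add]
    have : Real.exp (θ ^ 2 * (m * v) - θ * t)
        = Real.exp (-(θ * t)) * Real.exp (m * (θ ^ 2 * v)) := by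
      rw [← Real.exp_add]; congr 1; ring
    rw [this]; ring

end Bernstein

end EDG

namespace EDG

open Matrix

variable {n : ℕ}

/-! ### The trace inner product and the Frobenius norm -/

lemma ip_eq_sum (A B : Matrix (Fin n) (Fin n) ℝ) : ip A B = ∑ i, ∑ j, A i j * B i j := by
  rw [ip, Matrix.trace, Finset.sum_comm]
  simp [Matrix.mul_apply]

lemma ip_comm (A B : Matrix (Fin n) (Fin n) ℝ) : ip A B = ip B A := by
  simp only [ip_eq_sum, mul_comm]

lemma ip_add_left (A B C : Matrix (Fin n) (Fin n) ℝ) : ip (A + B) C = ip A C + ip B C := by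
  simp [ip, Matrix.add_mul]

lemma ip_add_right (A B C : Matrix (Fin n) (Fin n) ℝ) : ip A (B + C) = ip A B + ip A C := by
  simp [ip, Matrix.mul_add]

lemma ip_sub_left (A B C : Matrix (Fin n) (Fin n) ℝ) : ip (A - B) C = ip A C - ip B C := by
  simp [ip, Matrix.sub_mul]

lemma ip_sub_right (A B C : Matrix (Fin n) (Fin n) ℝ) : ip A (B - C) = ip A B - ip A C := by
  simp [ip, Matrix.mul_sub]

lemma ip_smul_left (c : ℝ) (A B : Matrix (Fin n) (Fin n) ℝ) : ip (c • A) B = c * ip A B := by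
  simp [ip]

lemma ip_smul_right (c : ℝ) (A B : Matrix (Fin n) (Fin n) ℝ) : ip A (c • B) = c * ip A B := by
  simp [ip]

lemma ip_sum_right {ι : Type*} (s : Finset ι) (A : Matrix (Fin n) (Fin n) ℝ)
    (f : ι → Matrix (Fin n) (Fin n) ℝ) : ip A (∑ k ∈ s, f k) = ∑ k ∈ s, ip A (f k) := by
  simp [ip, Matrix.mul_sum, Matrix.trace_sum]

lemma ip_mul_left (M A B : Matrix (Fin n) (Fin n) ℝ) : ip (M * A) B = ip A (Mᵀ * B) := by
  simp [ip, Matrix.transpose_mul, Matrix.mul_assoc]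

lemma ip_mul_right (M A B : Matrix (Fin n) (Fin n) ℝ) : ip (A * M) B = ip A (B * Mᵀ) := by
  rw [ip, ip, Matrix.transpose_mul, Matrix.mul_assoc, Matrix.trace_mul_comm, Matrix.mul_assoc]

lemma ip_transpose (A B : Matrix (Fin n) (Fin n) ℝ) : ip Aᵀ Bᵀ = ip A B := by
  rw [ip_eq_sum, ip_eq_sum, Finset.sum_comm]; rfl

lemma ip_self_nonneg (A : Matrix (Fin n) (Fin n) ℝ) : 0 ≤ ip A A := by
  rw [ip_eq_sum]
  exact Finset.sum_nonneg fun i _ => Finset.sum_nonneg fun j _ => mul_self_nonneg _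

lemma frob_nonneg (A : Matrix (Fin n) (Fin n) ℝ) : 0 ≤ frob A := Real.sqrt_nonneg _

lemma frob_sq (A : Matrix (Fin n) (Fin n) ℝ) : frob A ^ 2 = ip A A :=
  Real.sq_sqrt (ip_self_nonneg A)

lemma frob_sq_eq_sum (A : Matrix (Fin n) (Fin n) ℝ) : frob A ^ 2 = ∑ i, ∑ j, A i j ^ 2 := by
  rw [frob_sq, ip_eq_sum]; simp only [sq]

lemma sq_ip_le (A B : Matrix (Fin n) (Fin n) ℝ) : ip A B ^ 2 ≤ ip A A * ip B B := by
  simp only [ip_eq_sum, ← Fintype.sum_prod_type (f := fun x : Fin n × Fin n => A x.1 x.2 * B x.1 x.2),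
    ← Fintype.sum_prod_type (f := fun x : Fin n × Fin n => A x.1 x.2 * A x.1 x.2),
    ← Fintype.sum_prod_type (f := fun x : Fin n × Fin n => B x.1 x.2 * B x.1 x.2)]
  refine (Finset.sum_mul_sq_le_sq_mul_sq _ _ _).trans (le_of_eq ?_)
  simp only [sq]

lemma abs_ip_le (A B : Matrix (Fin n) (Fin n) ℝ) : |ip A B| ≤ frob A * frob B := by
  refine abs_le_of_sq_le_sq ?_ (mul_nonneg (frob_nonneg _) (frob_nonneg _))
  rw [mul_pow, frob_sq, frob_sq]
  exact sq_ip_le A B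

lemma ip_le (A B : Matrix (Fin n) (Fin n) ℝ) : ip A B ≤ frob A * frob B :=
  (le_abs_self _).trans (abs_ip_le A B)

lemma frob_add_le (A B : Matrix (Fin n) (Fin n) ℝ) : frob (A + B) ≤ frob A + frob B := by
  refine le_of_sq_le_sq ?_ (add_nonneg (frob_nonneg _) (frob_nonneg _))
  have h1 := ip_le A B
  rw [frob_sq, ip_add_left, ip_add_right, ip_add_right, add_sq, frob_sq, frob_sq, ip_comm B A]
  linarith

lemma frob_smul (c : ℝ) (A : Matrix (Fin n) (Fin n) ℝ) : frob (c • A) = |c| * frob A := by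
  rw [frob, ip_smul_left, ip_smul_right, ← mul_assoc, Real.sqrt_mul (mul_self_nonneg c),
    Real.sqrt_mul_self_eq_abs, frob]

lemma frob_neg (A : Matrix (Fin n) (Fin n) ℝ) : frob (-A) = frob A := by
  rw [← neg_one_smul ℝ A, frob_smul]; simp

lemma frob_sub_comm (A B : Matrix (Fin n) (Fin n) ℝ) : frob (A - B) = frob (B - A) := by
  rw [← frob_neg, neg_sub]

lemma frob_transpose (A : Matrix (Fin n) (Fin n) ℝ) : frob Aᵀ = frob A := by
  rw [frob, ip_transpose, frob]

lemma frob_eq_zero {A : Matrix (Fin n) (Fin n) ℝ} : frob A = 0 ↔ A = 0 := by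
  constructor
  · intro h
    have h2 := frob_sq_eq_sum A
    rw [h, zero_pow two_ne_zero] at h2
    ext i j
    have h3 := (Finset.sum_eq_zero_iff_of_nonneg
      (fun i _ => Finset.sum_nonneg fun j _ => sq_nonneg (A i j))).1 h2.symm i (Finset.mem_univ i)
    have h4 := (Finset.sum_eq_zero_iff_of_nonneg (fun j _ => sq_nonneg (A i j))).1 h3 j
      (Finset.mem_univ j)
    simpa using h4
  · rintro rfl; simp [frob, ip]

/-! ### The operator norm -/

lemma norm_toLp_sq (z : Fin n → ℝ) : ‖(WithLp.toLp 2 z : EuclideanSpace ℝ (Fin n))‖ ^ 2 = z ⬝ᵥ z := by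
  rw [EuclideanSpace.norm_sq_eq]
  simp [dotProduct, sq]

lemma opNorm_nonneg (A : Matrix (Fin n) (Fin n) ℝ) : 0 ≤ opNorm A := norm_nonneg _

lemma mulVec_dotProduct_self_le (A : Matrix (Fin n) (Fin n) ℝ) (z : Fin n → ℝ) :
    (A *ᵥ z) ⬝ᵥ (A *ᵥ z) ≤ opNorm A ^ 2 * (z ⬝ᵥ z) := by
  have h := (Matrix.toEuclideanCLM (n := Fin n) (𝕜 := ℝ) A).le_opNorm (WithLp.toLp 2 z)
  rw [Matrix.toEuclideanCLM_toLp] at h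
  rw [← norm_toLp_sq, ← norm_toLp_sq, ← mul_pow]
  exact pow_le_pow_left₀ (norm_nonneg _) h 2

lemma opNorm_le_of_forall {A : Matrix (Fin n) (Fin n) ℝ} {c : ℝ} (hc : 0 ≤ c)
    (h : ∀ z : Fin n → ℝ, (A *ᵥ z) ⬝ᵥ (A *ᵥ z) ≤ c ^ 2 * (z ⬝ᵥ z)) : opNorm A ≤ c := by
  refine ContinuousLinearMap.opNorm_le_bound _ hc fun x => ?_
  have h1 := h x.ofLp
  rw [← norm_toLp_sq, ← norm_toLp_sq, ← mul_pow] at h1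
  exact le_of_sq_le_sq h1 (by positivity)

lemma opNorm_transpose (A : Matrix (Fin n) (Fin n) ℝ) : opNorm Aᵀ = opNorm A := by
  have h : Aᵀ = star A := by
    rw [Matrix.star_eq_conjTranspose, Matrix.conjTranspose_eq_transpose_of_trivial]
  rw [opNorm, h, map_star]
  exact ContinuousLinearMap.adjoint.norm_map _

lemma frob_mul_le (M A : Matrix (Fin n) (Fin n) ℝ) : frob (M * A) ≤ opNorm M * frob A := by
  refine le_of_sq_le_sq ?_ (mul_nonneg (opNorm_nonneg _) (frob_nonneg _))
  rw [mul_pow, frob_sq_eq_sum, frob_sq_eq_sum, Finset.sum_comm, Finset.sum_comm (f := fun i j => A i j ^ 2),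
    Finset.mul_sum]
  refine Finset.sum_le_sum fun j _ => ?_
  have := mulVec_dotProduct_self_le M (fun i => A i j)
  simpa [dotProduct, Matrix.mulVec, Matrix.mul_apply, sq] using this

lemma frob_mul_le' (A M : Matrix (Fin n) (Fin n) ℝ) : frob (A * M) ≤ frob A * opNorm M := by
  rw [← frob_transpose, Matrix.transpose_mul, ← opNorm_transpose, ← frob_transpose A, mul_comm]
  exact frob_mul_le _ _

lemma opNorm_le_frob (A : Matrix (Fin n) (Fin n) ℝ) : opNorm A ≤ frob A := by
  refine opNorm_le_of_forall (frob_nonneg _) fun z => ?_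
  rw [frob_sq_eq_sum, Finset.sum_mul, dotProduct]
  refine Finset.sum_le_sum fun i _ => ?_
  have h := Finset.sum_mul_sq_le_sq_mul_sq Finset.univ (A i) z
  simpa [dotProduct, Matrix.mulVec, sq] using h

lemma opNorm_le_of_bilin {A : Matrix (Fin n) (Fin n) ℝ} {c : ℝ} (hc : 0 ≤ c)
    (h : ∀ u z : Fin n → ℝ, |u ⬝ᵥ A *ᵥ z| ≤ c * (√(u ⬝ᵥ u) * √(z ⬝ᵥ z))) : opNorm A ≤ c := by
  refine opNorm_le_of_forall hc fun z => ?_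
  have h1 := (le_abs_self _).trans (h (A *ᵥ z) z)
  set p := (A *ᵥ z) ⬝ᵥ (A *ᵥ z)
  have hp : 0 ≤ p := dotProduct_self_nonneg_real _
  have hz : 0 ≤ z ⬝ᵥ z := dotProduct_self_nonneg_real _
  have h2 : √p ≤ c * √(z ⬝ᵥ z) := by
    rcases eq_or_lt_of_le (Real.sqrt_nonneg p) with h0 | h0
    · rw [← h0]; positivity
    · have h3 : √p * √p ≤ √p * (c * √(z ⬝ᵥ z)) := by
        rw [Real.mul_self_sqrt hp]; linarith
      exact le_of_mul_le_mul_left h3 h0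
  have h4 := pow_le_pow_left₀ (Real.sqrt_nonneg p) h2 2
  rwa [Real.sq_sqrt hp, mul_pow, Real.sq_sqrt hz] at h4

lemma abs_dotProduct_le {d : Type*} [Fintype d] (u z : d → ℝ) :
    |u ⬝ᵥ z| ≤ √(u ⬝ᵥ u) * √(z ⬝ᵥ z) := by
  rw [← Real.sqrt_mul (dotProduct_self_nonneg_real u)]
  refine Real.abs_le_sqrt ?_
  have := Finset.sum_mul_sq_le_sq_mul_sq Finset.univ u z
  simpa [dotProduct, sq] using this

/-! ### Orthogonal projections and tangent spaces -/

/-- `P` is the matrix of an orthogonal projection. -/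
structure IsOrthProj (P : Matrix (Fin n) (Fin n) ℝ) : Prop where
  symm : Pᵀ = P
  idem : P * P = P

namespace IsOrthProj

variable {P : Matrix (Fin n) (Fin n) ℝ}

lemma one_sub (h : IsOrthProj P) : IsOrthProj (1 - P) :=
  ⟨by rw [Matrix.transpose_sub, h.symm, Matrix.transpose_one],
    by rw [Matrix.sub_mul, Matrix.mul_sub P, h.idem]; simp⟩

lemma mulVec_add (h : IsOrthProj P) (z : Fin n → ℝ) :
    (P *ᵥ z) ⬝ᵥ (P *ᵥ z) + ((1 - P) *ᵥ z) ⬝ᵥ ((1 - P) *ᵥ z) = z ⬝ᵥ z := by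
  have key : ∀ {Q : Matrix (Fin n) (Fin n) ℝ}, IsOrthProj Q → (Q *ᵥ z) ⬝ᵥ (Q *ᵥ z) = z ⬝ᵥ Q *ᵥ z :=
    fun {Q} hQ => by
      rw [Matrix.dotProduct_mulVec, ← Matrix.mulVec_transpose, hQ.symm, Matrix.mulVec_mulVec,
        hQ.idem, dotProduct_comm]
  rw [key h, key h.one_sub, Matrix.sub_mulVec, Matrix.one_mulVec, dotProduct_sub]
  ring

lemma opNorm_le_one (h : IsOrthProj P) : opNorm P ≤ 1 := by
  refine opNorm_le_of_forall zero_le_one fun z => ?_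
  have h1 := h.mulVec_add z
  have h2 := dotProduct_self_nonneg_real ((1 - P) *ᵥ z)
  linarith

lemma frob_mul_le (h : IsOrthProj P) (A : Matrix (Fin n) (Fin n) ℝ) : frob (P * A) ≤ frob A := by
  have h1 := EDG.frob_mul_le P A
  nlinarith [h.opNorm_le_one, frob_nonneg A]

lemma frob_mul_le' (h : IsOrthProj P) (A : Matrix (Fin n) (Fin n) ℝ) : frob (A * P) ≤ frob A := by
  have h1 := EDG.frob_mul_le' A P
  nlinarith [h.opNorm_le_one, frob_nonneg A]

lemma sum_sq_row (h : IsOrthProj P) (i : Fin n) : ∑ k, P i k ^ 2 = P i i := by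
  have h1 : (P * P) i i = P i i := by rw [h.idem]
  rw [← h1, Matrix.mul_apply]
  refine Finset.sum_congr rfl fun k _ => ?_
  have h2 : P k i = P i k := congrFun (congrFun h.symm i) k
  rw [h2, sq]

end IsOrthProj

/-- The tangent projection `Z ↦ P Z + Z P - P Z P` attached to a projection matrix `P`. -/
def tangent (P Z : Matrix (Fin n) (Fin n) ℝ) : Matrix (Fin n) (Fin n) ℝ :=
  P * Z + Z * P - P * Z * P

lemma tanProj_eq (X Z : Matrix (Fin n) (Fin n) ℝ) : tanProj X Z = tangent (colProj X) Z := rfl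

section tangent

variable {P : Matrix (Fin n) (Fin n) ℝ}

lemma sub_tangent (P Z : Matrix (Fin n) (Fin n) ℝ) :
    Z - tangent P Z = (1 - P) * Z * (1 - P) := by
  rw [tangent]; noncomm_ring

lemma tangent_add (P Y Z : Matrix (Fin n) (Fin n) ℝ) :
    tangent P (Y + Z) = tangent P Y + tangent P Z := by
  simp only [tangent]; noncomm_ring

lemma tangent_sub (P Y Z : Matrix (Fin n) (Fin n) ℝ) :
    tangent P (Y - Z) = tangent P Y - tangent P Z := by
  simp only [tangent]; noncomm_ring

lemma tangent_smul (P Y : Matrix (Fin n) (Fin n) ℝ) (c : ℝ) :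
    tangent P (c • Y) = c • tangent P Y := by
  simp only [tangent, Matrix.mul_smul, Matrix.smul_mul]; module

lemma tangent_tangent (hP : IsOrthProj P) (Z : Matrix (Fin n) (Fin n) ℝ) :
    tangent P (tangent P Z) = tangent P Z := by
  have h : tangent P Z - tangent P (tangent P Z) = 0 := by
    rw [sub_tangent]
    have : tangent P Z = Z - (1 - P) * Z * (1 - P) := by rw [← sub_tangent]; abel
    rw [this, Matrix.mul_sub (1 - P) Z, Matrix.sub_mul ((1 - P) * Z)]
    have e : (1 - P) * ((1 - P) * Z * (1 - P)) * (1 - P)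
        = ((1 - P) * (1 - P)) * Z * ((1 - P) * (1 - P)) := by simp only [Matrix.mul_assoc]
    rw [e, hP.one_sub.idem, sub_self]
  exact (sub_eq_zero.1 h).symm

lemma ip_tangent (hP : IsOrthProj P) (Y Z : Matrix (Fin n) (Fin n) ℝ) :
    ip (tangent P Y) Z = ip Y (tangent P Z) := by
  simp only [tangent, ip_add_left, ip_sub_left, ip_add_right, ip_sub_right]
  rw [ip_mul_right P Y, ip_mul_right P (P * Y), ip_mul_left P Y, ip_mul_left P Y, hP.symm,
    Matrix.mul_assoc]

lemma ip_tangent_sub (hP : IsOrthProj P) (Y Z : Matrix (Fin n) (Fin n) ℝ) :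
    ip (tangent P Y) (Z - tangent P Z) = 0 := by
  rw [ip_tangent hP, tangent_sub, tangent_tangent hP, sub_self]; simp [ip]

lemma frob_tangent_sq_add (hP : IsOrthProj P) (Z : Matrix (Fin n) (Fin n) ℝ) :
    frob (tangent P Z) ^ 2 + frob (Z - tangent P Z) ^ 2 = frob Z ^ 2 := by
  have h := ip_tangent_sub hP Z Z
  have h2 : Z = tangent P Z + (Z - tangent P Z) := by abel
  have h3 : ip Z Z = ip (tangent P Z + (Z - tangent P Z)) (tangent P Z + (Z - tangent P Z)) := by
    rw [← h2]
  rw [frob_sq, frob_sq, frob_sq, h3, ip_add_left, ip_add_right, ip_add_right, h,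
    ip_comm (Z - tangent P Z) (tangent P Z), h]
  ring

lemma frob_tangent_le (hP : IsOrthProj P) (Z : Matrix (Fin n) (Fin n) ℝ) :
    frob (tangent P Z) ≤ frob Z := by
  refine le_of_sq_le_sq ?_ (frob_nonneg _)
  nlinarith [frob_tangent_sq_add hP Z, sq_nonneg (frob (Z - tangent P Z))]

/-- If the range of `Q` is close to that of `P`, then a matrix tangent at `Q` is almost tangent
at `P`. -/
lemma frob_sub_tangent_le {Q : Matrix (Fin n) (Fin n) ℝ} (hP : IsOrthProj P) (hQ : IsOrthProj Q)
    {η : ℝ} (h : opNorm ((1 - P) * Q) ≤ η) {A : Matrix (Fin n) (Fin n) ℝ} (hA : tangent Q A = A) :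
    frob (A - tangent P A) ≤ 2 * η * frob A := by
  have h0 : A - tangent P A = ((1 - P) * Q) * (A * (1 - P))
      + ((1 - P) * ((1 - Q) * A)) * ((1 - P) * Q)ᵀ := by
    rw [sub_tangent, Matrix.transpose_mul, hQ.symm, hP.one_sub.symm]
    have h1 : A = Q * A + (1 - Q) * A * Q := by
      nth_rw 1 [← hA]; rw [tangent]; noncomm_ring
    nth_rw 1 [h1]
    noncomm_ring
  have hη : 0 ≤ η := (opNorm_nonneg _).trans h
  rw [h0]
  have h1 : frob (((1 - P) * Q) * (A * (1 - P))) ≤ η * frob A :=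
    (EDG.frob_mul_le _ _).trans (mul_le_mul h (hP.one_sub.frob_mul_le' A) (frob_nonneg _) hη)
  have h2 : frob (((1 - P) * ((1 - Q) * A)) * ((1 - P) * Q)ᵀ) ≤ frob A * η := by
    refine (EDG.frob_mul_le' _ _).trans (mul_le_mul ?_ ?_ (opNorm_nonneg _) (frob_nonneg _))
    · exact (hP.one_sub.frob_mul_le _).trans (hQ.one_sub.frob_mul_le _)
    · rwa [opNorm_transpose]
  refine (frob_add_le _ _).trans ?_
  linarith

/-- Entries of a tangent matrix are small when the diagonal of `P` is. -/
lemma tangent_entry_sq_le (hP : IsOrthProj P) {ρ : ℝ} (hρ : ∀ i, P i i ≤ ρ)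
    {A : Matrix (Fin n) (Fin n) ℝ} (hA : tangent P A = A) (i j : Fin n) :
    A i j ^ 2 ≤ 2 * ρ * ((∑ k, (A * (1 - P)) k j ^ 2) + ∑ k, A i k ^ 2) := by
  -- A = P · A(1−P) + A · P. Each product contains a row of P, whose squared length is a diagonal
  -- entry, at most ρ; Cauchy–Schwarz then applies to both.
  have h1 : A i j = ∑ k, P i k * (A * (1 - P)) k j + ∑ k, P j k * A i k := by
    have h2 : A = P * (A * (1 - P)) + A * P := by
      nth_rw 1 [← hA]; rw [tangent]; noncomm_ring
    have h3 : ∀ k, P k j = P j k := fun k => congrFun (congrFun hP.symm j) k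
    calc A i j = (P * (A * (1 - P)) + A * P) i j := by rw [← h2]
      _ = _ := by
        rw [Matrix.add_apply, Matrix.mul_apply, Matrix.mul_apply (M := A) (N := P)]
        simp only [h3, mul_comm (A i _)]
  have c1 := Finset.sum_mul_sq_le_sq_mul_sq Finset.univ (P i) (fun k => (A * (1 - P)) k j)
  have c2 := Finset.sum_mul_sq_le_sq_mul_sq Finset.univ (P j) (A i)
  rw [hP.sum_sq_row] at c1 c2
  have hb : 0 ≤ ∑ k, (A * (1 - P)) k j ^ 2 := Finset.sum_nonneg fun _ _ => sq_nonneg _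
  have ha : 0 ≤ ∑ k, A i k ^ 2 := Finset.sum_nonneg fun _ _ => sq_nonneg _
  have d1 := c1.trans (mul_le_mul_of_nonneg_right (hρ i) hb)
  have d2 := c2.trans (mul_le_mul_of_nonneg_right (hρ j) ha)
  rw [h1]
  nlinarith [sq_nonneg (∑ k, P i k * (A * (1 - P)) k j - ∑ k, P j k * A i k)]

/-- Weighted sums of squared entries of a tangent matrix. -/
lemma tangent_sum_entry_sq_le (hP : IsOrthProj P) {ρ : ℝ} (hρ : ∀ i, P i i ≤ ρ) (hρ0 : 0 ≤ ρ)
    {A : Matrix (Fin n) (Fin n) ℝ} (hA : tangent P A = A) {T : Fin n → Fin n → ℝ}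
    (hT : ∀ i j, 0 ≤ T i j) {D : ℝ} (hD : 0 ≤ D) (hrow : ∀ i, ∑ j, T i j ≤ D)
    (hcol : ∀ j, ∑ i, T i j ≤ D) :
    ∑ i, ∑ j, T i j * A i j ^ 2 ≤ 4 * ρ * D * frob A ^ 2 := by
  have hb : ∑ j, ∑ k, (A * (1 - P)) k j ^ 2 ≤ frob A ^ 2 := by
    rw [Finset.sum_comm, ← frob_sq_eq_sum]
    exact pow_le_pow_left₀ (frob_nonneg _) (hP.one_sub.frob_mul_le' A) 2
  have ha : ∑ i, ∑ k, A i k ^ 2 = frob A ^ 2 := (frob_sq_eq_sum A).symm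
  set b : Fin n → ℝ := fun j => ∑ k, (A * (1 - P)) k j ^ 2 with hbdef
  set a : Fin n → ℝ := fun i => ∑ k, A i k ^ 2 with hadef
  have hb0 : ∀ j, 0 ≤ b j := fun j => Finset.sum_nonneg fun _ _ => sq_nonneg _
  have ha0 : ∀ j, 0 ≤ a j := fun j => Finset.sum_nonneg fun _ _ => sq_nonneg _
  calc ∑ i, ∑ j, T i j * A i j ^ 2 ≤ ∑ i, ∑ j, T i j * (2 * ρ * (b j + a i)) :=
        Finset.sum_le_sum fun i _ => Finset.sum_le_sum fun j _ =>
          mul_le_mul_of_nonneg_left (tangent_entry_sq_le hP hρ hA i j) (hT i j)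
    _ = 2 * ρ * (∑ j, (∑ i, T i j) * b j + ∑ i, (∑ j, T i j) * a i) := by
        simp only [Finset.sum_mul]
        rw [Finset.sum_comm (f := fun j i => T i j * b j), ← Finset.sum_add_distrib, Finset.mul_sum]
        refine Finset.sum_congr rfl fun i _ => ?_
        rw [← Finset.sum_add_distrib, Finset.mul_sum]
        exact Finset.sum_congr rfl fun j _ => by ring
    _ ≤ 2 * ρ * (∑ j, D * b j + ∑ i, D * a i) := by
        gcongr with j _ i _
        exacts [hcol j, hrow i]
    _ = 2 * ρ * (D * ∑ j, b j + D * ∑ i, a i) := by rw [Finset.mul_sum, Finset.mul_sum]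
    _ ≤ 2 * ρ * (D * frob A ^ 2 + D * frob A ^ 2) := by
        rw [ha]; gcongr
    _ = _ := by ring

lemma tangent_sum_diag_sq_le (hP : IsOrthProj P) {ρ : ℝ} (hρ : ∀ i, P i i ≤ ρ) (hρ0 : 0 ≤ ρ)
    {A : Matrix (Fin n) (Fin n) ℝ} (hA : tangent P A = A) :
    ∑ i, A i i ^ 2 ≤ 4 * ρ * frob A ^ 2 := by
  have h := tangent_sum_entry_sq_le hP hρ hρ0 hA (T := fun i j => if i = j then 1 else 0)
    (fun i j => by split_ifs <;> simp) (D := 1) zero_le_one (fun i => by simp) (fun j => by simp)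
  simpa using h

end tangent

end EDG

namespace EDG

open Matrix Module

variable {n : ℕ}

/-! ### The projection onto the column space -/

lemma rank_eq_finrank_range (X : Matrix (Fin n) (Fin n) ℝ) :
    X.rank = finrank ℝ (LinearMap.range (Matrix.toEuclideanLin X)) := by
  rw [Matrix.rank_eq_finrank_range_toLin X (PiLp.basisFun 2 ℝ (Fin n)) (PiLp.basisFun 2 ℝ (Fin n)),
    ← Matrix.toLpLin_eq_toLin]

lemma toEuclideanLin_apply_toLp (X : Matrix (Fin n) (Fin n) ℝ) (z : Fin n → ℝ) :
    Matrix.toEuclideanLin X (WithLp.toLp 2 z) = WithLp.toLp 2 (X *ᵥ z) := rfl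

lemma toLp_colProj_mulVec (X : Matrix (Fin n) (Fin n) ℝ) (z : Fin n → ℝ) :
    WithLp.toLp 2 (colProj X *ᵥ z)
      = (LinearMap.range (Matrix.toEuclideanLin X)).starProjection (WithLp.toLp 2 z) := by
  rw [← Matrix.toEuclideanCLM_toLp, colProj, StarAlgEquiv.apply_symm_apply]

lemma isOrthProj_colProj (X : Matrix (Fin n) (Fin n) ℝ) : IsOrthProj (colProj X) := by
  refine ⟨colProj_isSymm X, ?_⟩
  rw [colProj, ← map_mul, (Submodule.isIdempotentElem_starProjection _).eq]

lemma colProj_mul_self (X : Matrix (Fin n) (Fin n) ℝ) : colProj X * X = X := by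
  refine Matrix.toLin'.injective (LinearMap.ext fun z => ?_)
  rw [Matrix.toLin'_apply, Matrix.toLin'_apply, ← Matrix.mulVec_mulVec]
  have h := toLp_colProj_mulVec X (X *ᵥ z)
  have hmem : WithLp.toLp 2 (X *ᵥ z) ∈ LinearMap.range (Matrix.toEuclideanLin X) :=
    ⟨WithLp.toLp 2 z, toEuclideanLin_apply_toLp X z⟩
  rw [Submodule.starProjection_eq_self_iff.2 hmem] at h
  exact congrArg WithLp.ofLp h

lemma self_mul_colProj {X : Matrix (Fin n) (Fin n) ℝ} (hX : X.IsSymm) : X * colProj X = X := by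
  have h := congrArg Matrix.transpose (colProj_mul_self X)
  rwa [Matrix.transpose_mul, hX.eq, (colProj_isSymm X).eq] at h

lemma colProj_mulVec_eq_zero {X : Matrix (Fin n) (Fin n) ℝ} (hX : X.IsSymm) {z : Fin n → ℝ}
    (hz : X *ᵥ z = 0) : colProj X *ᵥ z = 0 := by
  have h : (LinearMap.range (Matrix.toEuclideanLin X)).starProjection (WithLp.toLp 2 z) = 0 := by
    rw [Submodule.starProjection_apply_eq_zero_iff, Submodule.mem_orthogonal]
    rintro _ ⟨y, rfl⟩
    have h1 : Matrix.toEuclideanLin X y = WithLp.toLp 2 (X *ᵥ y.ofLp) := rfl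
    rw [h1, EuclideanSpace.inner_toLp_toLp, star_trivial, Matrix.dotProduct_mulVec,
      ← Matrix.mulVec_transpose, hX.eq, hz, zero_dotProduct]
  rw [← toLp_colProj_mulVec] at h
  exact congrArg WithLp.ofLp h

lemma trace_colProj (X : Matrix (Fin n) (Fin n) ℝ) : (colProj X).trace = X.rank := by
  have h1 : Matrix.toEuclideanLin (colProj X)
      = (LinearMap.range (Matrix.toEuclideanLin X)).starProjection.toLinearMap := by
    refine LinearMap.ext fun z => ?_
    exact toLp_colProj_mulVec X z.ofLp
  have h2 : LinearMap.IsProj (LinearMap.range (Matrix.toEuclideanLin X))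
      (LinearMap.range (Matrix.toEuclideanLin X)).starProjection.toLinearMap :=
    ⟨fun x => Submodule.starProjection_apply_mem _ x,
      fun x hx => Submodule.starProjection_eq_self_iff.2 hx⟩
  rw [rank_eq_finrank_range, ← h2.trace, ← h1]
  exact (Matrix.trace_toLin_eq _ (PiLp.basisFun 2 ℝ (Fin n))).symm

lemma sum_colProj_diag (X : Matrix (Fin n) (Fin n) ℝ) : ∑ i, colProj X i i = X.rank :=
  trace_colProj X

/-- Two subspaces, the second of at most the dimension of the first: if unit vectors of the first
are within `η < 1` of the second, then conversely. -/
lemma norm_sub_starProjection_le {E : Type*} [NormedAddCommGroup E] [InnerProductSpace ℝ E]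
    [FiniteDimensional ℝ E] (K₁ K₂ : Submodule ℝ E) (hd : finrank ℝ K₂ ≤ finrank ℝ K₁)
    {η : ℝ} (hη0 : 0 ≤ η) (hη : η < 1) (h : ∀ x ∈ K₁, ‖x - K₂.starProjection x‖ ≤ η * ‖x‖)
    {y : E} (hy : y ∈ K₂) : ‖y - K₁.starProjection y‖ ≤ η * ‖y‖ := by
  -- Since η < 1, projecting K₁ to K₂ is injective, hence bijective by dimension. So y is the
  -- projection of some x in K₁ with (1−η²)‖x‖² ≤ ‖y‖².
  let f : K₁ →ₗ[ℝ] K₂ := K₂.orthogonalProjectionOnto.toLinearMap ∘ₗ K₁.subtype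
  have hf : ∀ x : K₁, ((f x : K₂) : E) = K₂.starProjection x := fun x => rfl
  have hinj : Function.Injective f := by
    refine (injective_iff_map_eq_zero f).2 fun x hx => ?_
    have h1 := h x x.2
    rw [← hf, hx, Submodule.coe_zero, sub_zero] at h1
    have h2 : ‖(x : E)‖ = 0 := by nlinarith [norm_nonneg (x : E)]
    exact Subtype.ext (norm_eq_zero.1 h2)
  have hsurj := (LinearMap.injective_iff_surjective_of_finrank_eq_finrank
    (le_antisymm (LinearMap.finrank_le_finrank_of_injective hinj) hd)).1 hinj
  obtain ⟨x, hx⟩ := hsurj ⟨y, hy⟩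
  have hxy : K₂.starProjection x = y := by rw [← hf, hx]
  have p1 := Submodule.norm_sq_eq_add_norm_sq_starProjection (x : E) K₂
  rw [Submodule.starProjection_orthogonal_val, hxy] at p1
  have h1 := h x x.2
  rw [hxy] at h1
  have p2 := Submodule.norm_sq_eq_add_norm_sq_starProjection y K₁
  rw [Submodule.starProjection_orthogonal_val] at p2
  -- Cauchy–Schwarz in this identity, with the bound on ‖x‖, gives ‖P₁y‖² ≥ (1−η²)‖y‖², where P₁ is
  -- the projection to K₁.
  have h2 : ‖y‖ ^ 2 = inner ℝ (K₁.starProjection y) (x : E) := by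
    rw [Submodule.inner_starProjection_left_eq_right, Submodule.starProjection_eq_self_iff.2 x.2]
    rw [← real_inner_self_eq_norm_sq]
    have h3 := Submodule.starProjection_inner_eq_zero (K := K₂) (x : E) y hy
    rw [hxy, inner_sub_left, real_inner_comm] at h3
    linarith
  have h3 : ‖y‖ ^ 2 ≤ ‖K₁.starProjection y‖ * ‖(x : E)‖ := h2 ▸ real_inner_le_norm _ _
  have h4 : ‖(x : E) - y‖ ^ 2 ≤ η ^ 2 * ‖(x : E)‖ ^ 2 := by
    rw [← mul_pow]; exact pow_le_pow_left₀ (norm_nonneg _) h1 2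
  refine le_of_sq_le_sq ?_ (by positivity)
  rcases eq_or_lt_of_le (norm_nonneg y) with h0 | h0
  · have : y = 0 := norm_eq_zero.1 h0.symm
    simp [this]
  have h5 : (‖y‖ ^ 2) ^ 2 ≤ ‖K₁.starProjection y‖ ^ 2 * ‖(x : E)‖ ^ 2 := by
    rw [← mul_pow]; exact pow_le_pow_left₀ (by positivity) h3 2
  have h6 : 0 < 1 - η ^ 2 := by nlinarith
  have h7 : (1 - η ^ 2) * ‖(x : E)‖ ^ 2 ≤ ‖y‖ ^ 2 := by nlinarith
  have h8 : (1 - η ^ 2) * ‖y‖ ^ 2 ≤ ‖K₁.starProjection y‖ ^ 2 := by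
    have h9 : (1 - η ^ 2) * (‖y‖ ^ 2) ^ 2 ≤ ‖K₁.starProjection y‖ ^ 2 * ‖y‖ ^ 2 := by
      nlinarith [sq_nonneg ‖K₁.starProjection y‖]
    have h10 : 0 < ‖y‖ ^ 2 := by positivity
    refine le_of_mul_le_mul_right ?_ h10
    nlinarith
  nlinarith

/-- Perturbation theory controls P_X(1−P_Y) only: X is bounded below on its range, while nothing is
known of the small singular values of Y. The comparison of ranks supplies the opposite gap. -/
lemma opNorm_one_sub_colProj_mul_le {X Y : Matrix (Fin n) (Fin n) ℝ} (hr : Y.rank ≤ X.rank)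
    {η : ℝ} (hη : η < 1) (h : opNorm (colProj X * (1 - colProj Y)) ≤ η) :
    opNorm ((1 - colProj X) * colProj Y) ≤ η := by
  have hη0 : 0 ≤ η := (opNorm_nonneg _).trans h
  have h' : opNorm ((1 - colProj Y) * colProj X) ≤ η := by
    rw [← opNorm_transpose, Matrix.transpose_mul, (isOrthProj_colProj X).symm,
      (isOrthProj_colProj Y).one_sub.symm]
    exact h
  rw [rank_eq_finrank_range, rank_eq_finrank_range] at hr
  have key := fun y hy => norm_sub_starProjection_le _ _ hr hη0 hη (fun x hx => by
    have h1 := mulVec_dotProduct_self_le ((1 - colProj Y) * colProj X) x.ofLp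
    have h2 : WithLp.toLp 2 (colProj X *ᵥ x.ofLp) = x := by
      rw [toLp_colProj_mulVec]; exact Submodule.starProjection_eq_self_iff.2 hx
    have h3 : colProj X *ᵥ x.ofLp = x.ofLp := congrArg WithLp.ofLp h2
    rw [← Matrix.mulVec_mulVec, h3, Matrix.sub_mulVec, Matrix.one_mulVec, ← norm_toLp_sq,
      ← norm_toLp_sq, WithLp.toLp_sub, toLp_colProj_mulVec, ← mul_pow] at h1
    have h4 := le_of_sq_le_sq h1 (mul_nonneg (opNorm_nonneg _) (norm_nonneg _))
    exact h4.trans (mul_le_mul_of_nonneg_right h' (norm_nonneg _))) (y := y) hy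
  refine opNorm_le_of_forall hη0 fun z => ?_
  have h1 := key (WithLp.toLp 2 (colProj Y *ᵥ z)) (by
    rw [toLp_colProj_mulVec]; exact Submodule.starProjection_apply_mem _ _)
  rw [← toLp_colProj_mulVec, ← WithLp.toLp_sub] at h1
  have h2 := pow_le_pow_left₀ (norm_nonneg _) h1 2
  rw [mul_pow, norm_toLp_sq, norm_toLp_sq] at h2
  rw [← Matrix.mulVec_mulVec, Matrix.sub_mulVec, Matrix.one_mulVec]
  refine h2.trans (mul_le_mul_of_nonneg_left ?_ (sq_nonneg η))
  have h3 := (isOrthProj_colProj Y).mulVec_add z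
  have h4 := dotProduct_self_nonneg_real ((1 - colProj Y) *ᵥ z)
  linarith

/-- The smallest nonzero singular value bounds a symmetric matrix from below on its range. -/
lemma singularValue_mul_le {X : Matrix (Fin n) (Fin n) ℝ} (hX : X.IsSymm) (hr : 1 ≤ X.rank)
    (z : Fin n → ℝ) :
    (Matrix.toEuclideanLin X).singularValues (X.rank - 1) ^ 2
      * ((colProj X *ᵥ z) ⬝ᵥ (colProj X *ᵥ z)) ≤ (X *ᵥ z) ⬝ᵥ (X *ᵥ z) := by
  set T := Matrix.toEuclideanLin X with hT
  set x : EuclideanSpace ℝ (Fin n) := WithLp.toLp 2 (colProj X *ᵥ z) with hx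
  have hTx : T x = WithLp.toLp 2 (X *ᵥ z) := by
    rw [hx, hT, toEuclideanLin_apply_toLp, Matrix.mulVec_mulVec, self_mul_colProj hX]
  have hxr : x ∈ LinearMap.range T := by
    rw [hx, toLp_colProj_mulVec]; exact Submodule.starProjection_apply_mem _ _
  have hTs : ∀ a b : EuclideanSpace ℝ (Fin n), inner ℝ (T a) b = inner ℝ a (T b) := fun a b => by
    have h1 : T a = WithLp.toLp 2 (X *ᵥ a.ofLp) := rfl
    have h2 : T b = WithLp.toLp 2 (X *ᵥ b.ofLp) := rfl
    rw [h1, h2, EuclideanSpace.inner_eq_star_dotProduct, EuclideanSpace.inner_eq_star_dotProduct]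
    simp only [star_trivial]
    rw [Matrix.dotProduct_mulVec, ← Matrix.mulVec_transpose, hX.eq]
  have hfr : finrank ℝ (EuclideanSpace ℝ (Fin n)) = n := finrank_euclideanSpace_fin
  set b := T.isSymmetric_adjoint_comp_self.eigenvectorBasis hfr with hb
  set l := T.isSymmetric_adjoint_comp_self.eigenvalues hfr with hl
  have hsv : ∀ i : Fin n, l i = T.singularValues i ^ 2 := fun i =>
    (T.sq_singularValues_fin hfr i).symm
  have hTb : ∀ i j, inner ℝ (T (b i)) (T (b j)) = if i = j then l i else 0 := fun i j => by
    rw [← LinearMap.adjoint_inner_left]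
    have : LinearMap.adjoint T (T (b i)) = l i • b i :=
      T.isSymmetric_adjoint_comp_self.apply_eigenvectorBasis hfr i
    rw [this, inner_smul_left, orthonormal_iff_ite.1 b.orthonormal i j]
    simp
  have hnx : ‖T x‖ ^ 2 = ∑ i, l i * (inner ℝ (b i) x) ^ 2 := by
    have h1 : T x = ∑ i, inner ℝ (b i) x • T (b i) := by
      conv_lhs => rw [← b.sum_repr' x]
      rw [map_sum]; simp only [map_smul]
    rw [← real_inner_self_eq_norm_sq, h1, sum_inner]
    refine Finset.sum_congr rfl fun i _ => ?_
    rw [inner_sum]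
    simp only [inner_smul_left, inner_smul_right, hTb]
    simp; ring
  have hxx : ‖x‖ ^ 2 = ∑ i, (inner ℝ (b i) x) ^ 2 := by
    rw [← b.sum_sq_norm_inner_right x]; simp
  have e1 : (X *ᵥ z) ⬝ᵥ (X *ᵥ z) = ‖T x‖ ^ 2 := by rw [hTx, norm_toLp_sq]
  have e2 : (colProj X *ᵥ z) ⬝ᵥ (colProj X *ᵥ z) = ‖x‖ ^ 2 := by rw [hx, norm_toLp_sq]
  rw [e1, e2, hnx, hxx, Finset.mul_sum]
  refine Finset.sum_le_sum fun i _ => ?_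
  -- Singular values are numbered from 0, so those of index at least the rank vanish. Their
  -- eigenvectors lie in the kernel and are orthogonal to x by symmetry.
  by_cases hi : (i : ℕ) < X.rank
  · refine mul_le_mul_of_nonneg_right ?_ (sq_nonneg _)
    rw [hsv]
    exact pow_le_pow_left₀ (T.singularValues_nonneg _)
      (T.singularValues_antitone (by omega)) 2
  · have hli : l i = 0 := by
      rw [hsv, (T.singularValues_eq_zero_iff_le_finrank_range).2
        (by rw [← rank_eq_finrank_range]; omega)]
      simp
    have hTbi : T (b i) = 0 := by
      have := hTb i i
      rw [if_pos rfl, hli] at this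
      exact inner_self_eq_zero.1 this
    obtain ⟨y, hy⟩ := hxr
    have : inner ℝ (b i) x = 0 := by rw [← hy, ← hTs, hTbi, inner_zero_left]
    rw [this]; simp

lemma singularValue_pos {X : Matrix (Fin n) (Fin n) ℝ} (hr : 1 ≤ X.rank) :
    0 < (Matrix.toEuclideanLin X).singularValues (X.rank - 1) := by
  rw [LinearMap.singularValues_pos_iff_lt_finrank_range, ← rank_eq_finrank_range]
  omega

end EDG

namespace EDG

open Matrix Module

variable {n : ℕ}

/-! ### Hard thresholding -/

lemma rank_add_le (A B : Matrix (Fin n) (Fin n) ℝ) : (A + B).rank ≤ A.rank + B.rank := by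
  rw [Matrix.rank, Matrix.rank, Matrix.rank, Matrix.mulVecLin_add]
  exact (Submodule.finrank_mono (LinearMap.range_add_le _ _)).trans
    (Submodule.finrank_add_le_finrank_add_finrank _ _)

lemma rank_smul_le (c : ℝ) (A : Matrix (Fin n) (Fin n) ℝ) : (c • A).rank ≤ A.rank := by
  have : c • A = (c • (1 : Matrix (Fin n) (Fin n) ℝ)) * A := by simp
  rw [this]; exact Matrix.rank_mul_le_right _ _

lemma rank_sub_le (A B : Matrix (Fin n) (Fin n) ℝ) : (A - B).rank ≤ A.rank + B.rank := by
  have : A - B = A + (-1 : ℝ) • B := by module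
  rw [this]
  exact (rank_add_le _ _).trans (Nat.add_le_add_left (rank_smul_le _ _) _)

lemma IsHardThreshold.rank_le {r : ℕ} {Y Z : Matrix (Fin n) (Fin n) ℝ}
    (h : IsHardThreshold r Y Z) : Z.rank ≤ r := by
  obtain ⟨u, lam, -, -, rfl⟩ := h
  have h1 : ∀ s : Finset (Fin n),
      (∑ i ∈ s, lam i • Matrix.vecMulVec (u i).ofLp (u i).ofLp).rank ≤ s.card := fun s => by
    induction s using Finset.induction_on with
    | empty => simp
    | insert a s ha ih =>
      rw [Finset.sum_insert ha, Finset.card_insert_of_notMem ha, add_comm s.card]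
      exact (rank_add_le _ _).trans (Nat.add_le_add
        ((rank_smul_le _ _).trans (Matrix.rank_vecMulVec_le _ _)) ih)
  refine (h1 _).trans ?_
  have : (Finset.univ.filter fun i : Fin n => i.val < r).card ≤ (Finset.range r).card :=
    Finset.card_le_card_of_injOn (fun i => i.val) (fun i hi => by simpa using hi)
      (fun a _ b _ hab => Fin.ext hab)
  simpa using this

lemma IsHardThreshold.smul {r : ℕ} {Y Z : Matrix (Fin n) (Fin n) ℝ} (c : ℝ)
    (h : IsHardThreshold r Y Z) : IsHardThreshold r (c • Y) (c • Z) := by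
  obtain ⟨u, lam, hl, rfl, rfl⟩ := h
  refine ⟨u, fun i => c * lam i, fun i j hij => ?_, ?_, ?_⟩
  · simp only [abs_mul]; exact mul_le_mul_of_nonneg_left (hl hij) (abs_nonneg c)
  · rw [Finset.smul_sum]; simp only [smul_smul]
  · rw [Finset.smul_sum]; simp only [smul_smul]

lemma vecMulVec_basis_mulVec (u : OrthonormalBasis (Fin n) ℝ (EuclideanSpace ℝ (Fin n)))
    (lam : Fin n → ℝ) (s : Finset (Fin n)) (z : Fin n → ℝ) :
    (∑ i ∈ s, lam i • Matrix.vecMulVec (u i).ofLp (u i).ofLp) *ᵥ z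
      = ∑ i ∈ s, (lam i * ((u i).ofLp ⬝ᵥ z)) • (u i).ofLp := by
  rw [Matrix.sum_mulVec]
  refine Finset.sum_congr rfl fun i _ => ?_
  ext k
  simp [Matrix.mulVec, dotProduct, Matrix.vecMulVec_apply, Finset.mul_sum,
    Finset.sum_mul]
  exact Finset.sum_congr rfl fun j _ => by ring

lemma basis_dotProduct (u : OrthonormalBasis (Fin n) ℝ (EuclideanSpace ℝ (Fin n))) (i j : Fin n) :
    (u i).ofLp ⬝ᵥ (u j).ofLp = if i = j then 1 else 0 := by
  rw [← orthonormal_iff_ite.1 u.orthonormal i j, EuclideanSpace.inner_eq_star_dotProduct,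
    star_trivial, dotProduct_comm]

lemma vecMulVec_basis_mulVec_self (u : OrthonormalBasis (Fin n) ℝ (EuclideanSpace ℝ (Fin n)))
    (lam : Fin n → ℝ) (s : Finset (Fin n)) (j : Fin n) :
    (∑ i ∈ s, lam i • Matrix.vecMulVec (u i).ofLp (u i).ofLp) *ᵥ (u j).ofLp
      = if j ∈ s then lam j • (u j).ofLp else 0 := by
  rw [vecMulVec_basis_mulVec]
  simp [basis_dotProduct, ite_smul]

lemma IsHardThreshold.isCentered {r : ℕ} {Y Z : Matrix (Fin n) (Fin n) ℝ}
    (h : IsHardThreshold r Y Z) (hY : IsCentered Y) : IsCentered Z := by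
  refine ⟨h.isSymm, fun k => ?_⟩
  obtain ⟨u, lam, -, hYe, rfl⟩ := h
  have h1 : Y *ᵥ (fun _ => 1) = 0 := by
    ext i; simpa [Matrix.mulVec, dotProduct] using hY.2 i
  have h2 : ∀ j, lam j * ((u j).ofLp ⬝ᵥ fun _ => 1) = 0 := fun j => by
    have h3 : (u j).ofLp ⬝ᵥ (Y *ᵥ fun _ => 1) = 0 := by rw [h1, dotProduct_zero]
    rw [hYe, vecMulVec_basis_mulVec, dotProduct_sum] at h3
    simpa [dotProduct_smul, basis_dotProduct] using h3
  have h4 := vecMulVec_basis_mulVec u lam (Finset.univ.filter fun i => i.val < r) (fun _ => 1)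
  simp only [h2, zero_smul, Finset.sum_const_zero] at h4
  have h5 := congrFun h4 k
  simpa [Matrix.mulVec, dotProduct] using h5

lemma frob_sq_eq_sum_basis (u : OrthonormalBasis (Fin n) ℝ (EuclideanSpace ℝ (Fin n)))
    (M : Matrix (Fin n) (Fin n) ℝ) :
    frob M ^ 2 = ∑ i, (M *ᵥ (u i).ofLp) ⬝ᵥ (M *ᵥ (u i).ofLp) := by
  rw [frob_sq_eq_sum]
  simp only [dotProduct]
  rw [Finset.sum_comm (f := fun i x => (M *ᵥ (u i).ofLp) x * (M *ᵥ (u i).ofLp) x)]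
  refine Finset.sum_congr rfl fun k _ => ?_
  have h := u.sum_sq_norm_inner_right (WithLp.toLp 2 (M k))
  rw [norm_toLp_sq] at h
  simp only [dotProduct] at h
  simp only [sq]
  rw [← h]
  refine Finset.sum_congr rfl fun i _ => ?_
  rw [EuclideanSpace.inner_eq_star_dotProduct, star_trivial, Real.norm_eq_abs, sq_abs, sq]
  rfl

/-- The Eckart–Young theorem in the Frobenius norm, for symmetric matrices. -/
theorem IsHardThreshold.frob_sub_le {r : ℕ} {Y Z B : Matrix (Fin n) (Fin n) ℝ}
    (h : IsHardThreshold r Y Z) (hB : B.rank ≤ r) : frob (Y - Z) ≤ frob (Y - B) := by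
  obtain ⟨u, lam, hl, hY, hZ⟩ := h
  set Q := colProj B with hQdef
  have hQ : IsOrthProj Q := isOrthProj_colProj B
  refine le_of_sq_le_sq ?_ (frob_nonneg _)
  have hYu : ∀ i, Y *ᵥ (u i).ofLp = lam i • (u i).ofLp := fun i => by
    rw [hY, vecMulVec_basis_mulVec_self]; simp
  have hZu : ∀ i, Z *ᵥ (u i).ofLp = if i.val < r then lam i • (u i).ofLp else 0 := fun i => by
    rw [hZ, vecMulVec_basis_mulVec_self]; simp
  have huu : ∀ i, (u i).ofLp ⬝ᵥ (u i).ofLp = 1 := fun i => by rw [basis_dotProduct]; simp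
  set q : Fin n → ℝ := fun i => (Q *ᵥ (u i).ofLp) ⬝ᵥ (Q *ᵥ (u i).ofLp) with hq
  have hq0 : ∀ i, 0 ≤ q i := fun i => dotProduct_self_nonneg_real _
  have hq1 : ∀ i, ((1 - Q) *ᵥ (u i).ofLp) ⬝ᵥ ((1 - Q) *ᵥ (u i).ofLp) = 1 - q i := fun i => by
    have := hQ.mulVec_add (u i).ofLp
    rw [huu] at this; linarith
  have hq1' : ∀ i, q i ≤ 1 := fun i => by
    have := dotProduct_self_nonneg_real ((1 - Q) *ᵥ (u i).ofLp)
    rw [hq1] at this; linarith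
  have hqs : ∑ i, q i ≤ r := by
    rw [hq, ← frob_sq_eq_sum_basis, frob_sq, ip, hQ.symm, hQ.idem, hQdef, trace_colProj]
    exact_mod_cast hB
  have h1 : frob (Y - Z) ^ 2 = ∑ i : Fin n, if i.val < r then 0 else lam i ^ 2 := by
    rw [frob_sq_eq_sum_basis u]
    refine Finset.sum_congr rfl fun i _ => ?_
    rw [Matrix.sub_mulVec, hYu, hZu]
    split_ifs
    · simp
    · rw [sub_zero, smul_dotProduct, dotProduct_smul, huu]; simp [sq]
  -- Multiplying by 1 − Q kills B and does not increase the norm, so B enters only through the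
  -- weights q_i.
  have h2 : ∑ i, lam i ^ 2 * (1 - q i) ≤ frob (Y - B) ^ 2 := by
    have h3 : frob ((1 - Q) * (Y - B)) ^ 2 ≤ frob (Y - B) ^ 2 :=
      pow_le_pow_left₀ (frob_nonneg _) (hQ.one_sub.frob_mul_le _) 2
    have h4 : (1 - Q) * (Y - B) = (1 - Q) * Y := by
      rw [Matrix.mul_sub, Matrix.sub_mul 1 Q B, hQdef, colProj_mul_self]; simp
    rw [h4, frob_sq_eq_sum_basis u] at h3
    refine le_trans (le_of_eq (Finset.sum_congr rfl fun i _ => ?_)) h3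
    rw [← Matrix.mulVec_mulVec, hYu, Matrix.mulVec_smul, smul_dotProduct, dotProduct_smul, hq1]
    simp [sq]; ring
  rw [h1]
  refine le_trans ?_ h2
  by_cases hrn : r < n
  -- The square of the first discarded eigenvalue, at position r counted from 0. Comparing every
  -- term with c is the exchange argument: the weights q_i ≤ 1, of total at most r, are best spent
  -- on the first r eigenvalues.
  · set c : ℝ := lam ⟨r, hrn⟩ ^ 2
    have hsq : ∀ i j : Fin n, i ≤ j → lam j ^ 2 ≤ lam i ^ 2 := fun i j hij => by
      rw [← sq_abs (lam j), ← sq_abs (lam i)]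
      exact pow_le_pow_left₀ (abs_nonneg _) (hl hij) 2
    have h5 : ∀ i : Fin n, (if i.val < r then 0 else lam i ^ 2)
        ≤ lam i ^ 2 * (1 - q i) + c * (q i - if i.val < r then 1 else 0) := fun i => by
      split_ifs with hi
      · have h6 : c ≤ lam i ^ 2 := hsq i ⟨r, hrn⟩ (by rw [Fin.le_def]; exact hi.le)
        nlinarith [hq1' i]
      · have h6 : lam i ^ 2 ≤ c := hsq ⟨r, hrn⟩ i (by rw [Fin.le_def]; exact not_lt.1 hi)
        nlinarith [hq0 i]
    refine (Finset.sum_le_sum fun i _ => h5 i).trans ?_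
    rw [Finset.sum_add_distrib, ← Finset.mul_sum, Finset.sum_sub_distrib]
    have h7 : ∑ i : Fin n, (if i.val < r then (1 : ℝ) else 0) = r := by
      rw [Fin.sum_univ_eq_sum_range (fun i => if i < r then (1 : ℝ) else 0) n, ← Finset.sum_filter]
      have : (Finset.range n).filter (· < r) = Finset.range r := by
        ext i; simp; omega
      rw [this]; simp
    rw [h7]
    have : 0 ≤ c := sq_nonneg _
    nlinarith
  · refine Finset.sum_le_sum fun i _ => ?_
    rw [if_pos (by omega)]
    exact mul_nonneg (sq_nonneg _) (by linarith [hq1' i])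

lemma abs_ip_le_opNorm (M D : Matrix (Fin n) (Fin n) ℝ) :
    |ip M D| ≤ opNorm M * √D.rank * frob D := by
  set Q := colProj D with hQdef
  have hQ : IsOrthProj Q := isOrthProj_colProj D
  have h1 : ip M D = ip (Q * M) D := by
    rw [ip_mul_left, hQ.symm, hQdef, colProj_mul_self]
  have h2 : frob (Q * M) ≤ √D.rank * opNorm M := by
    have h3 : frob Q = √D.rank := by
      rw [frob, ip, hQ.symm, hQ.idem, hQdef, trace_colProj]
    rw [← h3]; exact frob_mul_le' Q M
  rw [h1]
  refine (abs_ip_le _ _).trans ?_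
  have := mul_le_mul_of_nonneg_right h2 (frob_nonneg D)
  linarith

/-- Expanding ‖Y−Z‖² ≤ ‖Y−X‖² gives ‖Z−X‖² ≤ 2⟨Y−X, Z−X⟩, and Z − X has rank at most 2r. This serves
the initial guess, where the operator norm is what concentrates. -/
lemma IsHardThreshold.frob_sub_le_opNorm {r : ℕ} {Y Z X : Matrix (Fin n) (Fin n) ℝ}
    (h : IsHardThreshold r Y Z) (hX : X.rank ≤ r) :
    frob (Z - X) ≤ 2 * √(2 * r) * opNorm (Y - X) := by
  have h1 := pow_le_pow_left₀ (frob_nonneg _) (h.frob_sub_le hX) 2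
  have h2 : Y - Z = (Y - X) - (Z - X) := by abel
  have h3 : frob (Z - X) ^ 2 ≤ 2 * ip (Y - X) (Z - X) := by
    rw [h2, frob_sq, frob_sq, ip_sub_left (Y - X) (Z - X), ip_sub_right (Y - X) (Y - X),
      ip_sub_right (Z - X) (Y - X), ip_comm (Z - X) (Y - X)] at h1
    rw [frob_sq]; linarith
  have h4 := (le_abs_self _).trans (abs_ip_le_opNorm (Y - X) (Z - X))
  have h5 : √((Z - X).rank : ℝ) ≤ √(2 * r) := by
    refine Real.sqrt_le_sqrt ?_
    have h6 : (Z - X).rank ≤ 2 * r := by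
      have := rank_sub_le Z X; have := h.rank_le; omega
    exact_mod_cast h6
  have h7 : opNorm (Y - X) * √((Z - X).rank : ℝ) ≤ opNorm (Y - X) * √(2 * r) :=
    mul_le_mul_of_nonneg_left h5 (opNorm_nonneg _)
  rcases eq_or_lt_of_le (frob_nonneg (Z - X)) with h0 | h0
  · rw [← h0]; have := opNorm_nonneg (Y - X); positivity
  · refine le_of_mul_le_mul_right ?_ h0
    nlinarith

end EDG

namespace EDG

open Matrix

variable {n m : ℕ}

/-! ### Pairs and centered matrices -/

lemma sum_eq_sum_diag_add_sum_pair (f : Fin n → Fin n → ℝ) :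
    ∑ i, ∑ j, f i j = ∑ i, f i i + ∑ a : Pair n, (f a.1.1 a.1.2 + f a.1.2 a.1.1) := by
  have h1 : ∀ g : Fin n × Fin n → ℝ, ∑ a : Pair n, g a.1 = ∑ x, if x.1 < x.2 then g x else 0 :=
    fun g => by
      rw [← Finset.sum_filter]
      exact (Finset.sum_subtype _ (fun x => by simp) g).symm
  have h2 : ∑ a : Pair n, (f a.1.1 a.1.2 + f a.1.2 a.1.1)
      = ∑ i, ∑ j, ((if i < j then f i j else 0) + if j < i then f i j else 0) := by
    rw [h1 (fun x => f x.1 x.2 + f x.2 x.1), Fintype.sum_prod_type]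
    simp only [Finset.sum_add_distrib, ite_add_zero]
    congr 1
    rw [Finset.sum_comm]
  have h3 : ∑ i, f i i = ∑ i, ∑ j, if i = j then f i j else 0 := by simp
  rw [h2, h3, ← Finset.sum_add_distrib]
  refine Finset.sum_congr rfl fun i _ => ?_
  rw [← Finset.sum_add_distrib]
  refine Finset.sum_congr rfl fun j _ => ?_
  rcases lt_trichotomy i j with h | h | h
  · simp [h, h.ne, h.not_gt]
  · simp [h]
  · simp [h, h.ne', h.not_gt]

lemma card_pair (n : ℕ) : (Fintype.card (Pair n) : ℝ) = numPairs n := by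
  have h := sum_eq_sum_diag_add_sum_pair (n := n) (fun _ _ => 1)
  simp at h
  rw [numPairs]; linarith

lemma isCentered_iff {Y : Matrix (Fin n) (Fin n) ℝ} :
    IsCentered Y ↔ Yᵀ = Y ∧ Y *ᵥ (fun _ => 1) = 0 := by
  refine and_congr Iff.rfl ⟨fun h => ?_, fun h i => ?_⟩
  · ext i; simpa [Matrix.mulVec, dotProduct] using h i
  · simpa [Matrix.mulVec, dotProduct] using congrFun h i

lemma IsCentered.add {Y Z : Matrix (Fin n) (Fin n) ℝ} (hY : IsCentered Y) (hZ : IsCentered Z) :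
    IsCentered (Y + Z) := by
  rw [isCentered_iff] at *
  exact ⟨by rw [Matrix.transpose_add, hY.1, hZ.1], by rw [Matrix.add_mulVec, hY.2, hZ.2, add_zero]⟩

lemma IsCentered.smul {Y : Matrix (Fin n) (Fin n) ℝ} (c : ℝ) (hY : IsCentered Y) :
    IsCentered (c • Y) := by
  rw [isCentered_iff] at *
  exact ⟨by rw [Matrix.transpose_smul, hY.1], by rw [Matrix.smul_mulVec, hY.2, smul_zero]⟩

lemma IsCentered.sub {Y Z : Matrix (Fin n) (Fin n) ℝ} (hY : IsCentered Y) (hZ : IsCentered Z) :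
    IsCentered (Y - Z) := by
  have := hY.add (hZ.smul (-1)); rwa [neg_one_smul, ← sub_eq_add_neg] at this

lemma IsCentered.apply_comm {Y : Matrix (Fin n) (Fin n) ℝ} (hY : IsCentered Y) (i j : Fin n) :
    Y i j = Y j i := congrFun (congrFun hY.1 j) i

lemma IsCentered.tangent {X Y : Matrix (Fin n) (Fin n) ℝ} (hX : IsCentered X) (hY : IsCentered Y) :
    IsCentered (tangent (colProj X) Y) := by
  have hP := isOrthProj_colProj X
  have h1 : colProj X *ᵥ (fun _ => 1) = 0 := colProj_mulVec_eq_zero hX.1 (isCentered_iff.1 hX).2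
  rw [isCentered_iff] at hY ⊢
  refine ⟨?_, ?_⟩
  · simp only [EDG.tangent, Matrix.transpose_add, Matrix.transpose_sub, Matrix.transpose_mul,
      hP.symm, hY.1, Matrix.mul_assoc]
    abel
  · simp only [EDG.tangent, Matrix.add_mulVec, Matrix.sub_mulVec, ← Matrix.mulVec_mulVec, h1, hY.2,
      Matrix.mulVec_zero]
    simp

/-- A centered matrix does not see the projection in the vectors `centered i`, so v_α reads off one
entry. -/
lemma ip_v {Y : Matrix (Fin n) (Fin n) ℝ} (hY : IsCentered Y) (a : Pair n) :
    ip Y (v a) = -Y a.1.1 a.1.2 := by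
  have hc : ∀ i, Y *ᵥ centered i = fun k => Y k i := fun i => by
    ext k
    simp [Matrix.mulVec, dotProduct, centered, mul_sub, Finset.sum_sub_distrib, ← Finset.sum_mul,
      hY.2 k]
  have hv : ∀ i j, ip Y (Matrix.vecMulVec (centered i) (centered j)) = Y i j := fun i j => by
    have h1 : ip Y (Matrix.vecMulVec (centered i) (centered j)) = centered i ⬝ᵥ Y *ᵥ centered j := by
      rw [ip_eq_sum]
      simp only [dotProduct, Matrix.mulVec, Matrix.vecMulVec_apply, Finset.mul_sum]
      exact Finset.sum_congr rfl fun k _ => Finset.sum_congr rfl fun l _ => by ring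
    have h2 : (Y *ᵥ centered i) j = Y j i := congrFun (hc i) j
    rw [h1, hc]
    have h3 : (Y *ᵥ centered i) j = Y i j := h2.trans (hY.apply_comm j i)
    rw [← h3]
    simp only [Matrix.mulVec, dotProduct]
    exact Finset.sum_congr rfl fun k _ => by rw [hY.apply_comm k j]; ring
  rw [v, ip_smul_right, ip_add_right, hv, hv, hY.apply_comm a.1.2]
  ring

lemma ip_w_of_isCentered {Y : Matrix (Fin n) (Fin n) ℝ} (hY : IsCentered Y) (a : Pair n) :
    ip Y (w a) = Y a.1.1 a.1.1 + Y a.1.2 a.1.2 - 2 * Y a.1.1 a.1.2 := by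
  rw [ip_w, hY.apply_comm a.1.2 a.1.1]; ring

/-- The full sum ∑_{i,j} A_ij d_i vanishes with the row sums, leaving the diagonal. The right side,
times p, is the mean that the diagonal estimate of a good sample compares with. -/
lemma sum_pair_diag {A : Matrix (Fin n) (Fin n) ℝ} (hA : IsCentered A) (d : Fin n → ℝ) :
    ∑ a : Pair n, A a.1.1 a.1.2 * (d a.1.1 + d a.1.2) = -∑ i, A i i * d i := by
  have h := sum_eq_sum_diag_add_sum_pair (fun i j => A i j * d i)
  have h1 : ∑ i, ∑ j, A i j * d i = 0 := by
    simp only [← Finset.sum_mul, hA.2]; simp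
  have h2 : ∀ a : Pair n, A a.1.1 a.1.2 * d a.1.1 + A a.1.2 a.1.1 * d a.1.2
      = A a.1.1 a.1.2 * (d a.1.1 + d a.1.2) := fun a => by rw [hA.apply_comm a.1.2 a.1.1]; ring
  simp only [h2] at h
  linarith

/-- The families `v` and `w` are dual bases of the space of centered matrices. -/
lemma sum_ip_v_mul_ip_w {A B : Matrix (Fin n) (Fin n) ℝ} (hA : IsCentered A) (hB : IsCentered B) :
    ∑ a, ip A (v a) * ip B (w a) = ip A B := by
  have h1 := sum_pair_diag hA (fun i => B i i)
  have h2 := sum_eq_sum_diag_add_sum_pair (fun i j => A i j * B i j)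
  rw [← ip_eq_sum] at h2
  have h3 : ∀ a : Pair n, ip A (v a) * ip B (w a)
      = -(A a.1.1 a.1.2 * (B a.1.1 a.1.1 + B a.1.2 a.1.2))
        + (A a.1.1 a.1.2 * B a.1.1 a.1.2 + A a.1.2 a.1.1 * B a.1.2 a.1.1) := fun a => by
    rw [ip_v hA, ip_w_of_isCentered hB, hA.apply_comm a.1.2 a.1.1, hB.apply_comm a.1.2 a.1.1]
    ring
  simp only [h3, Finset.sum_add_distrib, Finset.sum_neg_distrib] at h2 ⊢
  linarith

lemma isCentered_sum {ι : Type*} (s : Finset ι) {f : ι → Matrix (Fin n) (Fin n) ℝ}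
    (h : ∀ k, IsCentered (f k)) : IsCentered (∑ k ∈ s, f k) := by
  induction s using Finset.cons_induction with
  | empty => simp [isCentered_iff]
  | cons a s ha ih => rw [Finset.sum_cons]; exact (h a).add ih

/-- The difference D of the two sides is centered, and duality gives ⟨D, D⟩ = 0. -/
lemma sum_ip_w_smul_v {X : Matrix (Fin n) (Fin n) ℝ} (hX : IsCentered X) :
    ∑ a, ip X (w a) • v a = X := by
  have hS : IsCentered (∑ a, ip X (w a) • v a) :=
    isCentered_sum _ fun a => (isCentered_v a).smul _
  have hD := hS.sub hX
  set D := ∑ a, ip X (w a) • v a - X with hDdef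
  have h : ip D D = 0 := by
    have h1 : ip D D = ip D (∑ a, ip X (w a) • v a) - ip D X := by
      nth_rw 2 [hDdef]; rw [ip_sub_right]
    rw [h1, ip_sum_right, ← sum_ip_v_mul_ip_w hD hX]
    simp only [ip_smul_right, mul_comm, sub_self]
  have h2 : D = 0 := frob_eq_zero.1 (by rw [frob, h, Real.sqrt_zero])
  exact sub_eq_zero.1 h2

lemma isCentered_sampling (ω : Fin m → Pair n) (Y : Matrix (Fin n) (Fin n) ℝ) :
    IsCentered (sampling ω Y) :=
  isCentered_sum _ fun k => (isCentered_v (ω k)).smul _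

lemma sampling_add (ω : Fin m → Pair n) (Y Z : Matrix (Fin n) (Fin n) ℝ) :
    sampling ω (Y + Z) = sampling ω Y + sampling ω Z := by
  simp [sampling, ip_add_left, add_smul, Finset.sum_add_distrib]

lemma sampling_neg (ω : Fin m → Pair n) (Y : Matrix (Fin n) (Fin n) ℝ) :
    sampling ω (-Y) = -sampling ω Y := by
  rw [← neg_one_smul ℝ Y, ← neg_one_smul ℝ (sampling ω Y)]
  simp only [sampling, ip_smul_left, Finset.smul_sum, smul_smul]

lemma ip_sampling (ω : Fin m → Pair n) (A B : Matrix (Fin n) (Fin n) ℝ) :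
    ip A (sampling ω B) = ∑ k, ip A (v (ω k)) * ip B (w (ω k)) := by
  simp only [sampling, ip_sum_right, ip_smul_right, mul_comm]

/-! ### Multiplicities of the sampled pairs -/

/-- Indicator that the pair `a` consists of `i` and `j`. -/
def incid (a : Pair n) (i j : Fin n) : ℕ :=
  (if a.1 = (i, j) then 1 else 0) + if a.1 = (j, i) then 1 else 0

/-- The number of times the unordered pair `{i, j}` is sampled. -/
def mult (ω : Fin m → Pair n) (i j : Fin n) : ℕ := ∑ k, incid (ω k) i j

lemma incid_comm (a : Pair n) (i j : Fin n) : incid a i j = incid a j i := add_comm _ _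

lemma mult_comm (ω : Fin m → Pair n) (i j : Fin n) : mult ω i j = mult ω j i := by
  simp only [mult, incid_comm]

lemma sum_incid_mul (a : Pair n) (f : Fin n → Fin n → ℝ) :
    ∑ i, ∑ j, (incid a i j : ℝ) * f i j = f a.1.1 a.1.2 + f a.1.2 a.1.1 := by
  have h1 : ∑ x : Fin n × Fin n, (if a.1 = x then (1 : ℝ) else 0) * f x.1 x.2 = f a.1.1 a.1.2 := by
    simp
  have h2 : ∑ x : Fin n × Fin n, (if a.1 = x then (1 : ℝ) else 0) * f x.2 x.1 = f a.1.2 a.1.1 := by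
    simp
  rw [Fintype.sum_prod_type] at h1 h2
  rw [Finset.sum_comm] at h2
  rw [← h1, ← h2, ← Finset.sum_add_distrib]
  refine Finset.sum_congr rfl fun i _ => ?_
  rw [← Finset.sum_add_distrib]
  refine Finset.sum_congr rfl fun j _ => ?_
  simp only [incid]; push_cast; ring

lemma sum_mult_mul (ω : Fin m → Pair n) (f : Fin n → Fin n → ℝ) :
    ∑ i, ∑ j, (mult ω i j : ℝ) * f i j
      = ∑ k, (f (ω k).1.1 (ω k).1.2 + f (ω k).1.2 (ω k).1.1) := by
  calc ∑ i, ∑ j, (mult ω i j : ℝ) * f i j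
      = ∑ i, ∑ j, ∑ k, (incid (ω k) i j : ℝ) * f i j := by
        simp only [mult, Nat.cast_sum, Finset.sum_mul]
    _ = ∑ i, ∑ k, ∑ j, (incid (ω k) i j : ℝ) * f i j :=
        Finset.sum_congr rfl fun i _ => Finset.sum_comm
    _ = ∑ k, ∑ i, ∑ j, (incid (ω k) i j : ℝ) * f i j := Finset.sum_comm
    _ = _ := Finset.sum_congr rfl fun k _ => sum_incid_mul (ω k) f

end EDG

namespace EDG

open Matrix

variable {n m : ℕ}

/-! ### Deterministic consequences of a well-distributed sample -/

/-- A sample that acts on the tangent space at `X` almost as `p` times the identity, where `p` is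
the sampling rate, and that hits no index too often. -/
structure GoodSample (ω : Fin m → Pair n) (X : Matrix (Fin n) (Fin n) ℝ) (p ε Λ τ : ℝ) : Prop where
  rip : ∀ A B : Matrix (Fin n) (Fin n) ℝ, IsCentered A → IsCentered B →
    tangent (colProj X) A = A → tangent (colProj X) B = B →
    |ip A (sampling ω B) - p * ip A B| ≤ p * ε * (frob A * frob B)
  diag : ∀ (A : Matrix (Fin n) (Fin n) ℝ) (d : Fin n → ℝ), IsCentered A →
    tangent (colProj X) A = A →
    |∑ k, A (ω k).1.1 (ω k).1.2 * (d (ω k).1.1 + d (ω k).1.2) + p * ∑ i, A i i * d i|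
      ≤ p * Λ * (frob A * √(d ⬝ᵥ d))
  row : ∀ i, ∑ j, (mult ω i j : ℝ) ^ 2 ≤ τ ^ 2

lemma sqrt_diag_le_frob (B : Matrix (Fin n) (Fin n) ℝ) :
    √((fun i => B i i) ⬝ᵥ (fun i => B i i)) ≤ frob B := by
  refine Real.sqrt_le_left (frob_nonneg B) |>.2 ?_
  rw [frob_sq_eq_sum]
  refine Finset.sum_le_sum fun i _ => ?_
  rw [← sq]
  exact Finset.single_le_sum (f := fun j => B i j ^ 2) (fun j _ => sq_nonneg _) (Finset.mem_univ i)

lemma abs_sum_sum_mul_le (T f g : Fin n → Fin n → ℝ) (hT : ∀ i j, 0 ≤ T i j) {a b : ℝ}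
    (ha : 0 ≤ a) (hb : 0 ≤ b) (hf : ∑ i, ∑ j, T i j * f i j ^ 2 ≤ a ^ 2)
    (hg : ∑ i, ∑ j, T i j * g i j ^ 2 ≤ b ^ 2) :
    |∑ i, ∑ j, T i j * (f i j * g i j)| ≤ a * b := by
  refine abs_le_of_sq_le_sq ?_ (mul_nonneg ha hb)
  have h := Finset.sum_mul_sq_le_sq_mul_sq Finset.univ
    (fun x : Fin n × Fin n => √(T x.1 x.2) * f x.1 x.2)
    (fun x : Fin n × Fin n => √(T x.1 x.2) * g x.1 x.2)
  have e1 : ∀ x : Fin n × Fin n, √(T x.1 x.2) * f x.1 x.2 * (√(T x.1 x.2) * g x.1 x.2)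
      = T x.1 x.2 * (f x.1 x.2 * g x.1 x.2) := fun x => by
    have := Real.mul_self_sqrt (hT x.1 x.2)
    calc _ = (√(T x.1 x.2) * √(T x.1 x.2)) * (f x.1 x.2 * g x.1 x.2) := by ring
      _ = _ := by rw [this]
  simp only [e1, mul_pow, Real.sq_sqrt (hT _ _)] at h
  simp only [Fintype.sum_prod_type] at h
  refine h.trans ?_
  rw [mul_pow]
  refine mul_le_mul hf hg ?_ (sq_nonneg a)
  exact Finset.sum_nonneg fun i _ => Finset.sum_nonneg fun j _ => mul_nonneg (hT i j) (sq_nonneg _)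

namespace GoodSample

variable {ω : Fin m → Pair n} {X A B : Matrix (Fin n) (Fin n) ℝ} {p ε Λ τ ρ : ℝ}

lemma mult_le (h : GoodSample ω X p ε Λ τ) (hτ : 0 ≤ τ) (i j : Fin n) : (mult ω i j : ℝ) ≤ τ := by
  refine le_of_sq_le_sq ?_ hτ
  exact (Finset.single_le_sum (f := fun j => (mult ω i j : ℝ) ^ 2) (fun j _ => sq_nonneg _)
    (Finset.mem_univ j)).trans (h.row i)

lemma sum_mult_le (h : GoodSample ω X p ε Λ τ) (i : Fin n) : ∑ j, (mult ω i j : ℝ) ≤ τ ^ 2 := by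
  refine (Finset.sum_le_sum fun j _ => ?_).trans (h.row i)
  -- Multiplicities are natural numbers, hence at most their squares.
  exact_mod_cast Nat.le_self_pow two_ne_zero _

lemma sum_mult_sq_le (h : GoodSample ω X p ε Λ τ) (hτ : 0 ≤ τ) (B : Matrix (Fin n) (Fin n) ℝ) :
    ∑ i, ∑ j, (mult ω i j : ℝ) * B i j ^ 2 ≤ (√τ * frob B) ^ 2 := by
  rw [mul_pow, Real.sq_sqrt hτ, frob_sq_eq_sum, Finset.mul_sum]
  refine Finset.sum_le_sum fun i _ => ?_
  rw [Finset.mul_sum]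
  exact Finset.sum_le_sum fun j _ => mul_le_mul_of_nonneg_right (h.mult_le hτ i j) (sq_nonneg _)

lemma sum_mult_sq_le_of_tangent (h : GoodSample ω X p ε Λ τ) (hρ0 : 0 ≤ ρ)
    (hρ : ∀ i, colProj X i i ≤ ρ) (hA : tangent (colProj X) A = A) :
    ∑ i, ∑ j, (mult ω i j : ℝ) * A i j ^ 2 ≤ 4 * ρ * τ ^ 2 * frob A ^ 2 :=
  tangent_sum_entry_sq_le (isOrthProj_colProj X) hρ hρ0 hA (fun i j => Nat.cast_nonneg _)
    (sq_nonneg τ) h.sum_mult_le (fun j => by simp only [mult_comm ω _ j]; exact h.sum_mult_le j)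

/-- Separates the diagonal of B, where the signs of A have to cancel for a sharp bound, from the
off-diagonal entries, where absolute values suffice. -/
lemma ip_sampling_eq (ω : Fin m → Pair n) (hA : IsCentered A) (hB : IsCentered B) :
    ip A (sampling ω B)
      = -∑ k, A (ω k).1.1 (ω k).1.2 * (B (ω k).1.1 (ω k).1.1 + B (ω k).1.2 (ω k).1.2)
        + ∑ i, ∑ j, (mult ω i j : ℝ) * (A i j * B i j) := by
  rw [sum_mult_mul ω (fun i j => A i j * B i j), ip_sampling, ← Finset.sum_neg_distrib,
    ← Finset.sum_add_distrib]
  refine Finset.sum_congr rfl fun k _ => ?_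
  rw [ip_v hA, ip_w_of_isCentered hB, hA.apply_comm (ω k).1.2 (ω k).1.1,
    hB.apply_comm (ω k).1.2 (ω k).1.1]
  ring

/-- The diagonal part is close to its mean by `diag`. The rest is Cauchy–Schwarz weighted by
multiplicities, where the tangency of A improves the trivial bound τ by the factor 2√(ρτ). -/
lemma abs_ip_sampling_le_of_tangent_left (h : GoodSample ω X p ε Λ τ) (hp : 0 ≤ p) (hΛ : 0 ≤ Λ)
    (hτ : 0 ≤ τ) (hρ0 : 0 ≤ ρ) (hρ : ∀ i, colProj X i i ≤ ρ) (hA : IsCentered A)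
    (hB : IsCentered B) (hAT : tangent (colProj X) A = A) :
    |ip A (sampling ω B)| ≤ (p * (1 + Λ) + 2 * (τ * √(ρ * τ))) * (frob A * frob B) := by
  rw [ip_sampling_eq ω hA hB]
  have hAB := mul_nonneg (frob_nonneg A) (frob_nonneg B)
  have h1 := h.diag A (fun i => B i i) hA hAT
  have h2 : frob A * √((fun i => B i i) ⬝ᵥ (fun i => B i i)) ≤ frob A * frob B :=
    mul_le_mul_of_nonneg_left (sqrt_diag_le_frob B) (frob_nonneg A)
  have h3 : |∑ i, A i i * B i i| ≤ frob A * frob B := by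
    refine (abs_dotProduct_le (fun i => A i i) (fun i => B i i)).trans ?_
    exact mul_le_mul (sqrt_diag_le_frob A) (sqrt_diag_le_frob B) (Real.sqrt_nonneg _) (frob_nonneg A)
  have h4 : |∑ i, ∑ j, (mult ω i j : ℝ) * (A i j * B i j)|
      ≤ (2 * (√ρ * τ) * frob A) * (√τ * frob B) := by
    refine abs_sum_sum_mul_le _ _ _ (fun i j => Nat.cast_nonneg _)
      (mul_nonneg (by positivity) (frob_nonneg A)) (mul_nonneg (by positivity) (frob_nonneg B)) ?_
      (h.sum_mult_sq_le hτ B)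
    refine (h.sum_mult_sq_le_of_tangent hρ0 hρ hAT).trans (le_of_eq ?_)
    rw [mul_pow, mul_pow, mul_pow, Real.sq_sqrt hρ0]; ring
  have h5 : √(ρ * τ) = √ρ * √τ := Real.sqrt_mul hρ0 τ
  set S := ∑ k, A (ω k).1.1 (ω k).1.2 * (B (ω k).1.1 (ω k).1.1 + B (ω k).1.2 (ω k).1.2)
  set D := ∑ i, A i i * B i i
  set M := ∑ i, ∑ j, (mult ω i j : ℝ) * (A i j * B i j)
  have h6 : |S + p * D| ≤ p * Λ * (frob A * frob B) :=
    h1.trans (mul_le_mul_of_nonneg_left h2 (mul_nonneg hp hΛ))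
  have h7 : |p * D| ≤ p * (frob A * frob B) := by
    rw [abs_mul, abs_of_nonneg hp]; exact mul_le_mul_of_nonneg_left h3 hp
  have h8 : -S + M = -(S + p * D) + p * D + M := by ring
  rw [h8]
  refine (abs_add_three _ _ _).trans ?_
  rw [abs_neg, h5]
  linarith

/-- No cancellation is needed here: the diagonal of a tangent B is itself small in ℓ²
(`tangent_sum_diag_sq_le`), so one weighted Cauchy–Schwarz covers all entries. -/
lemma abs_ip_sampling_le_of_tangent_right (h : GoodSample ω X p ε Λ τ)
    (hτ : 0 ≤ τ) (hρ0 : 0 ≤ ρ) (hρ : ∀ i, colProj X i i ≤ ρ) (hA : IsCentered A)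
    (hB : IsCentered B) (hBT : tangent (colProj X) B = B) :
    |ip A (sampling ω B)| ≤ 5 * (τ * √(ρ * τ)) * (frob A * frob B) := by
  have h1 : ip A (sampling ω B)
      = (-1 / 2) * ∑ i, ∑ j, (mult ω i j : ℝ) * (A i j * (B i i + B j j - 2 * B i j)) := by
    rw [sum_mult_mul ω (fun i j => A i j * (B i i + B j j - 2 * B i j)), ip_sampling,
      Finset.mul_sum]
    refine Finset.sum_congr rfl fun k _ => ?_
    rw [ip_v hA, ip_w_of_isCentered hB, hA.apply_comm (ω k).1.2 (ω k).1.1,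
      hB.apply_comm (ω k).1.2 (ω k).1.1]
    ring
  have hdiag : ∑ i, ∑ j, (mult ω i j : ℝ) * B i i ^ 2 ≤ τ ^ 2 * (4 * ρ * frob B ^ 2) := by
    calc ∑ i, ∑ j, (mult ω i j : ℝ) * B i i ^ 2 = ∑ i, (∑ j, (mult ω i j : ℝ)) * B i i ^ 2 := by
          simp only [Finset.sum_mul]
      _ ≤ ∑ i, τ ^ 2 * B i i ^ 2 := Finset.sum_le_sum fun i _ =>
          mul_le_mul_of_nonneg_right (h.sum_mult_le i) (sq_nonneg _)
      _ = τ ^ 2 * ∑ i, B i i ^ 2 := by rw [Finset.mul_sum]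
      _ ≤ _ := mul_le_mul_of_nonneg_left
          (tangent_sum_diag_sq_le (isOrthProj_colProj X) hρ hρ0 hBT) (sq_nonneg τ)
  have hdiag' : ∑ i, ∑ j, (mult ω i j : ℝ) * B j j ^ 2 ≤ τ ^ 2 * (4 * ρ * frob B ^ 2) := by
    rw [Finset.sum_comm]
    simp only [mult_comm ω _ _] at hdiag ⊢
    refine le_trans (le_of_eq ?_) hdiag
    exact Finset.sum_congr rfl fun i _ => Finset.sum_congr rfl fun j _ => by rw [mult_comm]
  have h2 : ∑ i, ∑ j, (mult ω i j : ℝ) * (B i i + B j j - 2 * B i j) ^ 2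
      ≤ (10 * (√ρ * τ) * frob B) ^ 2 := by
    have h3 : ∀ i j, (mult ω i j : ℝ) * (B i i + B j j - 2 * B i j) ^ 2
        ≤ 3 * ((mult ω i j : ℝ) * B i i ^ 2) + 3 * ((mult ω i j : ℝ) * B j j ^ 2)
          + 12 * ((mult ω i j : ℝ) * B i j ^ 2) := fun i j => by
      have h4 : (B i i + B j j - 2 * B i j) ^ 2 ≤ 3 * B i i ^ 2 + 3 * B j j ^ 2 + 12 * B i j ^ 2 := by
        nlinarith [sq_nonneg (B i i - B j j), sq_nonneg (B i i + 2 * B i j),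
          sq_nonneg (B j j + 2 * B i j)]
      have := mul_le_mul_of_nonneg_left h4 (Nat.cast_nonneg (α := ℝ) (mult ω i j))
      linarith
    have h5 := h.sum_mult_sq_le_of_tangent hρ0 hρ hBT
    calc _ ≤ ∑ i, ∑ j, (3 * ((mult ω i j : ℝ) * B i i ^ 2) + 3 * ((mult ω i j : ℝ) * B j j ^ 2)
          + 12 * ((mult ω i j : ℝ) * B i j ^ 2)) :=
          Finset.sum_le_sum fun i _ => Finset.sum_le_sum fun j _ => h3 i j
      _ = 3 * ∑ i, ∑ j, (mult ω i j : ℝ) * B i i ^ 2 + 3 * ∑ i, ∑ j, (mult ω i j : ℝ) * B j j ^ 2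
          + 12 * ∑ i, ∑ j, (mult ω i j : ℝ) * B i j ^ 2 := by
          simp only [Finset.sum_add_distrib, Finset.mul_sum]
      -- 3·4 + 3·4 + 12·4 = 72, then rounded up to the square of 10; the prefactor 1/2 turns 10 into
      -- the 5 of the statement.
      _ ≤ 72 * (ρ * τ ^ 2 * frob B ^ 2) := by linarith
      _ ≤ 100 * (ρ * τ ^ 2 * frob B ^ 2) := by
          have : 0 ≤ ρ * τ ^ 2 * frob B ^ 2 := by positivity
          linarith
      _ = _ := by rw [mul_pow, mul_pow, mul_pow, Real.sq_sqrt hρ0]; ring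
  have h6 := abs_sum_sum_mul_le (fun i j => (mult ω i j : ℝ)) (fun i j => A i j)
    (fun i j => B i i + B j j - 2 * B i j) (fun i j => Nat.cast_nonneg _)
    (mul_nonneg (Real.sqrt_nonneg τ) (frob_nonneg A))
    (mul_nonneg (by positivity) (frob_nonneg B)) (h.sum_mult_sq_le hτ A) h2
  rw [h1, abs_mul, Real.sqrt_mul hρ0]
  norm_num
  linarith

/-- The diagonal and off-diagonal parts cost τ each. Cauchy–Schwarz along a row uses the ℓ² norm of
the multiplicities, at most τ; their plain row sums are only bounded by τ². -/
lemma abs_ip_sampling_le (h : GoodSample ω X p ε Λ τ) (hτ : 0 ≤ τ) (hA : IsCentered A)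
    (hB : IsCentered B) : |ip A (sampling ω B)| ≤ 2 * τ * (frob A * frob B) := by
  rw [ip_sampling_eq ω hA hB]
  have h1 : ∑ k, A (ω k).1.1 (ω k).1.2 * (B (ω k).1.1 (ω k).1.1 + B (ω k).1.2 (ω k).1.2)
      = (fun i => ∑ j, (mult ω i j : ℝ) * A i j) ⬝ᵥ (fun i => B i i) := by
    have h2 := sum_mult_mul ω (fun i j => A i j * B i i)
    have h3 : ∑ i, ∑ j, (mult ω i j : ℝ) * (A i j * B i i)
        = (fun i => ∑ j, (mult ω i j : ℝ) * A i j) ⬝ᵥ (fun i => B i i) := by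
      simp only [dotProduct, Finset.sum_mul, mul_assoc]
    rw [← h3, h2]
    refine Finset.sum_congr rfl fun k _ => ?_
    rw [hA.apply_comm (ω k).1.2 (ω k).1.1]; ring
  have h4 : √((fun i => ∑ j, (mult ω i j : ℝ) * A i j) ⬝ᵥ fun i => ∑ j, (mult ω i j : ℝ) * A i j)
      ≤ τ * frob A := by
    refine Real.sqrt_le_left (mul_nonneg hτ (frob_nonneg A)) |>.2 ?_
    rw [mul_pow, frob_sq_eq_sum, Finset.mul_sum]
    refine Finset.sum_le_sum fun i _ => ?_
    rw [← sq]
    refine (Finset.sum_mul_sq_le_sq_mul_sq _ _ _).trans ?_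
    exact mul_le_mul_of_nonneg_right (h.row i) (Finset.sum_nonneg fun _ _ => sq_nonneg _)
  have h5 := (abs_dotProduct_le (fun i => ∑ j, (mult ω i j : ℝ) * A i j) (fun i => B i i)).trans
    (mul_le_mul h4 (sqrt_diag_le_frob B) (Real.sqrt_nonneg _) (mul_nonneg hτ (frob_nonneg A)))
  have h6 := abs_sum_sum_mul_le (fun i j => (mult ω i j : ℝ)) A B (fun i j => Nat.cast_nonneg _)
    (mul_nonneg (Real.sqrt_nonneg τ) (frob_nonneg A))
    (mul_nonneg (Real.sqrt_nonneg τ) (frob_nonneg B)) (h.sum_mult_sq_le hτ A)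
    (h.sum_mult_sq_le hτ B)
  have h7 : √τ * frob A * (√τ * frob B) = τ * (frob A * frob B) := by
    calc _ = (√τ * √τ) * (frob A * frob B) := by ring
      _ = _ := by rw [Real.mul_self_sqrt hτ]
  rw [h7] at h6
  rw [h1]
  refine (abs_add_le _ _).trans ?_
  rw [abs_neg]
  linarith

end GoodSample

end EDG

namespace EDG

open Matrix

variable {n m : ℕ}

/-! ### One step of the algorithm -/

namespace GoodSample

variable {ω : Fin m → Pair n} {X Y A B : Matrix (Fin n) (Fin n) ℝ} {p ε Λ τ ρ η : ℝ}

/-- The constants are small enough for a neighbourhood of radius `η`. -/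
structure SmallRadius (p ε Λ τ ρ η : ℝ) : Prop where
  p_pos : 0 < p
  Λ_nonneg : 0 ≤ Λ
  τ_nonneg : 0 ≤ τ
  ρ_nonneg : 0 ≤ ρ
  η_nonneg : 0 ≤ η
  ε_pos : 0 < ε
  ε_lt : ε < 1 / 22
  le : 3 * η * (p * (1 + Λ)) + 14 * (τ * √(ρ * τ)) * η + 8 * τ * η ^ 2 + 4 * p * η ^ 2 ≤ p * ε

lemma SmallRadius.g_nonneg (s : SmallRadius p ε Λ τ ρ η) : 0 ≤ τ * √(ρ * τ) :=
  mul_nonneg s.τ_nonneg (Real.sqrt_nonneg _)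

lemma SmallRadius.η_le (s : SmallRadius p ε Λ τ ρ η) : 3 * η ≤ ε := by
  have h1 := s.le
  have h2 : 0 ≤ 14 * (τ * √(ρ * τ)) * η :=
    mul_nonneg (mul_nonneg (by norm_num) s.g_nonneg) s.η_nonneg
  have h3 : 0 ≤ 8 * τ * η ^ 2 := mul_nonneg (mul_nonneg (by norm_num) s.τ_nonneg) (sq_nonneg _)
  have h4 : 0 ≤ 4 * p * η ^ 2 := mul_nonneg (mul_nonneg (by norm_num) s.p_pos.le) (sq_nonneg _)
  have h5 : 0 ≤ 3 * η * (p * Λ) :=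
    mul_nonneg (mul_nonneg (by norm_num) s.η_nonneg) (mul_nonneg s.p_pos.le s.Λ_nonneg)
  have h6 : p * (3 * η) ≤ p * ε := by linarith
  exact le_of_mul_le_mul_left h6 s.p_pos

/-- Carries the bound for a left tangent argument from X to a nearby Y: the part of A off the
tangent space at X has norm at most 2η‖A‖ and pays the general price 2τ. -/
lemma abs_ip_sampling_near_le (h : GoodSample ω X p ε Λ τ) (s : SmallRadius p ε Λ τ ρ η)
    (hX : IsCentered X) (hρ : ∀ i, colProj X i i ≤ ρ)
    (hη : opNorm ((1 - colProj X) * colProj Y) ≤ η) (hA : IsCentered A) (hB : IsCentered B)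
    (hAT : tangent (colProj Y) A = A) :
    |ip A (sampling ω B)|
      ≤ (p * (1 + Λ) + 2 * (τ * √(ρ * τ)) + 4 * τ * η) * (frob A * frob B) := by
  have hP := isOrthProj_colProj X
  set A₀ := tangent (colProj X) A with hA₀
  have hA0c : IsCentered A₀ := hX.tangent hA
  have hA1c : IsCentered (A - A₀) := hA.sub hA0c
  have e : ip A (sampling ω B) = ip A₀ (sampling ω B) + ip (A - A₀) (sampling ω B) := by
    rw [ip_sub_left]; ring
  have h0 := h.abs_ip_sampling_le_of_tangent_left s.p_pos.le s.Λ_nonneg s.τ_nonneg s.ρ_nonneg hρ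
    hA0c hB (tangent_tangent hP A)
  have h1 := h.abs_ip_sampling_le s.τ_nonneg hA1c hB
  have f0 : frob A₀ * frob B ≤ frob A * frob B :=
    mul_le_mul_of_nonneg_right (frob_tangent_le hP A) (frob_nonneg B)
  have f1 : frob (A - A₀) * frob B ≤ 2 * η * frob A * frob B :=
    mul_le_mul_of_nonneg_right (frob_sub_tangent_le hP (isOrthProj_colProj Y) hη hAT)
      (frob_nonneg B)
  have c0 : 0 ≤ p * (1 + Λ) + 2 * (τ * √(ρ * τ)) := by
    have := s.g_nonneg
    have := mul_nonneg s.p_pos.le (add_nonneg zero_le_one s.Λ_nonneg)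
    linarith
  have g0 := mul_le_mul_of_nonneg_left f0 c0
  have g1 := mul_le_mul_of_nonneg_left f1 (mul_nonneg zero_le_two s.τ_nonneg)
  rw [e]
  refine (abs_add_le _ _).trans ?_
  linarith

/-- Both arguments are split along the tangent space at X. The tangent pair falls under `rip`. The
inner product has no cross terms, but the sampled form has two, each with one factor 2η, and a last
term with two such factors. -/
lemma rip_near (h : GoodSample ω X p ε Λ τ) (s : SmallRadius p ε Λ τ ρ η)
    (hX : IsCentered X) (hρ : ∀ i, colProj X i i ≤ ρ)
    (hη : opNorm ((1 - colProj X) * colProj Y) ≤ η) (hA : IsCentered A) (hB : IsCentered B)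
    (hAT : tangent (colProj Y) A = A) (hBT : tangent (colProj Y) B = B) :
    |ip A (sampling ω B) - p * ip A B| ≤ 2 * (p * ε) * (frob A * frob B) := by
  have hP := isOrthProj_colProj X
  have hQ := isOrthProj_colProj Y
  set A₀ := tangent (colProj X) A with hA₀
  set B₀ := tangent (colProj X) B with hB₀
  have hA0c : IsCentered A₀ := hX.tangent hA
  have hA1c : IsCentered (A - A₀) := hA.sub hA0c
  have hB0c : IsCentered B₀ := hX.tangent hB
  have hB1c : IsCentered (B - B₀) := hB.sub hB0c
  have es : sampling ω B = sampling ω B₀ + sampling ω (B - B₀) := by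
    rw [← sampling_add]; congr 1; abel
  have e1 : ip A (sampling ω B) = ip A₀ (sampling ω B₀) + ip A₀ (sampling ω (B - B₀))
      + ip (A - A₀) (sampling ω B₀) + ip (A - A₀) (sampling ω (B - B₀)) := by
    rw [es]; simp only [ip_add_right, ip_sub_left]; ring
  have e2 : ip A B = ip A₀ B₀ + ip (A - A₀) (B - B₀) := by
    have h1 : ip A₀ (B - B₀) = 0 := ip_tangent_sub hP A B
    have h2 : ip B₀ (A - A₀) = 0 := ip_tangent_sub hP B A
    rw [ip_comm] at h2
    have h3 : ip A B = ip A₀ B₀ + ip A₀ (B - B₀) + ip (A - A₀) B₀ + ip (A - A₀) (B - B₀) := by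
      simp only [ip_sub_left, ip_sub_right]; ring
    rw [h3, h1, h2]; ring
  have b1 := h.rip A₀ B₀ hA0c hB0c (tangent_tangent hP A) (tangent_tangent hP B)
  have b2 := h.abs_ip_sampling_le_of_tangent_left s.p_pos.le s.Λ_nonneg s.τ_nonneg s.ρ_nonneg hρ
    hA0c hB1c (tangent_tangent hP A)
  have b3 := h.abs_ip_sampling_le_of_tangent_right s.τ_nonneg s.ρ_nonneg hρ
    hA1c hB0c (tangent_tangent hP B)
  have b4 := h.abs_ip_sampling_le s.τ_nonneg hA1c hB1c
  have b5 := abs_ip_le (A - A₀) (B - B₀)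
  have nA := frob_nonneg A
  have nB := frob_nonneg B
  have fA0 : frob A₀ ≤ frob A := frob_tangent_le hP A
  have fB0 : frob B₀ ≤ frob B := frob_tangent_le hP B
  have fA1 : frob (A - A₀) ≤ 2 * η * frob A := frob_sub_tangent_le hP hQ hη hAT
  have fB1 : frob (B - B₀) ≤ 2 * η * frob B := frob_sub_tangent_le hP hQ hη hBT
  have hη0 := s.η_nonneg
  have m1 : frob A₀ * frob B₀ ≤ frob A * frob B := mul_le_mul fA0 fB0 (frob_nonneg _) nA
  have m2 : frob A₀ * frob (B - B₀) ≤ frob A * (2 * η * frob B) :=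
    mul_le_mul fA0 fB1 (frob_nonneg _) nA
  have m3 : frob (A - A₀) * frob B₀ ≤ 2 * η * frob A * frob B :=
    mul_le_mul fA1 fB0 (frob_nonneg _) (by positivity)
  have m4 : frob (A - A₀) * frob (B - B₀) ≤ 2 * η * frob A * (2 * η * frob B) :=
    mul_le_mul fA1 fB1 (frob_nonneg _) (by positivity)
  have c0 : 0 ≤ p * (1 + Λ) + 2 * (τ * √(ρ * τ)) := by
    have := s.g_nonneg
    have := mul_nonneg s.p_pos.le (add_nonneg zero_le_one s.Λ_nonneg)
    linarith
  have k1 := b1.trans (mul_le_mul_of_nonneg_left m1 (mul_nonneg s.p_pos.le s.ε_pos.le))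
  have k2 := b2.trans (mul_le_mul_of_nonneg_left m2 c0)
  have k3 := b3.trans (mul_le_mul_of_nonneg_left m3 (mul_nonneg (by norm_num) s.g_nonneg))
  have k4 := b4.trans (mul_le_mul_of_nonneg_left m4 (mul_nonneg zero_le_two s.τ_nonneg))
  have k5 : |p * ip (A - A₀) (B - B₀)| ≤ p * (2 * η * frob A * (2 * η * frob B)) := by
    rw [abs_mul, abs_of_pos s.p_pos]
    exact mul_le_mul_of_nonneg_left (b5.trans m4) s.p_pos.le
  have hfin := mul_le_mul_of_nonneg_right s.le (mul_nonneg nA nB)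
  have hpos : 0 ≤ η * (p * (1 + Λ)) * (frob A * frob B) :=
    mul_nonneg (mul_nonneg hη0 (mul_nonneg s.p_pos.le (add_nonneg zero_le_one s.Λ_nonneg)))
      (mul_nonneg nA nB)
  rw [abs_le] at k1 k2 k3 k4 k5 ⊢
  rw [e1, e2]
  constructor
  · linarith [k1.1, k2.1, k3.1, k4.1, k5.2]
  · linarith [k1.2, k2.2, k3.2, k4.2, k5.1]

/-- One step of the algorithm contracts the error. -/
theorem step (h : GoodSample ω X p ε Λ τ) (s : SmallRadius p ε Λ τ ρ η)
    (hX : IsCentered X) (hρ : ∀ i, colProj X i i ≤ ρ) {r : ℕ} (hrX : X.rank = r)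
    {σ : ℝ} (hσ : 0 < σ)
    (hσX : ∀ z, σ ^ 2 * ((colProj X *ᵥ z) ⬝ᵥ (colProj X *ᵥ z)) ≤ (X *ᵥ z) ⬝ᵥ (X *ᵥ z))
    (hY : IsCentered Y) (hrY : Y.rank ≤ r) (hE : frob (Y - X) ≤ η * σ)
    {Z : Matrix (Fin n) (Fin n) ℝ} (hZ : IsHardThreshold r (gradStep ω X Y) Z) :
    frob (Z - X) ≤ 18 * ε / (1 - 4 * ε) * frob (Y - X) := by
  have hP := isOrthProj_colProj X
  have hQ := isOrthProj_colProj Y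
  set P := colProj X with hPdef
  set Q := colProj Y with hQdef
  set E := Y - X with hEdef
  have hp := s.p_pos
  have hε := s.ε_pos
  have hε' := s.ε_lt
  have hη0 := s.η_nonneg
  have hη3 := s.η_le
  have nE := frob_nonneg E
  have hEc : IsCentered E := hY.sub hX
  have hYQ : Y * (1 - Q) = 0 := by
    rw [Matrix.mul_sub, Matrix.mul_one, hQdef, self_mul_colProj hY.1, sub_self]
  have hQY : (1 - Q) * Y = 0 := by
    rw [Matrix.sub_mul, Matrix.one_mul, hQdef, colProj_mul_self, sub_self]
  -- X is bounded below by σ on its range, while Y(1−Q) = 0 gives X(1−Q) = −E(1−Q), of norm at most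
  -- ησ.
  have hPQ : opNorm (P * (1 - Q)) ≤ η := by
    refine opNorm_le_of_forall hη0 fun z => ?_
    have h1 := hσX ((1 - Q) *ᵥ z)
    have h2 : X *ᵥ ((1 - Q) *ᵥ z) = (-E) *ᵥ ((1 - Q) *ᵥ z) := by
      rw [Matrix.mulVec_mulVec, Matrix.mulVec_mulVec]
      congr 1
      rw [hEdef, neg_sub, Matrix.sub_mul, hYQ, sub_zero]
    have h3 := mulVec_dotProduct_self_le (-E) ((1 - Q) *ᵥ z)
    have h4 : opNorm (-E) ≤ η * σ := (opNorm_le_frob _).trans (by rw [frob_neg]; exact hE)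
    have h5 : ((1 - Q) *ᵥ z) ⬝ᵥ ((1 - Q) *ᵥ z) ≤ z ⬝ᵥ z := by
      have := hQ.mulVec_add z
      have := dotProduct_self_nonneg_real (Q *ᵥ z)
      linarith
    have h6 : opNorm (-E) ^ 2 ≤ (η * σ) ^ 2 := pow_le_pow_left₀ (opNorm_nonneg _) h4 2
    rw [h2] at h1
    have h7 : opNorm (-E) ^ 2 * (((1 - Q) *ᵥ z) ⬝ᵥ ((1 - Q) *ᵥ z)) ≤ (η * σ) ^ 2 * (z ⬝ᵥ z) :=
      mul_le_mul h6 h5 (dotProduct_self_nonneg_real _) (sq_nonneg _)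
    have h8 : σ ^ 2 * ((P *ᵥ (1 - Q) *ᵥ z) ⬝ᵥ (P *ᵥ (1 - Q) *ᵥ z)) ≤ σ ^ 2 * (η ^ 2 * (z ⬝ᵥ z)) := by
      rw [mul_pow] at h7
      linarith
    rw [← Matrix.mulVec_mulVec]
    exact le_of_mul_le_mul_left h8 (by positivity)
  have hη1 : η < 1 := by linarith
  have hQP : opNorm ((1 - P) * Q) ≤ η :=
    opNorm_one_sub_colProj_mul_le (by omega) hη1 hPQ
  set A₀ := tangent Q E with hA₀
  set N := E - A₀ with hN
  have hA0c : IsCentered A₀ := hY.tangent hEc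
  have hNc : IsCentered N := hEc.sub hA0c
  -- As (1−Q)E = −(1−Q)X and X = XP, a factor P(1−Q) can be inserted on the right; this makes N of
  -- second order.
  have hNle : frob N ≤ η * frob E := by
    have h1 : N = ((1 - Q) * E) * (P * (1 - Q)) := by
      rw [hN, hA₀, sub_tangent]
      have h2 : (1 - Q) * E = -((1 - Q) * X) := by
        rw [hEdef, Matrix.mul_sub, hQY, zero_sub]
      have h3 : X * P = X := self_mul_colProj hX.1
      rw [h2, Matrix.neg_mul, Matrix.neg_mul, ← Matrix.mul_assoc, Matrix.mul_assoc _ X P, h3]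
    rw [h1, mul_comm η]
    exact (frob_mul_le' _ _).trans
      (mul_le_mul (hQ.one_sub.frob_mul_le E) hPQ (opNorm_nonneg _) nE)
  set G := tanProj Y (sampling ω (X - Y)) with hG
  have hGeq : G = -tangent Q (sampling ω E) := by
    rw [hG, tanProj_eq, show X - Y = -E by rw [hEdef, neg_sub], sampling_neg,
      ← neg_one_smul ℝ (sampling ω E), tangent_smul, neg_one_smul]
  have hGc : IsCentered G := hY.tangent (isCentered_sampling ω _)
  have hGT : tangent Q G = G := by rw [hG, tanProj_eq]; exact tangent_tangent hQ _
  have hd : 0 < 1 - 2 * ε := by linarith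
  -- Only the product with G matters. For G = 0 the step size is a meaningless default, so the ideal
  -- value 1/p is used; otherwise `rip_near` puts the denominator within a relative 2ε of p‖G‖².
  obtain ⟨a, ha, ha1, ha2⟩ : ∃ a : ℝ, a • G = stepSize ω X Y • G ∧
      0 ≤ a * p ∧ a * p ≤ 1 / (1 - 2 * ε) ∧ |1 - a * p| ≤ 2 * ε / (1 - 2 * ε) := by
    by_cases hG0 : G = 0
    · refine ⟨1 / p, by rw [hG0, smul_zero, smul_zero], ?_, ?_, ?_⟩
      · rw [one_div_mul_cancel hp.ne']; exact zero_le_one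
      · rw [one_div_mul_cancel hp.ne', le_div_iff₀ hd]; linarith
      · rw [one_div_mul_cancel hp.ne', sub_self, abs_zero]; positivity
    · have hfG : 0 < frob G := lt_of_le_of_ne (frob_nonneg G) fun h => hG0 (frob_eq_zero.1 h.symm)
      have hr := h.rip_near s hX hρ hQP hGc hGc hGT hGT
      rw [← frob_sq, ← sq, abs_le] at hr
      set D := ip G (sampling ω G) with hD
      set F := frob G ^ 2 with hF
      have hFp : 0 < F := by positivity
      have hD1 : p * F * (1 - 2 * ε) ≤ D := by linarith [hr.1]
      have hD2 : D ≤ p * F * (1 + 2 * ε) := by linarith [hr.2]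
      have hDp : 0 < D := lt_of_lt_of_le (by positivity) hD1
      have hst : stepSize ω X Y = F / D := by
        rw [stepSize]; exact max_eq_left (by positivity)
      have hlow : F / D * p ≤ 1 / (1 - 2 * ε) := by
        rw [div_mul_eq_mul_div, div_le_div_iff₀ hDp hd]; linarith
      refine ⟨F / D, by rw [hst], by positivity, hlow, ?_⟩
      rw [abs_le]
      have h1 : 1 - F / D * p = (D - F * p) / D := by field_simp
      have h2 : -(2 * ε / (1 - 2 * ε)) ≤ 1 - F / D * p := by
        have : 1 / (1 - 2 * ε) = 1 + 2 * ε / (1 - 2 * ε) := by field_simp; ring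
        linarith
      refine ⟨h2, ?_⟩
      rw [h1, div_le_div_iff₀ hDp hd]
      nlinarith [mul_pos hp hFp]
  obtain ⟨ha2, ha3⟩ := ha2
  -- V is the tangent part of the error after the gradient step; N passes through unchanged.
  set V := A₀ + a • G with hV
  have hVc : IsCentered V := hA0c.add (hGc.smul a)
  have hVT : tangent Q V = V := by
    rw [hV, tangent_add, tangent_smul, hGT, hA₀, tangent_tangent hQ]
  have hW : gradStep ω X Y - X = V + N := by
    rw [gradStep, ← hG, ← ha, hV, hN, hEdef]; abel
  have nV := frob_nonneg V
  -- Tested against the tangent matrix V, the projection inside G disappears. Three terms remain: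
  -- the deviation of the step size from 1/p, the defect of the near-isometry, and the leakage of N
  -- through R_Ω.
  have hVV : frob V ^ 2 = (1 - a * p) * ip V A₀ - a * (ip V (sampling ω A₀) - p * ip V A₀)
      - a * ip V (sampling ω N) := by
    have h1 : ip V G = -(ip V (sampling ω A₀) + ip V (sampling ω N)) := by
      have h2 : sampling ω E = sampling ω A₀ + sampling ω N := by
        rw [← sampling_add, hN]; congr 1; abel
      rw [hGeq, ← neg_one_smul ℝ (tangent Q _), ip_smul_right, ← ip_tangent hQ, hVT, h2,
        ip_add_right]
      ring
    rw [frob_sq]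
    nth_rw 2 [hV]
    rw [ip_add_right, ip_smul_right, h1]; ring
  have fA : frob A₀ ≤ frob E := frob_tangent_le hQ E
  have t1 : |(1 - a * p) * ip V A₀| ≤ 2 * ε / (1 - 2 * ε) * (frob V * frob E) := by
    rw [abs_mul]
    exact mul_le_mul ha3 ((abs_ip_le V A₀).trans (mul_le_mul_of_nonneg_left fA nV))
      (abs_nonneg _) (by positivity)
  have ha0 : 0 ≤ a := by
    by_contra! hc
    nlinarith
  have hVE : 0 ≤ frob V * frob E := mul_nonneg nV nE
  have t2 : |a * (ip V (sampling ω A₀) - p * ip V A₀)|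
      ≤ 2 * ε / (1 - 2 * ε) * (frob V * frob E) := by
    have h1 := h.rip_near s hX hρ hQP hVc hA0c hVT (tangent_tangent hQ E)
    rw [abs_mul, abs_of_nonneg ha0]
    have h2 : 2 * (p * ε) * (frob V * frob A₀) ≤ 2 * (p * ε) * (frob V * frob E) := by gcongr
    calc _ ≤ a * (2 * (p * ε) * (frob V * frob E)) :=
          mul_le_mul_of_nonneg_left (h1.trans h2) ha0
      _ = (a * p) * (2 * ε * (frob V * frob E)) := by ring
      _ ≤ 1 / (1 - 2 * ε) * (2 * ε * (frob V * frob E)) :=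
          mul_le_mul_of_nonneg_right ha2 (by positivity)
      _ = _ := by ring
  have t3 : |a * ip V (sampling ω N)| ≤ ε / (1 - 2 * ε) * (frob V * frob E) := by
    have h1 := h.abs_ip_sampling_near_le s hX hρ hQP hVc hNc hVT
    rw [abs_mul, abs_of_nonneg ha0]
    set C := p * (1 + Λ) + 2 * (τ * √(ρ * τ)) + 4 * τ * η with hC
    have hC0 : 0 ≤ C := by
      have := s.g_nonneg
      have := mul_nonneg hp.le (add_nonneg zero_le_one s.Λ_nonneg)
      have := mul_nonneg s.τ_nonneg hη0
      linarith
    have hCη : C * η ≤ p * ε := by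
      refine le_trans ?_ s.le
      have h4 := mul_nonneg s.g_nonneg hη0
      have h5 := mul_nonneg (mul_nonneg hp.le (add_nonneg zero_le_one s.Λ_nonneg)) hη0
      have h6 := mul_nonneg s.τ_nonneg (sq_nonneg η)
      have h7 := mul_nonneg hp.le (sq_nonneg η)
      rw [hC]
      nlinarith
    have h2 : C * (frob V * frob N) ≤ p * ε * (frob V * frob E) := by
      calc C * (frob V * frob N) ≤ C * (frob V * (η * frob E)) := by gcongr
        _ = (C * η) * (frob V * frob E) := by ring
        _ ≤ _ := mul_le_mul_of_nonneg_right hCη hVE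
    calc _ ≤ a * (p * ε * (frob V * frob E)) := mul_le_mul_of_nonneg_left (h1.trans h2) ha0
      _ = (a * p) * (ε * (frob V * frob E)) := by ring
      _ ≤ 1 / (1 - 2 * ε) * (ε * (frob V * frob E)) :=
          mul_le_mul_of_nonneg_right ha2 (by positivity)
      _ = _ := by ring
  have hVle : frob V ≤ 5 * ε / (1 - 2 * ε) * frob E := by
    rw [abs_le] at t1 t2 t3
    have h1 : frob V ^ 2 ≤ 5 * ε / (1 - 2 * ε) * (frob V * frob E) := by
      have : 5 * ε / (1 - 2 * ε) * (frob V * frob E)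
          = 2 * ε / (1 - 2 * ε) * (frob V * frob E) + 2 * ε / (1 - 2 * ε) * (frob V * frob E)
            + ε / (1 - 2 * ε) * (frob V * frob E) := by ring
      rw [hVV, this]
      linarith [t1.2, t2.1, t3.1]
    rcases eq_or_lt_of_le nV with h0 | h0
    · rw [← h0]; positivity
    · refine le_of_mul_le_mul_left ?_ h0
      linarith
  have hWle : frob (gradStep ω X Y - X) ≤ 9 * ε / (1 - 4 * ε) * frob E := by
    have h1 : frob (gradStep ω X Y - X) ≤ (5 * ε / (1 - 2 * ε) + η) * frob E := by
      rw [hW]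
      refine (frob_add_le _ _).trans ?_
      linarith
    refine h1.trans (mul_le_mul_of_nonneg_right ?_ nE)
    have hd4 : 0 < 1 - 4 * ε := by linarith
    -- Since 3η ≤ ε, the contribution of N is absorbed in ε.
    have h2 : 5 * ε / (1 - 2 * ε) + ε ≤ 9 * ε / (1 - 4 * ε) := by
      have h3 : 5 * ε / (1 - 2 * ε) ≤ 5 * ε / (1 - 4 * ε) := by gcongr; linarith
      have h4 : ε ≤ 4 * ε / (1 - 4 * ε) := by
        rw [le_div_iff₀ hd4]; nlinarith
      have h5 : 9 * ε / (1 - 4 * ε) = 5 * ε / (1 - 4 * ε) + 4 * ε / (1 - 4 * ε) := by ring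
      linarith
    linarith
  -- X has rank r and competes with Z in the best approximation, so thresholding at most doubles the
  -- error.
  have hZW : frob (Z - gradStep ω X Y) ≤ frob (gradStep ω X Y - X) := by
    rw [frob_sub_comm]; exact hZ.frob_sub_le hrX.le
  have hfin : Z - X = (Z - gradStep ω X Y) + (gradStep ω X Y - X) := by abel
  rw [hfin]
  refine (frob_add_le _ _).trans ?_
  have : 18 * ε / (1 - 4 * ε) * frob E = 2 * (9 * ε / (1 - 4 * ε) * frob E) := by ring
  linarith

/-- Every run started in the neighbourhood converges linearly. -/
theorem linear_convergence (h : GoodSample ω X p ε Λ τ) (s : SmallRadius p ε Λ τ ρ η)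
    (hX : IsCentered X) (hρ : ∀ i, colProj X i i ≤ ρ) {r : ℕ} (hrX : X.rank = r)
    {σ : ℝ} (hσ : 0 < σ)
    (hσX : ∀ z, σ ^ 2 * ((colProj X *ᵥ z) ⬝ᵥ (colProj X *ᵥ z)) ≤ (X *ᵥ z) ⬝ᵥ (X *ᵥ z))
    {x : ℕ → Matrix (Fin n) (Fin n) ℝ} (hx : IsRun r ω X x) (h0 : frob (x 0 - X) ≤ η * σ) (l : ℕ) :
    frob (x (l + 1) - X) ≤ 18 * ε / (1 - 4 * ε) * frob (x l - X) := by
  have hε := s.ε_pos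
  have hε' := s.ε_lt
  have hδ : 18 * ε / (1 - 4 * ε) ≤ 1 := by
    rw [div_le_one (by linarith)]; linarith
  have key : ∀ l, IsCentered (x l) ∧ (x l).rank ≤ r ∧ frob (x l - X) ≤ η * σ := by
    intro l
    induction l with
    | zero =>
      obtain ⟨Z, hZ, hx0⟩ := hx.init
      refine ⟨?_, ?_, h0⟩
      · rw [hx0]; exact (hZ.isCentered (isCentered_sampling ω X)).smul _
      · rw [hx0]; exact (rank_smul_le _ _).trans hZ.rank_le
    | succ l ih =>
      obtain ⟨h1, h2, h3⟩ := ih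
      have hst := hx.step l
      refine ⟨hst.isCentered ?_, hst.rank_le, ?_⟩
      · exact h1.add ((h1.tangent (isCentered_sampling ω _)).smul _)
      · have h4 := h.step s hX hρ hrX hσ hσX h1 h2 h3 hst
        have := frob_nonneg (x l - X)
        nlinarith
  obtain ⟨h1, h2, h3⟩ := key l
  exact h.step s hX hρ hrX hσ hσX h1 h2 h3 (hx.step l)

end GoodSample

end EDG

namespace EDG

open Matrix

/-! ### Tail bounds for the sample -/

/-- Matrix Bernstein's inequality with the deviation `t ≥ 2 √(V u)`, where `V` is the variance
parameter, in the range `4 R² u ≤ V` of a subgaussian tail. -/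
theorem measureReal_bernstein_exp_le {α I J : Type*} [Fintype α] [Fintype I] [Fintype J]
    [Nonempty α] [MeasurableSpace α] [MeasurableSingletonClass α]
    (S : α → Matrix I J ℝ) {R V c t : ℝ} (m : ℕ) (hm : 0 < m) (hV : 0 < V)
    (hc : 0 < c) (ht : 0 ≤ t) (hRV : 4 * R ^ 2 * c ≤ V) (htV : 4 * V * c ≤ t ^ 2)
    (hR : ∀ a u z, |u ⬝ᵥ S a *ᵥ z| ≤ R * (√(u ⬝ᵥ u) * √(z ⬝ᵥ z)))
    (hv₁ : ∀ u, ∑ a, ((S a)ᵀ *ᵥ u) ⬝ᵥ ((S a)ᵀ *ᵥ u) ≤ Fintype.card α * (V / m) * (u ⬝ᵥ u))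
    (hv₂ : ∀ z, ∑ a, (S a *ᵥ z) ⬝ᵥ (S a *ᵥ z) ≤ Fintype.card α * (V / m) * (z ⬝ᵥ z)) :
    (Measure.pi fun _ : Fin m => uniformOn (Set.univ : Set α)).real
      {ω | ¬ ∀ (u : I → ℝ) (z : J → ℝ),
        |∑ k, u ⬝ᵥ S (ω k) *ᵥ z - m / Fintype.card α * ∑ a, u ⬝ᵥ S a *ᵥ z|
          ≤ t * (√(u ⬝ᵥ u) * √(z ⬝ᵥ z))}
      ≤ (Fintype.card I + Fintype.card J) * Real.exp (-c) := by
  classical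
  have hm' : (0 : ℝ) < m := by exact_mod_cast hm
  -- With this θ the variance term θ²V equals c, and t² ≥ 4Vc gives θt ≥ 2c, so the exponent is at
  -- most −c.
  have hθ : 0 < √(c / V) := Real.sqrt_pos.2 (by positivity)
  have hθ2 : √(c / V) ^ 2 = c / V := Real.sq_sqrt (by positivity)
  refine (measureReal_bernstein_le S (t := t) m hθ ?_ hR hv₁ hv₂).trans ?_
  · refine le_of_sq_le_sq (le_of_eq_of_le (b := 4 * R ^ 2 * c / V) ?_ ?_) zero_le_one
    · rw [mul_pow, hθ2]; ring
    · rw [one_pow, div_le_one hV]; exact hRV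
  · gcongr
    rw [mul_div_cancel₀ _ hm'.ne', hθ2, div_mul_cancel₀ _ hV.ne']
    have : 2 * c ≤ √(c / V) * t := by
      refine le_of_sq_le_sq ?_ (by positivity)
      rw [mul_pow √(c / V), hθ2, div_mul_eq_mul_div, le_div_iff₀ hV]
      nlinarith
    linarith

/-- Bernstein's inequality for sums of matrices of rank one. -/
theorem measureReal_bernstein_rankOne_le {α I J : Type*} [Fintype α] [Fintype I] [Fintype J]
    [Nonempty α] [MeasurableSpace α] [MeasurableSingletonClass α]
    (x : α → I → ℝ) (y : α → J → ℝ) {bx bz cx cy V c t : ℝ} (m : ℕ)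
    (hbx : ∀ a, x a ⬝ᵥ x a ≤ bx) (hby : ∀ a, y a ⬝ᵥ y a ≤ bz)
    (hcx : ∀ u : I → ℝ, ∑ a, (u ⬝ᵥ x a) ^ 2 ≤ cx * (u ⬝ᵥ u))
    (hcy : ∀ z : J → ℝ, ∑ a, (y a ⬝ᵥ z) ^ 2 ≤ cy * (z ⬝ᵥ z))
    (hbx0 : 0 ≤ bx) (hby0 : 0 ≤ bz)
    (hV₁ : m / Fintype.card α * (bz * cx) ≤ V) (hV₂ : m / Fintype.card α * (bx * cy) ≤ V)
    (hm : 0 < m) (hV : 0 < V) (hc : 0 < c) (ht : 0 ≤ t)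
    (hRV : 4 * (bx * bz) * c ≤ V) (htV : 4 * V * c ≤ t ^ 2) :
    (Measure.pi fun _ : Fin m => uniformOn (Set.univ : Set α)).real
      {ω | ¬ ∀ (u : I → ℝ) (z : J → ℝ),
        |∑ k, (u ⬝ᵥ x (ω k)) * (y (ω k) ⬝ᵥ z)
            - m / Fintype.card α * ∑ a, (u ⬝ᵥ x a) * (y a ⬝ᵥ z)|
          ≤ t * (√(u ⬝ᵥ u) * √(z ⬝ᵥ z))}
      ≤ (Fintype.card I + Fintype.card J) * Real.exp (-c) := by
  classical
  have hN : (0 : ℝ) < Fintype.card α := by exact_mod_cast Fintype.card_pos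
  have hm' : (0 : ℝ) < m := by exact_mod_cast hm
  have hS : ∀ a u z, u ⬝ᵥ Matrix.vecMulVec (x a) (y a) *ᵥ z = (u ⬝ᵥ x a) * (y a ⬝ᵥ z) :=
    fun a u z => by
      rw [Matrix.vecMulVec_mulVec, dotProduct_smul]; simp
  have hVd : ∀ {b : ℝ}, m / Fintype.card α * b ≤ V → b ≤ Fintype.card α * (V / m) :=
      fun {b} hb => by
    rw [div_mul_eq_mul_div, div_le_iff₀ hN] at hb
    rw [← mul_div_assoc, le_div_iff₀ hm']; linarith
  have h := measureReal_bernstein_exp_le (fun a => Matrix.vecMulVec (x a) (y a)) (R := √bx * √bz)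
    m hm hV hc ht
    (by rwa [mul_pow, Real.sq_sqrt hbx0, Real.sq_sqrt hby0]) htV
    (fun a u z => by
      rw [hS, abs_mul]
      have h1 := abs_dotProduct_le u (x a)
      have h2 := abs_dotProduct_le (y a) z
      have h3 := Real.sqrt_le_sqrt (hbx a)
      have h4 := Real.sqrt_le_sqrt (hby a)
      calc _ ≤ (√(u ⬝ᵥ u) * √(x a ⬝ᵥ x a)) * (√(y a ⬝ᵥ y a) * √(z ⬝ᵥ z)) := by gcongr
        _ ≤ (√(u ⬝ᵥ u) * √bx) * (√bz * √(z ⬝ᵥ z)) := by gcongr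
        _ = _ := by ring)
    (fun u => by
      have h1 : ∀ a, ((Matrix.vecMulVec (x a) (y a))ᵀ *ᵥ u) ⬝ᵥ ((Matrix.vecMulVec (x a) (y a))ᵀ *ᵥ u)
          ≤ bz * (u ⬝ᵥ x a) ^ 2 := fun a => by
        rw [Matrix.transpose_vecMulVec, Matrix.vecMulVec_mulVec, smul_dotProduct, dotProduct_smul,
          dotProduct_comm (x a) u]
        simp only [MulOpposite.smul_eq_mul_unop, MulOpposite.unop_op]
        nlinarith [mul_le_mul_of_nonneg_right (hby a) (sq_nonneg (u ⬝ᵥ x a))]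
      calc _ ≤ ∑ a, bz * (u ⬝ᵥ x a) ^ 2 := Finset.sum_le_sum fun a _ => h1 a
        _ = bz * ∑ a, (u ⬝ᵥ x a) ^ 2 := by rw [Finset.mul_sum]
        _ ≤ bz * (cx * (u ⬝ᵥ u)) := mul_le_mul_of_nonneg_left (hcx u) hby0
        _ = bz * cx * (u ⬝ᵥ u) := by ring
        _ ≤ _ := mul_le_mul_of_nonneg_right (hVd hV₁) (dotProduct_self_nonneg_real u))
    (fun z => by
      have h1 : ∀ a, (Matrix.vecMulVec (x a) (y a) *ᵥ z) ⬝ᵥ (Matrix.vecMulVec (x a) (y a) *ᵥ z)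
          ≤ bx * (y a ⬝ᵥ z) ^ 2 := fun a => by
        rw [Matrix.vecMulVec_mulVec, smul_dotProduct, dotProduct_smul]
        simp only [MulOpposite.smul_eq_mul_unop, MulOpposite.unop_op]
        nlinarith [mul_le_mul_of_nonneg_right (hbx a) (sq_nonneg (y a ⬝ᵥ z))]
      calc _ ≤ ∑ a, bx * (y a ⬝ᵥ z) ^ 2 := Finset.sum_le_sum fun a _ => h1 a
        _ = bx * ∑ a, (y a ⬝ᵥ z) ^ 2 := by rw [Finset.mul_sum]
        _ ≤ bx * (cy * (z ⬝ᵥ z)) := mul_le_mul_of_nonneg_left (hcy z) hbx0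
        _ = bx * cy * (z ⬝ᵥ z) := by ring
        _ ≤ _ := mul_le_mul_of_nonneg_right (hVd hV₂) (dotProduct_self_nonneg_real z))
  simpa only [hS] using h

variable {n : ℕ}

/-- The entries of a matrix as a vector. -/
def flat (A : Matrix (Fin n) (Fin n) ℝ) : Fin n × Fin n → ℝ := fun x => A x.1 x.2

lemma flat_dotProduct (A B : Matrix (Fin n) (Fin n) ℝ) : flat A ⬝ᵥ flat B = ip A B := by
  rw [ip_eq_sum, dotProduct, Fintype.sum_prod_type]; rfl

lemma exists_flat (u : Fin n × Fin n → ℝ) : ∃ A : Matrix (Fin n) (Fin n) ℝ, u = flat A :=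
  ⟨Matrix.of fun i j => u (i, j), rfl⟩

/-- The matrix of the projection onto the vectors of mean zero. -/
noncomputable def centering (n : ℕ) : Matrix (Fin n) (Fin n) ℝ :=
  Matrix.of fun i j => centered j i

lemma centering_apply (i j : Fin n) : centering n i j = (if i = j then 1 else 0) - 1 / (n : ℝ) := rfl

lemma isOrthProj_centering (n : ℕ) : IsOrthProj (centering n) := by
  refine ⟨?_, ?_⟩
  · ext i j; simp only [Matrix.transpose_apply, centering_apply, eq_comm]
  · ext i j
    have hn : (n : ℝ) ≠ 0 := by have := i.pos; positivity
    simp only [Matrix.mul_apply, centering_apply, sub_mul, mul_sub, Finset.sum_sub_distrib]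
    simp
    field_simp
    ring

lemma centered_dotProduct_self_le (i : Fin n) : centered i ⬝ᵥ centered i ≤ 1 := by
  have h := (isOrthProj_centering n).sum_sq_row i
  have h1 : centered i ⬝ᵥ centered i = ∑ k, centering n i k ^ 2 := by
    simp only [dotProduct, centering_apply, centered, sq, eq_comm]
  rw [h1, h, centering_apply]
  simp

lemma sum_centered_dotProduct_sq_le (z : Fin n → ℝ) : ∑ i, (centered i ⬝ᵥ z) ^ 2 ≤ z ⬝ᵥ z := by
  have hJ := isOrthProj_centering n
  have h1 := hJ.mulVec_add z
  have h2 := dotProduct_self_nonneg_real ((1 - centering n) *ᵥ z)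
  have h3 : (centering n *ᵥ z) ⬝ᵥ (centering n *ᵥ z) = ∑ i, (centered i ⬝ᵥ z) ^ 2 := by
    rw [dotProduct]
    refine Finset.sum_congr rfl fun i _ => ?_
    have : (centering n *ᵥ z) i = centered i ⬝ᵥ z := by
      simp only [Matrix.mulVec, dotProduct, centering_apply, centered, eq_comm]
    rw [this, sq]
  linarith

/-- With J the centering projection, ⟨Y, v_α⟩ is minus the mean of the (i,j) and (j,i) entries of
JYJ. Hence its square is at most half the sum of their squares. -/
lemma sum_ip_v_sq_le (Y : Matrix (Fin n) (Fin n) ℝ) :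
    ∑ a, ip Y (v a) ^ 2 ≤ 1 / 2 * frob Y ^ 2 := by
  have hJ := isOrthProj_centering n
  set M := centering n * Y * centering n with hM
  have hMle : frob M ^ 2 ≤ frob Y ^ 2 :=
    pow_le_pow_left₀ (frob_nonneg _) ((hJ.frob_mul_le' _).trans (hJ.frob_mul_le Y)) 2
  have hv : ∀ i j, ip Y (Matrix.vecMulVec (centered i) (centered j)) = M i j := fun i j => by
    have h1 : Matrix.vecMulVec (centered i) (centered j)
        = centering n * Matrix.single i j 1 * centering n := by
      ext k l
      rw [Matrix.mul_assoc, Matrix.mul_apply]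
      simp only [Matrix.vecMulVec_apply, centering_apply, centered]
      rw [Finset.sum_eq_single i]
      · rw [Matrix.mul_apply, Finset.sum_eq_single j]
        · simp [centering_apply, eq_comm]
        · intro b _ hb; simp [hb.symm]
        · simp
      · intro b _ hb
        rw [Matrix.mul_apply]
        simp [hb.symm]
      · simp
    have h2 : ip Y (Matrix.vecMulVec (centered i) (centered j)) = ip M (Matrix.single i j 1) := by
      rw [h1, hM, ip_mul_right, ip_mul_left, hJ.symm, Matrix.mul_assoc]
    rw [h2, ip_eq_sum, Finset.sum_eq_single i, Finset.sum_eq_single j]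
    · simp
    · intro b _ hb; simp [hb.symm]
    · simp
    · intro b _ hb; simp [hb.symm]
    · simp
  have h3 : ∀ a : Pair n, ip Y (v a) ^ 2 ≤ 1 / 2 * (M a.1.1 a.1.2 ^ 2 + M a.1.2 a.1.1 ^ 2) :=
    fun a => by
      rw [v, ip_smul_right, ip_add_right, hv, hv]
      nlinarith [sq_nonneg (M a.1.1 a.1.2 - M a.1.2 a.1.1)]
  have h4 := sum_eq_sum_diag_add_sum_pair (fun i j => M i j ^ 2)
  have h5 : 0 ≤ ∑ i, M i i ^ 2 := Finset.sum_nonneg fun _ _ => sq_nonneg _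
  rw [← frob_sq_eq_sum] at h4
  calc _ ≤ ∑ a : Pair n, 1 / 2 * (M a.1.1 a.1.2 ^ 2 + M a.1.2 a.1.1 ^ 2) :=
        Finset.sum_le_sum fun a _ => h3 a
    _ = 1 / 2 * ∑ a : Pair n, (M a.1.1 a.1.2 ^ 2 + M a.1.2 a.1.1 ^ 2) := by rw [Finset.mul_sum]
    _ ≤ _ := by linarith

lemma sum_pair_add_le (f : Fin n → ℝ) (hf : ∀ i, 0 ≤ f i) :
    ∑ a : Pair n, (f a.1.1 + f a.1.2) ≤ n * ∑ i, f i := by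
  have h := sum_eq_sum_diag_add_sum_pair (n := n) (fun i _ => f i)
  have h1 : 0 ≤ ∑ i, f i := Finset.sum_nonneg fun i _ => hf i
  simp only [Finset.sum_const, Finset.card_univ, Fintype.card_fin, nsmul_eq_mul, ← Finset.mul_sum] at h
  linarith

/-- A diagonal entry meets n − 1 pairs, so for general Y the diagonal costs a factor of order n. For
tangent Y it carries only a fraction 4ρ of the squared norm. -/
lemma sum_ip_w_sq_le {P Y : Matrix (Fin n) (Fin n) ℝ} (hP : IsOrthProj P) {ρ : ℝ}
    (hρ : ∀ i, P i i ≤ ρ) (hρ0 : 0 ≤ ρ) (hY : tangent P Y = Y) :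
    ∑ a, ip Y (w a) ^ 2 ≤ (16 * n * ρ + 4) * frob Y ^ 2 := by
  have h1 := sum_pair_add_le (fun i => Y i i ^ 2) (fun i => sq_nonneg _)
  have h2 := tangent_sum_diag_sq_le hP hρ hρ0 hY
  have h3 := sum_eq_sum_diag_add_sum_pair (fun i j => Y i j ^ 2)
  rw [← frob_sq_eq_sum] at h3
  have h4 : 0 ≤ ∑ i, Y i i ^ 2 := Finset.sum_nonneg fun _ _ => sq_nonneg _
  have h5 : ∀ a : Pair n, ip Y (w a) ^ 2 ≤ 4 * (Y a.1.1 a.1.1 ^ 2 + Y a.1.2 a.1.2 ^ 2)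
      + 4 * (Y a.1.1 a.1.2 ^ 2 + Y a.1.2 a.1.1 ^ 2) := fun a => by
    rw [ip_w]
    nlinarith [sq_nonneg (Y a.1.1 a.1.1 - Y a.1.2 a.1.2), sq_nonneg (Y a.1.1 a.1.1 + Y a.1.1 a.1.2),
      sq_nonneg (Y a.1.1 a.1.1 + Y a.1.2 a.1.1), sq_nonneg (Y a.1.2 a.1.2 + Y a.1.1 a.1.2),
      sq_nonneg (Y a.1.2 a.1.2 + Y a.1.2 a.1.1), sq_nonneg (Y a.1.1 a.1.2 - Y a.1.2 a.1.1)]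
  calc _ ≤ ∑ a : Pair n, (4 * (Y a.1.1 a.1.1 ^ 2 + Y a.1.2 a.1.2 ^ 2)
      + 4 * (Y a.1.1 a.1.2 ^ 2 + Y a.1.2 a.1.1 ^ 2)) := Finset.sum_le_sum fun a _ => h5 a
    _ = 4 * ∑ a : Pair n, (Y a.1.1 a.1.1 ^ 2 + Y a.1.2 a.1.2 ^ 2)
        + 4 * ∑ a : Pair n, (Y a.1.1 a.1.2 ^ 2 + Y a.1.2 a.1.1 ^ 2) := by
        rw [Finset.sum_add_distrib, Finset.mul_sum, Finset.mul_sum]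
    _ ≤ 4 * (n * (4 * ρ * frob Y ^ 2)) + 4 * frob Y ^ 2 := by
        have h6 : (n : ℝ) * ∑ i, Y i i ^ 2 ≤ n * (4 * ρ * frob Y ^ 2) :=
          mul_le_mul_of_nonneg_left h2 (Nat.cast_nonneg n)
        linarith
    _ = _ := by ring

end EDG

namespace EDG

open Matrix

variable {n m r : ℕ} {X : Matrix (Fin n) (Fin n) ℝ} {ν c : ℝ}

/-! ### Consequences of incoherence -/

lemma frob_sq_mul_unitMat {P : Matrix (Fin n) (Fin n) ℝ} (hP : IsOrthProj P) (i j : Fin n) :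
    frob (P * unitMat i j) ^ 2 = P i i := by
  rw [← hP.sum_sq_row, frob_sq_eq_sum]
  refine Finset.sum_congr rfl fun k _ => ?_
  rw [Finset.sum_eq_single j]
  · rw [unitMat, Matrix.mul_single_apply_same, mul_one, ← Matrix.transpose_apply P, hP.symm]
  · intro b _ hb
    rw [unitMat, Matrix.mul_single_apply_of_ne _ _ _ _ _ hb]; simp
  · simp

lemma unitMat_transpose (i j : Fin n) : (unitMat i j)ᵀ = unitMat j i := by
  simp [unitMat, Matrix.transpose_single]

lemma apply_self_le_frob_tangent_unitMat {P : Matrix (Fin n) (Fin n) ℝ} (hP : IsOrthProj P)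
    (i j : Fin n) : P j j ≤ frob (tangent P (unitMat i j)) ^ 2 := by
  have h1 : tangent P (unitMat i j) * P = unitMat i j * P := by
    rw [tangent, Matrix.sub_mul, Matrix.add_mul, Matrix.mul_assoc (unitMat i j), hP.idem,
      Matrix.mul_assoc (P * _) P P, hP.idem]
    abel
  have h2 : frob (unitMat i j * P) ^ 2 = P j j := by
    rw [← frob_transpose, Matrix.transpose_mul, hP.symm, unitMat_transpose, frob_sq_mul_unitMat hP]
  rw [← h2, ← h1]
  exact pow_le_pow_left₀ (frob_nonneg _) (hP.frob_mul_le' _) 2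

namespace IsIncoherent

lemma frob_sq_le {A : Matrix (Fin n) (Fin n) ℝ} {b : ℝ} (hb : 0 ≤ b) (h : frob A ≤ √b) :
    frob A ^ 2 ≤ b := by
  have := pow_le_pow_left₀ (frob_nonneg A) h 2
  rwa [Real.sq_sqrt hb] at this

lemma colProj_diag_le (h : IsIncoherent r ν X) (hn : 2 ≤ n) (i : Fin n) :
    colProj X i i ≤ ν * r / (128 * n) := by
  have hP := isOrthProj_colProj X
  have hν := h.one_le
  have hb : 0 ≤ ν * r / (128 * n) := by positivity
  -- The last index is never the first of a pair. Its leverage score is bounded through the tangent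
  -- projection of e_{0i} instead.
  by_cases hi : i.val + 1 < n
  · let a : Pair n := ⟨(i, ⟨i.val + 1, hi⟩), by simp [Fin.lt_def]⟩
    rw [← frob_sq_mul_unitMat hP i ⟨i.val + 1, hi⟩]
    exact frob_sq_le hb (h.col_unit a)
  · let a : Pair n := ⟨(⟨0, by omega⟩, i), by simp [Fin.lt_def]; omega⟩
    exact (apply_self_le_frob_tangent_unitMat hP ⟨0, by omega⟩ i).trans
      (frob_sq_le hb (h.tan_unit a))

/-- The leverage scores sum to the rank r, and each is at most νr/(128n). -/
lemma le_ν (h : IsIncoherent r ν X) (hn : 2 ≤ n) (hr : 1 ≤ r) (hrank : X.rank = r) : 128 ≤ ν := by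
  have h1 := sum_colProj_diag X
  rw [hrank] at h1
  have h2 : ∑ i, colProj X i i ≤ ∑ _i : Fin n, ν * r / (128 * n) :=
    Finset.sum_le_sum fun i _ => h.colProj_diag_le hn i
  rw [h1, Finset.sum_const, Finset.card_univ, Fintype.card_fin, nsmul_eq_mul] at h2
  have hn' : (0 : ℝ) < n := by positivity
  have hr' : (0 : ℝ) < r := by positivity
  have h3 : (n : ℝ) * (ν * r / (128 * n)) = ν / 128 * r := by field_simp
  rw [h3] at h2
  have := le_of_mul_le_mul_right ((one_mul (r : ℝ)).le.trans h2) hr'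
  linarith

end IsIncoherent

lemma nonempty_pair (hn : 2 ≤ n) : Nonempty (Pair n) :=
  ⟨⟨(⟨0, by omega⟩, ⟨1, by omega⟩), by simp [Fin.lt_def]⟩⟩

lemma isProbabilityMeasure_sampleLaw (hn : 2 ≤ n) (m : ℕ) : IsProbabilityMeasure (sampleLaw n m) := by
  have := nonempty_pair hn
  exact isProbabilityMeasure_pi_uniformOn (α := Pair n) m

lemma sampleLaw_real_mono (hn : 2 ≤ n) {p q : (Fin m → Pair n) → Prop} (h : ∀ ω, q ω → p ω) :
    (sampleLaw n m).real {ω | ¬ p ω} ≤ (sampleLaw n m).real {ω | ¬ q ω} := by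
  have := isProbabilityMeasure_sampleLaw hn m
  refine measureReal_mono fun ω hω => ?_
  simp only [Set.mem_ofPred_eq] at hω ⊢
  exact mt (h ω) hω

/-! ### The sampling operator on the tangent space -/

/-- Bernstein in dimension n² for the rank-one forms built from the tangent projections of v_α and
w_α. Their sum over all pairs is the identity on centered tangent matrices, by duality. -/
lemma sampleLaw_rip_le (hX : IsIncoherent r ν X) (hn : 2 ≤ n) (hm : 0 < m) (hr : 1 ≤ r)
    (hrank : X.rank = r) {ε : ℝ} (hε : 0 < ε) (hε1 : ε ≤ 1) (hc : 0 < c)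
    (hp : 5 * (ν ^ 2 * r ^ 2) * c ≤ 16 * n * (m / numPairs n) * ε ^ 2) :
    (sampleLaw n m).real {ω | ¬ ∀ A B : Matrix (Fin n) (Fin n) ℝ,
        IsCentered A → IsCentered B → tangent (colProj X) A = A → tangent (colProj X) B = B →
        |ip A (sampling ω B) - m / numPairs n * ip A B| ≤ m / numPairs n * ε * (frob A * frob B)}
      ≤ 2 * n ^ 2 * Real.exp (-c) := by
  have := nonempty_pair hn
  have hP := isOrthProj_colProj X
  have hν := hX.le_ν hn hr hrank
  have hn0 : (0 : ℝ) < n := by positivity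
  have hr1 : (1 : ℝ) ≤ r := by exact_mod_cast hr
  have hN : (0 : ℝ) < numPairs n := by rw [← card_pair]; exact_mod_cast Fintype.card_pos
  have hm0 : (0 : ℝ) < m := by positivity
  have hp0 : 0 < m / numPairs n := by positivity
  set p := m / numPairs n with hpdef
  have hνr : 128 ≤ ν * r := by nlinarith
  have hbern := measureReal_bernstein_rankOne_le (α := Pair n)
    (fun a => flat (tangent (colProj X) (v a))) (fun a => flat (tangent (colProj X) (w a)))
    -- `cy` is 16nρ + 4 = νr/8 + 4, at most 5νr/32 as νr ≥ 128. The variance V is p · `bx` · `cy`;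
    -- the other candidate p · `bz` · `cx` is smaller, again by νr ≥ 128.
    (bx := ν * r / (2 * n)) (bz := ν * r / (8 * n)) (cx := 1 / 2) (cy := 5 / 32 * (ν * r))
    (V := 5 * p * (ν * r) ^ 2 / (64 * n)) (c := c) (t := p * ε) m
    (fun a => by
      rw [flat_dotProduct, ← frob_sq]
      exact IsIncoherent.frob_sq_le (by positivity) (hX.tan_v a))
    (fun a => by
      rw [flat_dotProduct, ← frob_sq]
      exact IsIncoherent.frob_sq_le (by positivity) (hX.tan_w a))
    (fun u => by
      obtain ⟨U, rfl⟩ := exists_flat u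
      simp only [flat_dotProduct, ← ip_tangent hP, ← frob_sq]
      refine (sum_ip_v_sq_le _).trans ?_
      gcongr
      · exact frob_nonneg _
      · exact frob_tangent_le hP U)
    (fun u => by
      obtain ⟨U, rfl⟩ := exists_flat u
      simp only [flat_dotProduct, ip_comm _ U, ← ip_tangent hP, ← frob_sq]
      refine (sum_ip_w_sq_le hP (hX.colProj_diag_le hn) (by positivity)
        (tangent_tangent hP U)).trans ?_
      have h1 : 16 * (n : ℝ) * (ν * r / (128 * n)) + 4 ≤ 5 / 32 * (ν * r) := by
        have : 16 * (n : ℝ) * (ν * r / (128 * n)) = ν * r / 8 := by field_simp; norm_num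
        linarith
      gcongr
      · exact frob_nonneg _
      · exact frob_tangent_le hP U)
    (by positivity) (by positivity)
    (by
      rw [card_pair, ← hpdef, show p * (ν * r / (8 * n) * (1 / 2)) = 4 * p * (ν * r) / (64 * n) by
        ring]
      gcongr ?_ / _
      nlinarith [mul_le_mul_of_nonneg_left hνr (by positivity : 0 ≤ p * (ν * r))])
    (by rw [card_pair, ← hpdef]; exact le_of_eq (by ring))
    hm (by positivity) hc (by positivity)
    (by
      have h1 : c ≤ 5 / 16 * n * p := by
        have h2 : 5 * 128 ^ 2 * c ≤ 5 * (ν ^ 2 * r ^ 2) * c := by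
          have : (128 : ℝ) ^ 2 ≤ ν ^ 2 * r ^ 2 := by rw [← mul_pow]; gcongr
          gcongr
        have h3 : 16 * n * p * ε ^ 2 ≤ 16 * n * p := by
          have : ε ^ 2 ≤ 1 := by nlinarith
          exact mul_le_of_le_one_right (by positivity) this
        have : 0 < n * p := by positivity
        linarith
      rw [show 4 * (ν * r / (2 * n) * (ν * r / (8 * n))) * c = (ν * r) ^ 2 / (4 * n ^ 2) * c by
        field_simp; norm_num]
      calc _ ≤ (ν * r) ^ 2 / (4 * n ^ 2) * (5 / 16 * n * p) := by gcongr
        _ = _ := by field_simp; norm_num)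
    (by
      rw [show 4 * (5 * p * (ν * r) ^ 2 / (64 * n)) * c
        = p / (16 * n) * (5 * (ν ^ 2 * r ^ 2) * c) by field_simp; norm_num]
      calc _ ≤ p / (16 * n) * (16 * n * p * ε ^ 2) := by gcongr
        _ = _ := by field_simp)
  refine (sampleLaw_real_mono hn fun ω hgood A B hcA hcB hA hB => ?_).trans (hbern.trans (le_of_eq ?_))
  · have h1 := hgood (flat A) (flat B)
    simp only [flat_dotProduct, ← ip_tangent hP, ip_tangent hP (w _), hA, hB, card_pair] at h1
    simp only [ip_comm (w _) B, sum_ip_v_mul_ip_w hcA hcB, ← hpdef] at h1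
    rw [ip_sampling]
    exact h1
  · rw [Fintype.card_prod, Fintype.card_fin]; push_cast; ring

/-! ### Diagonal perturbations -/

lemma pair_indicator_dotProduct (a : Pair n) (z : Fin n → ℝ) :
    (Pi.single a.1.1 1 + Pi.single a.1.2 1 : Fin n → ℝ) ⬝ᵥ z = z a.1.1 + z a.1.2 := by
  rw [add_dotProduct, single_one_dotProduct, single_one_dotProduct]

/-- Rank-one Bernstein pairing the tangent projection of v_α with e_i + e_j. The second argument is
an arbitrary vector d, so the estimate applies to the diagonal of any B, tangent or not. -/
lemma sampleLaw_diag_le (hX : IsIncoherent r ν X) (hn : 2 ≤ n) (hm : 0 < m) (hr : 1 ≤ r)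
    (hc : 0 < c) (hp : 4 * c ≤ n * (m / numPairs n)) {Λ : ℝ} (hΛ0 : 0 ≤ Λ)
    (hΛ : 4 * (ν * r) * c ≤ m / numPairs n * Λ ^ 2) :
    (sampleLaw n m).real {ω | ¬ ∀ (A : Matrix (Fin n) (Fin n) ℝ) (d : Fin n → ℝ),
        IsCentered A → tangent (colProj X) A = A →
        |∑ k, A (ω k).1.1 (ω k).1.2 * (d (ω k).1.1 + d (ω k).1.2)
            + m / numPairs n * ∑ i, A i i * d i|
          ≤ m / numPairs n * Λ * (frob A * √(d ⬝ᵥ d))}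
      ≤ (n ^ 2 + n) * Real.exp (-c) := by
  have := nonempty_pair hn
  have hP := isOrthProj_colProj X
  have hν := hX.one_le
  have hn0 : (0 : ℝ) < n := by positivity
  have hr1 : (1 : ℝ) ≤ r := by exact_mod_cast hr
  have hN : (0 : ℝ) < numPairs n := by rw [← card_pair]; exact_mod_cast Fintype.card_pos
  have hm0 : (0 : ℝ) < m := by positivity
  have hp0 : 0 < m / numPairs n := by positivity
  set p := m / numPairs n with hpdef
  have hνr : 1 ≤ ν * r := by nlinarith
  have hbern := measureReal_bernstein_rankOne_le (α := Pair n)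
    (fun a => flat (tangent (colProj X) (v a)))
    (fun a => (Pi.single a.1.1 1 + Pi.single a.1.2 1 : Fin n → ℝ))
    (bx := ν * r / (2 * n)) (bz := 2) (cx := 1 / 2) (cy := 2 * n)
    (V := p * (ν * r)) (c := c) (t := p * Λ) m
    (fun a => by
      rw [flat_dotProduct, ← frob_sq]
      exact IsIncoherent.frob_sq_le (by positivity) (hX.tan_v a))
    (fun a => by
      rw [pair_indicator_dotProduct]
      simp [a.2.ne, a.2.ne']
      norm_num)
    (fun u => by
      obtain ⟨U, rfl⟩ := exists_flat u
      simp only [flat_dotProduct, ← ip_tangent hP, ← frob_sq]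
      refine (sum_ip_v_sq_le _).trans ?_
      gcongr
      · exact frob_nonneg _
      · exact frob_tangent_le hP U)
    (fun z => by
      simp only [pair_indicator_dotProduct]
      calc _ ≤ ∑ a : Pair n, 2 * (z a.1.1 ^ 2 + z a.1.2 ^ 2) :=
            Finset.sum_le_sum fun a _ => by nlinarith [sq_nonneg (z a.1.1 - z a.1.2)]
        _ = 2 * ∑ a : Pair n, (z a.1.1 ^ 2 + z a.1.2 ^ 2) := by rw [Finset.mul_sum]
        _ ≤ 2 * (n * ∑ i, z i ^ 2) := by
            gcongr; exact sum_pair_add_le (fun i => z i ^ 2) fun i => sq_nonneg _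
        _ = 2 * n * (z ⬝ᵥ z) := by simp only [dotProduct, sq]; ring)
    (by positivity) (by positivity)
    (by rw [card_pair, ← hpdef]; nlinarith)
    (by rw [card_pair, ← hpdef]; exact le_of_eq (by field_simp))
    hm (by positivity) hc (by positivity)
    (by
      rw [show 4 * (ν * r / (2 * n) * 2) * c = ν * r / n * (4 * c) by field_simp]
      calc _ ≤ ν * r / n * (n * p) := by gcongr
        _ = _ := by field_simp)
    (by
      calc _ = p * (4 * (ν * r) * c) := by ring
        _ ≤ p * (p * Λ ^ 2) := by gcongr
        _ = _ := by ring)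
  refine (sampleLaw_real_mono hn fun ω hgood A d hcA hA => ?_).trans (hbern.trans (le_of_eq ?_))
  · have h1 := hgood (flat A) d
    simp only [flat_dotProduct, ← ip_tangent hP, hA, card_pair, pair_indicator_dotProduct,
      ip_v hcA, neg_mul, Finset.sum_neg_distrib, sum_pair_diag hcA, neg_neg, ← hpdef] at h1
    rw [← abs_neg, neg_add']
    exact h1
  · rw [Fintype.card_prod, Fintype.card_fin]; push_cast; ring

/-! ### The initial guess -/

lemma abs_dotProduct_centered_le (u : Fin n → ℝ) (i : Fin n) : |u ⬝ᵥ centered i| ≤ √(u ⬝ᵥ u) := by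
  refine (abs_dotProduct_le u (centered i)).trans ?_
  have := Real.sqrt_le_one.2 (centered_dotProduct_self_le i)
  exact mul_le_of_le_one_right (Real.sqrt_nonneg _) this

lemma v_mulVec (a : Pair n) (z : Fin n → ℝ) :
    v a *ᵥ z = (-(1 / 2 : ℝ)) • ((z ⬝ᵥ centered a.1.2) • centered a.1.1
      + (z ⬝ᵥ centered a.1.1) • centered a.1.2) := by
  rw [v, Matrix.smul_mulVec, Matrix.add_mulVec, Matrix.vecMulVec_mulVec, Matrix.vecMulVec_mulVec,
    dotProduct_comm z, dotProduct_comm z]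
  simp

lemma abs_dotProduct_v_mulVec_le (a : Pair n) (u z : Fin n → ℝ) :
    |u ⬝ᵥ v a *ᵥ z| ≤ √(u ⬝ᵥ u) * √(z ⬝ᵥ z) := by
  rw [v_mulVec]
  simp only [dotProduct_smul, dotProduct_add, smul_eq_mul]
  have h1 := abs_dotProduct_centered_le u a.1.1
  have h2 := abs_dotProduct_centered_le u a.1.2
  have h3 := abs_dotProduct_centered_le z a.1.1
  have h4 := abs_dotProduct_centered_le z a.1.2
  have h5 := mul_le_mul h4 h1 (abs_nonneg _) (Real.sqrt_nonneg _)
  have h6 := mul_le_mul h3 h2 (abs_nonneg _) (Real.sqrt_nonneg _)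
  rw [← abs_mul] at h5 h6
  rw [abs_mul, abs_neg, abs_of_pos (by norm_num : (0 : ℝ) < 1 / 2)]
  have h7 := abs_add_le (z ⬝ᵥ centered a.1.2 * (u ⬝ᵥ centered a.1.1))
    (z ⬝ᵥ centered a.1.1 * (u ⬝ᵥ centered a.1.2))
  linarith

lemma sum_v_mulVec_sq_le (z : Fin n → ℝ) :
    ∑ a, (v a *ᵥ z) ⬝ᵥ (v a *ᵥ z) ≤ n / 2 * (z ⬝ᵥ z) := by
  have h1 : ∀ a : Pair n, (v a *ᵥ z) ⬝ᵥ (v a *ᵥ z)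
      ≤ 1 / 2 * ((centered a.1.1 ⬝ᵥ z) ^ 2 + (centered a.1.2 ⬝ᵥ z) ^ 2) := fun a => by
    rw [v_mulVec]
    set x := centered a.1.1
    set y := centered a.1.2
    have hx : x ⬝ᵥ x ≤ 1 := centered_dotProduct_self_le _
    have hy : y ⬝ᵥ y ≤ 1 := centered_dotProduct_self_le _
    have hsq := dotProduct_self_nonneg_real ((z ⬝ᵥ y) • x - (z ⬝ᵥ x) • y)
    simp only [dotProduct_smul, dotProduct_add, dotProduct_sub, smul_dotProduct, add_dotProduct,
      sub_dotProduct, smul_eq_mul, dotProduct_comm y x, dotProduct_comm x z, dotProduct_comm y z]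
      at hsq ⊢
    nlinarith [mul_le_mul_of_nonneg_left hx (sq_nonneg (z ⬝ᵥ y)),
      mul_le_mul_of_nonneg_left hy (sq_nonneg (z ⬝ᵥ x))]
  have h2 := sum_pair_add_le (fun i => (centered i ⬝ᵥ z) ^ 2) fun i => sq_nonneg _
  have h3 := sum_centered_dotProduct_sq_le z
  calc _ ≤ ∑ a : Pair n, 1 / 2 * ((centered a.1.1 ⬝ᵥ z) ^ 2 + (centered a.1.2 ⬝ᵥ z) ^ 2) :=
        Finset.sum_le_sum fun a _ => h1 a
    _ = 1 / 2 * ∑ a : Pair n, ((centered a.1.1 ⬝ᵥ z) ^ 2 + (centered a.1.2 ⬝ᵥ z) ^ 2) := by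
        rw [Finset.mul_sum]
    _ ≤ 1 / 2 * (n * (z ⬝ᵥ z)) := by
        have : (n : ℝ) * ∑ i, (centered i ⬝ᵥ z) ^ 2 ≤ n * (z ⬝ᵥ z) := by gcongr
        linarith
    _ = _ := by ring

/-- Bernstein for ⟨X, w_α⟩ v_α, whose sum over all pairs is X. The entry bound enters through |⟨X,
w_α⟩| ≤ 4M, and the variance is p · 16M² · n/2. -/
lemma sampleLaw_opNorm_le (hX : IsCentered X) (hn : 2 ≤ n) (hm : 0 < m) {M : ℝ} (hM0 : 0 < M)
    (hM : ∀ i j, |X i j| ≤ M) (hc : 0 < c) (hp : 8 * c ≤ n * (m / numPairs n)) {t : ℝ} (ht : 0 ≤ t)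
    (htM : 32 * (n * (m / numPairs n)) * M ^ 2 * c ≤ t ^ 2) :
    (sampleLaw n m).real {ω | ¬ opNorm (sampling ω X - (m / numPairs n) • X) ≤ t}
      ≤ 2 * n * Real.exp (-c) := by
  have := nonempty_pair hn
  have hn0 : (0 : ℝ) < n := by positivity
  have hN : (0 : ℝ) < numPairs n := by rw [← card_pair]; exact_mod_cast Fintype.card_pos
  have hm0 : (0 : ℝ) < m := by positivity
  have hp0 : 0 < m / numPairs n := by positivity
  have hVm : Fintype.card (Pair n) * (8 * (n * (m / numPairs n)) * M ^ 2 / m) = 8 * n * M ^ 2 := by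
    rw [card_pair]; field_simp
  set p := m / numPairs n with hpdef
  have hw : ∀ a, |ip X (w a)| ≤ 4 * M := fun a => by
    rw [ip_w]
    have h1 := abs_le.1 (hM a.1.1 a.1.1)
    have h2 := abs_le.1 (hM a.1.2 a.1.2)
    have h3 := abs_le.1 (hM a.1.1 a.1.2)
    have h4 := abs_le.1 (hM a.1.2 a.1.1)
    exact abs_le.2 ⟨by linarith, by linarith⟩
  have hsum : ∀ z : Fin n → ℝ, ∑ a, ((ip X (w a) • v a) *ᵥ z) ⬝ᵥ ((ip X (w a) • v a) *ᵥ z)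
      ≤ 8 * n * M ^ 2 * (z ⬝ᵥ z) := fun z => by
    calc _ ≤ ∑ a, (4 * M) ^ 2 * ((v a *ᵥ z) ⬝ᵥ (v a *ᵥ z)) := by
          refine Finset.sum_le_sum fun a _ => ?_
          rw [Matrix.smul_mulVec, smul_dotProduct, dotProduct_smul, smul_eq_mul, smul_eq_mul,
            ← mul_assoc, ← sq]
          exact mul_le_mul_of_nonneg_right (sq_le_sq' (abs_le.1 (hw a)).1 (abs_le.1 (hw a)).2)
            (dotProduct_self_nonneg_real _)
      _ = 16 * M ^ 2 * ∑ a, (v a *ᵥ z) ⬝ᵥ (v a *ᵥ z) := by rw [← Finset.mul_sum]; ring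
      _ ≤ 16 * M ^ 2 * (n / 2 * (z ⬝ᵥ z)) := by gcongr; exact sum_v_mulVec_sq_le z
      _ = _ := by ring
  have hbern := measureReal_bernstein_exp_le (α := Pair n) (fun a => ip X (w a) • v a) (R := 4 * M)
    (V := 8 * (n * p) * M ^ 2) (c := c) (t := t) m hm (by positivity) hc ht
    (by nlinarith [mul_le_mul_of_nonneg_left hp (sq_nonneg M)]) (by linarith)
    (fun a u z => by
      rw [Matrix.smul_mulVec, dotProduct_smul, smul_eq_mul, abs_mul]
      exact mul_le_mul (hw a) (abs_dotProduct_v_mulVec_le a u z) (abs_nonneg _) (by positivity))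
    (fun u => by
      rw [hVm]
      simp only [Matrix.transpose_smul, (isCentered_v _).1.eq]
      exact hsum u)
    (fun z => by rw [hVm]; exact hsum z)
  refine (sampleLaw_real_mono hn fun ω hgood => ?_).trans (hbern.trans (le_of_eq ?_))
  · refine opNorm_le_of_bilin ht fun u z => ?_
    have h1 := hgood u z
    rw [card_pair, ← hpdef] at h1
    simp only [← dotProduct_sum, ← Matrix.sum_mulVec] at h1
    rw [sum_ip_w_smul_v hX] at h1
    rwa [Matrix.sub_mulVec, Matrix.smul_mulVec, dotProduct_sub, dotProduct_smul, smul_eq_mul]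
  · rw [Fintype.card_fin]; ring

end EDG

namespace EDG

open Matrix

variable {n m r : ℕ}

/-! ### Repeated samples -/

lemma sum_incid_le (i j : Fin n) : ∑ a : Pair n, (incid a i j : ℝ) ≤ 1 := by
  have h := sum_eq_sum_diag_add_sum_pair (n := n) (fun k l => if k = i ∧ l = j then 1 else 0)
  have h1 : ∑ k : Fin n, ∑ l : Fin n, (if k = i ∧ l = j then (1 : ℝ) else 0) = 1 := by
    simp [ite_and]
  have h2 : 0 ≤ ∑ k : Fin n, (if k = i ∧ k = j then (1 : ℝ) else 0) :=
    Finset.sum_nonneg fun k _ => by split_ifs <;> norm_num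
  have h3 : ∀ a : Pair n, (incid a i j : ℝ) = (if a.1.1 = i ∧ a.1.2 = j then 1 else 0)
      + if a.1.2 = i ∧ a.1.1 = j then 1 else 0 := fun a => by
    simp only [incid, Prod.ext_iff, and_comm (a := a.1.2 = i)]
    push_cast
    rfl
  simp only [h3]
  linarith

lemma incid_eq_zero_or_single (a : Pair n) (i : Fin n) :
    incid a i = 0 ∨ ∃ j, incid a i = Pi.single j 1 := by
  obtain ⟨⟨k, l⟩, hkl⟩ := a
  have hne : k ≠ l := ne_of_lt hkl
  by_cases hk : k = i
  · subst hk
    refine Or.inr ⟨l, funext fun j => ?_⟩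
    by_cases hj : j = l
    · simp [incid, hj, hne]
    · simp [incid, hj, hne.symm, Ne.symm hj]
  · by_cases hl : l = i
    · subst hl
      refine Or.inr ⟨k, funext fun j => ?_⟩
      by_cases hj : j = k
      · simp [incid, hj, hne]
      · simp [incid, hj, hne, Ne.symm hj]
    · left; funext j; simp [incid, hk, hl]

/-- The square, continued linearly beyond `τ`. -/
noncomputable def huber (τ : ℝ) (t : ℕ) : ℝ :=
  if (t : ℝ) ≤ τ then (t : ℝ) ^ 2 else 2 * τ * t - τ ^ 2

/-- The bounded slope is the purpose of the linear continuation: one draw raises the potential by at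
most 2τ. The second bound is the one that the square itself satisfies. -/
lemma huber_succ_sub_le (τ : ℝ) (t : ℕ) :
    huber τ (t + 1) - huber τ t ≤ 2 * τ ∧ huber τ (t + 1) - huber τ t ≤ 2 * t + 2 := by
  simp only [huber]
  push_cast
  split_ifs with h1 h2 h2
  · constructor <;> nlinarith
  · linarith
  · constructor <;> nlinarith [sq_nonneg (τ - t)]
  · constructor <;> nlinarith

lemma huber_nonneg {τ : ℝ} (hτ : 0 ≤ τ) (t : ℕ) : 0 ≤ huber τ t := by
  rw [huber]; split_ifs with h
  · positivity
  · nlinarith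

/-- Nothing is lost on the bad event: a single count t > τ already contributes 2τt − τ² > τ². -/
lemma sq_le_sum_huber {τ : ℝ} (hτ : 0 ≤ τ) (s : Fin n → ℕ) (hs : τ ^ 2 < ∑ j, (s j : ℝ) ^ 2) :
    τ ^ 2 ≤ ∑ j, huber τ (s j) := by
  by_cases h : ∀ j, (s j : ℝ) ≤ τ
  · simp only [huber, h, if_true]; exact hs.le
  · push Not at h
    obtain ⟨j, hj⟩ := h
    refine le_trans ?_ (Finset.single_le_sum (f := fun j => huber τ (s j))
      (fun j _ => huber_nonneg hτ _) (Finset.mem_univ j))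
    simp only [huber, hj.not_ge, if_false]
    nlinarith

lemma exp_le_one_add_two_mul {x : ℝ} (h0 : 0 ≤ x) (h1 : x ≤ 1) : Real.exp x ≤ 1 + 2 * x := by
  have h := Real.abs_exp_sub_one_le (x := x) (by rwa [abs_of_nonneg h0])
  rw [abs_of_nonneg h0] at h
  linarith [(abs_le.1 h).2]

lemma sum_add_single_apply (f : ℕ → ℝ) (s : Fin n → ℕ) (j : Fin n) :
    ∑ l, f ((s + Pi.single j 1 : Fin n → ℕ) l) = ∑ l, f (s l) + (f (s j + 1) - f (s j)) := by
  rw [← sub_eq_iff_eq_add', ← Finset.sum_sub_distrib, Finset.sum_eq_single j]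
  · simp
  · intro b _ hb; simp [hb]
  · simp

/-- A draw raises at most one count of row i, by one. With θ = 1/(4τ) the Huber part of the exponent
grows by at most 1/2 and the linear part by A ≤ 1/2, within the range where e^x ≤ 1 + 2x. -/
lemma exp_huber_add_incid_le {τ θ A : ℝ} (hτ : 0 < τ) (hθ : θ = 1 / (4 * τ)) (hA0 : 0 ≤ A)
    (hA : A ≤ 1 / 2) (s : Fin n → ℕ) (a : Pair n) (i : Fin n) :
    Real.exp (θ * ∑ j, huber τ ((s + incid a i) j) + A * ∑ j, ((s + incid a i) j : ℝ))
      ≤ Real.exp (θ * ∑ j, huber τ (s j) + A * ∑ j, (s j : ℝ))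
        * (1 + ∑ j, (incid a i j : ℝ) * (2 * (θ * (2 * s j + 2) + A))) := by
  have hθ0 : 0 < θ := by rw [hθ]; positivity
  rcases incid_eq_zero_or_single a i with h | ⟨j, h⟩
  · simp [h]
  · have h1 := sum_add_single_apply (huber τ) s j
    have h2 := sum_add_single_apply (fun t => (t : ℝ)) s j
    simp only [h]
    rw [h1, h2]
    have h3 : ∑ l, ((Pi.single j 1 : Fin n → ℕ) l : ℝ) * (2 * (θ * (2 * s l + 2) + A))
        = 2 * (θ * (2 * s j + 2) + A) := by
      rw [Finset.sum_eq_single j]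
      · simp
      · intro b _ hb; simp [hb]
      · simp
    rw [h3]
    set y := θ * min (2 * τ) (2 * s j + 2) + A with hy
    have hy0 : 0 ≤ y := by positivity
    have hτθ : θ * (2 * τ) = 1 / 2 := by rw [hθ]; field_simp; norm_num
    have hy1 : y ≤ 1 := by
      have := mul_le_mul_of_nonneg_left (min_le_left (2 * τ) (2 * (s j : ℝ) + 2)) hθ0.le
      linarith
    have hy2 : y ≤ θ * (2 * s j + 2) + A := by
      have := mul_le_mul_of_nonneg_left (min_le_right (2 * τ) (2 * (s j : ℝ) + 2)) hθ0.le
      linarith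
    have hy3 : θ * (huber τ (s j + 1) - huber τ (s j)) + A ≤ y := by
      have h4 := huber_succ_sub_le τ (s j)
      have := mul_le_mul_of_nonneg_left (le_min h4.1 h4.2) hθ0.le
      linarith
    have h5 := exp_le_one_add_two_mul hy0 hy1
    calc _ = Real.exp (θ * ∑ j, huber τ (s j) + A * ∑ j, (s j : ℝ))
          * Real.exp (θ * (huber τ (s j + 1) - huber τ (s j)) + A) := by
          rw [← Real.exp_add]; congr 1; push_cast; ring
      _ ≤ _ := by
          gcongr
          exact (Real.exp_le_exp.2 hy3).trans (h5.trans (by linarith))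

/-- Averaging over the draw produces a drift 4θ/L times the current total count. The linear term of
the potential is there to absorb it, by raising its coefficient A. -/
lemma sum_exp_huber_add_incid_le {τ θ A : ℝ} (hn : 2 ≤ n) (hτ : 0 < τ) (hθ : θ = 1 / (4 * τ))
    (hA0 : 0 ≤ A) (hA : A ≤ 1 / 2) (s : Fin n → ℕ) (i : Fin n) :
    ∑ a : Pair n,
        Real.exp (θ * ∑ j, huber τ ((s + incid a i) j) + A * ∑ j, ((s + incid a i) j : ℝ))
      ≤ numPairs n * Real.exp (θ * ∑ j, huber τ (s j) + (A + 4 * θ / numPairs n) * ∑ j, (s j : ℝ)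
        + n * (4 * θ + 2 * A) / numPairs n) := by
  have := nonempty_pair hn
  have hN : (0 : ℝ) < numPairs n := by rw [← card_pair]; exact_mod_cast Fintype.card_pos
  have hθ0 : 0 < θ := by rw [hθ]; positivity
  set E := Real.exp (θ * ∑ j, huber τ (s j) + A * ∑ j, (s j : ℝ)) with hE
  set D := ∑ j, 2 * (θ * (2 * (s j : ℝ) + 2) + A) with hD
  have h1 : ∑ a : Pair n, ∑ j, (incid a i j : ℝ) * (2 * (θ * (2 * s j + 2) + A)) ≤ D := by
    rw [Finset.sum_comm]
    refine Finset.sum_le_sum fun j _ => ?_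
    rw [← Finset.sum_mul]
    exact mul_le_of_le_one_left (by positivity) (sum_incid_le i j)
  have h2 : D = 4 * θ * ∑ j, (s j : ℝ) + n * (4 * θ + 2 * A) := by
    simp only [hD, mul_add, Finset.sum_add_distrib, ← Finset.mul_sum, Finset.sum_const,
      Finset.card_univ, Fintype.card_fin, nsmul_eq_mul]
    ring
  calc _ ≤ ∑ a : Pair n, E * (1 + ∑ j, (incid a i j : ℝ) * (2 * (θ * (2 * s j + 2) + A))) :=
        Finset.sum_le_sum fun a _ => exp_huber_add_incid_le hτ hθ hA0 hA s a i
    _ = E * (numPairs n + ∑ a : Pair n, ∑ j, (incid a i j : ℝ) * (2 * (θ * (2 * s j + 2) + A))) := by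
        rw [← Finset.mul_sum, Finset.sum_add_distrib, ← card_pair]; simp
    _ ≤ E * (numPairs n + D) := by gcongr
    _ = E * (numPairs n * (D / numPairs n + 1)) := by field_simp; ring
    _ ≤ E * (numPairs n * Real.exp (D / numPairs n)) := by gcongr; exact Real.add_one_le_exp _
    _ = numPairs n * Real.exp (θ * ∑ j, huber τ (s j) + A * ∑ j, (s j : ℝ) + D / numPairs n) := by
        rw [Real.exp_add]; ring
    _ = _ := by congr 2; rw [h2]; field_simp; ring

lemma sampleLaw_row_le {τ θ : ℝ} (hn : 2 ≤ n) (hmL : (m : ℝ) ≤ numPairs n) (hτ : 2 ≤ τ)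
    (hθ : θ = 1 / (4 * τ)) (i : Fin n) :
    (sampleLaw n m).real {ω | ¬ ∑ j, (mult ω i j : ℝ) ^ 2 ≤ τ ^ 2}
      ≤ Real.exp (12 * (n * (m / numPairs n)) * θ - θ * τ ^ 2) := by
  have := nonempty_pair hn
  have hN : (0 : ℝ) < numPairs n := by rw [← card_pair]; exact_mod_cast Fintype.card_pos
  have hτ0 : 0 < τ := by linarith
  have hθ0 : 0 < θ := by rw [hθ]; positivity
  have h4θ : 4 * θ ≤ 1 / 2 := by
    rw [hθ, ← mul_div_assoc, mul_one, div_mul_cancel_left₀ (by norm_num), one_div]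
    exact inv_anti₀ (by norm_num) hτ
  -- With k draws remaining, the linear coefficient is 4θk/L. Since m ≤ L it stays below 4θ ≤ 1/2,
  -- and each draw adds at most n(4θ + 2·4θ)/L = 12nθ/L.
  have hstep := sum_pi_le_of_step (m := m) (fun a : Pair n => incid a i)
    (fun k s => Real.exp (θ * ∑ j, huber τ (s j) + (4 * θ * (k / numPairs n)) * ∑ j, (s j : ℝ)
      + k * (12 * n * θ / numPairs n)))
    (fun k hk s => by
      have hk1 : (k : ℝ) / numPairs n ≤ 1 := by
        rw [div_le_one hN]
        exact (Nat.cast_le.2 hk.le).trans hmL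
      have hA1 : 4 * θ * (k / numPairs n) ≤ 4 * θ := mul_le_of_le_one_right (by positivity) hk1
      have h1 := sum_exp_huber_add_incid_le hn hτ0 hθ (A := 4 * θ * (k / numPairs n))
        (by positivity) (hA1.trans h4θ) s i
      simp only [Real.exp_add _ ((k : ℝ) * _)]
      rw [← Finset.sum_mul, card_pair]
      refine (mul_le_mul_of_nonneg_right h1 (Real.exp_pos _).le).trans ?_
      rw [mul_assoc, ← Real.exp_add]
      refine mul_le_mul_of_nonneg_left (Real.exp_le_exp.2 ?_) hN.le
      have h2 : n * (4 * θ + 2 * (4 * θ * (k / numPairs n))) / numPairs n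
          ≤ 12 * n * θ / numPairs n := by
        gcongr ?_ / _
        nlinarith [mul_le_mul_of_nonneg_left hA1 (Nat.cast_nonneg (α := ℝ) n)]
      push_cast
      have h3 : 4 * θ * ((k + 1 : ℝ) / numPairs n)
          = 4 * θ * (k / numPairs n) + 4 * θ / numPairs n := by ring
      rw [h3]
      linarith) 0
  refine measureReal_pi_uniformOn_le
    (f := fun ω => Real.exp (-(θ * τ ^ 2)) * Real.exp (θ * ∑ j, huber τ (mult ω i j)))
    (fun ω => by positivity) (fun ω hω => ?_) ?_
  · simp only [Set.mem_ofPred_eq, not_le] at hω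
    rw [← Real.exp_add]
    refine Real.one_le_exp ?_
    have := mul_le_mul_of_nonneg_left (sq_le_sum_huber hτ0.le _ hω) hθ0.le
    linarith
  · rw [← Finset.mul_sum]
    have h0 : ∀ (ω : Fin m → Pair n) j, (∑ k, incid (ω k) i) j = mult ω i j := fun ω j => by
      rw [Finset.sum_apply]; rfl
    have hh0 : huber τ 0 = 0 := by simp [huber, hτ0.le]
    simp only [zero_add, h0, Pi.zero_apply, hh0, Nat.cast_zero, zero_div, mul_zero, zero_mul,
      add_zero, Finset.sum_const_zero] at hstep
    refine (mul_le_mul_of_nonneg_left hstep (Real.exp_pos _).le).trans (le_of_eq ?_)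
    rw [mul_left_comm, ← Real.exp_add]
    congr 2
    ring

end EDG

namespace EDG

open Matrix

/-! ### Numerical consequences of the lower bound on the number of samples -/

/-- Here g stands for νr, y for √(np), and the row bound τ is 8y. The hypothesis on η²gn is dictated
by the term τ√(ρτ)η, the most expensive one. -/
lemma smallRadius_of_sq_le {n p y g ε η Λ c : ℝ} (hp : 0 < p) (hp1 : p ≤ 1) (hn : 1 ≤ n)
    (hy : 0 < y) (hynp : y ^ 2 = n * p) (hg : 128 ≤ g) (hε : 0 < ε) (hε' : ε < 1 / 22) (hη : 0 ≤ η)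
    (hηq : η ^ 2 * g * n ≤ y * (ε / 40) ^ 2) (hΛ : 0 ≤ Λ) (hΛc : p * Λ ^ 2 ≤ 4 * g * c)
    (hc : 4 * c ≤ y) :
    GoodSample.SmallRadius p ε Λ (8 * y) (g / (128 * n)) η := by
  have hn0 : 0 < n := by linarith
  have hg0 : 0 < g := by linarith
  -- In units of pe, the budget of 40 is spent as 3/11 + 3 on 3ηp(1+Λ), 28 on the term with √(ρτ),
  -- and less than 1 on the terms quadratic in η.
  set e := ε / 40 with he
  have he0 : 0 < e := by positivity
  have hyn : y ≤ n := by nlinarith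
  have h1 : η ≤ e / 11 := by
    refine le_of_sq_le_sq ?_ (by positivity)
    have h2 : η ^ 2 * 128 * n ≤ η ^ 2 * g * n := by gcongr
    have h3 : y * e ^ 2 ≤ n * e ^ 2 := by gcongr
    have h4 : η ^ 2 * 128 ≤ e ^ 2 := by
      refine le_of_mul_le_mul_right ?_ hn0
      linarith
    nlinarith
  have h2 : Λ * η ≤ e := by
    refine le_of_sq_le_sq ?_ he0.le
    refine le_of_mul_le_mul_left ?_ (by positivity : 0 < n * p)
    calc n * p * (Λ * η) ^ 2 = n * η ^ 2 * (p * Λ ^ 2) := by ring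
      _ ≤ n * η ^ 2 * (4 * g * c) := by gcongr
      _ = n * η ^ 2 * g * (4 * c) := by ring
      _ ≤ n * η ^ 2 * g * y := by gcongr
      _ = η ^ 2 * g * n * y := by ring
      _ ≤ y * e ^ 2 * y := by gcongr
      _ = n * p * e ^ 2 := by rw [← hynp]; ring
  have h3 : 8 * y * √(g / (128 * n) * (8 * y)) * η ≤ 2 * p * e := by
    refine le_of_sq_le_sq ?_ (by positivity)
    rw [mul_pow, mul_pow, Real.sq_sqrt (by positivity)]
    refine le_of_mul_le_mul_left ?_ (by positivity : 0 < n ^ 2)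
    calc n ^ 2 * ((8 * y) ^ 2 * (g / (128 * n) * (8 * y)) * η ^ 2)
        = 4 * y ^ 3 * (η ^ 2 * g * n) := by field_simp; ring
      _ ≤ 4 * y ^ 3 * (y * e ^ 2) := by gcongr
      _ = 4 * (y ^ 2) ^ 2 * e ^ 2 := by ring
      _ = n ^ 2 * (2 * p * e) ^ 2 := by rw [hynp]; ring
  have h4 : y * η ^ 2 * 128 ≤ p * e ^ 2 := by
    refine le_of_mul_le_mul_left ?_ hn0
    calc n * (y * η ^ 2 * 128) ≤ n * (y * η ^ 2 * g) := by gcongr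
      _ = y * (η ^ 2 * g * n) := by ring
      _ ≤ y * (y * e ^ 2) := by gcongr
      _ = n * (p * e ^ 2) := by rw [← mul_assoc, ← sq, hynp]; ring
  refine ⟨hp, hΛ, by positivity, by positivity, hη, hε, hε', ?_⟩
  have h5 : p * η ≤ p * (e / 11) := by gcongr
  have h6 : p * (Λ * η) ≤ p * e := by gcongr
  have h7 : p * η ^ 2 ≤ p * (e / 11) ^ 2 := by gcongr
  have h8 : e ≤ 1 := by rw [he]; linarith
  have h9 : p * e ^ 2 ≤ p * e := by
    rw [sq]; exact mul_le_mul_of_nonneg_left (mul_le_of_le_one_left he0.le h8) hp.le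
  have h10 : 0 < p * e := by positivity
  have h11 : p * ε = 40 * (p * e) := by rw [he]; ring
  rw [h11]
  nlinarith

lemma log_ge_nine {x : ℝ} (hx : 20000 ≤ x) : 9 ≤ Real.log x := by
  rw [Real.le_log_iff_exp_le (by linarith)]
  have h1 : Real.exp 9 = Real.exp 1 ^ 9 := by rw [← Real.exp_nat_mul]; norm_num
  have h2 : Real.exp 1 ^ 9 ≤ 3 ^ 9 :=
    pow_le_pow_left₀ (Real.exp_pos _).le (by linarith [Real.exp_one_lt_d9]) 9
  rw [h1]; norm_num at h2; linarith

/-- With x = n^(1/4), the hypothesis reads y² ≥ 340x³K for y = √(np), and p ≤ 1 gives y² ≤ x⁴, hence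
340K ≤ x. Trading powers of x against powers of K yields y ≥ 340²K² and y³ ≥ 340²nK², which is what
the radius of the initial guess requires. -/
lemma sample_size_bounds {n p r ν β ε s : ℝ} (hn : 3 ≤ n) (hp : 0 < p) (hp1 : p ≤ 1) (hr : 1 ≤ r)
    (hν : 128 ≤ ν) (hβ : 1 < β) (hε : 0 < ε) (hε' : ε < 1 / 22) (hs : 0 < s) (hsr : 1 ≤ s ^ 2 * r)
    (h : 340 * s * n ^ (3 / 4 : ℝ) * √(β * ν * r ^ 3) * Real.log n ≤ n * p * ε) :
    8 * ((1 + β) * Real.log n) ≤ √(n * p) ∧ 1 ≤ √(n * p) ∧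
    256 * r ^ 2 * s ^ 2 * ((1 + β) * Real.log n) * (ν * r) * n ≤ √(n * p) ^ 3 * (ε / 40) ^ 2 := by
  have hn0 : 0 < n := by linarith
  set l := Real.log n with hl
  have hl1 : 1 ≤ l := by
    rw [hl, Real.le_log_iff_exp_le hn0]
    linarith [Real.exp_one_lt_d9]
  set x := n ^ (1 / 4 : ℝ) with hx
  have hx0 : 0 < x := Real.rpow_pos_of_pos hn0 _
  have hx4 : x ^ 4 = n := by
    rw [hx, ← Real.rpow_natCast, ← Real.rpow_mul hn0.le]; norm_num
  have hx3 : n ^ (3 / 4 : ℝ) = x ^ 3 := by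
    rw [hx, ← Real.rpow_natCast, ← Real.rpow_mul hn0.le]; norm_num
  set K := s * √(β * ν * r ^ 3) * l / ε with hK
  have hK0 : 0 < K := by positivity
  have hK2 : K ^ 2 * ε ^ 2 = s ^ 2 * (β * ν * r ^ 3) * l ^ 2 := by
    rw [hK, div_pow, mul_pow, mul_pow, Real.sq_sqrt (by positivity)]; field_simp
  set y := √(n * p) with hy
  have hy0 : 0 < y := Real.sqrt_pos.2 (by positivity)
  have hy2 : y ^ 2 = n * p := Real.sq_sqrt (by positivity)
  have hyK : 340 * x ^ 3 * K ≤ y ^ 2 := by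
    rw [hx3] at h
    refine le_of_mul_le_mul_right ?_ hε
    calc 340 * x ^ 3 * K * ε = 340 * s * x ^ 3 * √(β * ν * r ^ 3) * l := by
          rw [hK]; field_simp
      _ ≤ y ^ 2 * ε := by rw [hy2]; exact h
  have hKx : 340 * K ≤ x := by
    refine le_of_mul_le_mul_left ?_ (by positivity : 0 < x ^ 3)
    have : n * p ≤ n := mul_le_of_le_one_right hn0.le hp1
    nlinarith
  have hKβ : 60000 * (β * l) ≤ K ^ 2 := by
    have h1 : 128 * (β * l) ≤ s ^ 2 * (β * ν * r ^ 3) * l ^ 2 := by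
      calc 128 * (β * l) = 1 * (β * 128 * 1 ^ 2) * (l * 1) := by ring
        _ ≤ (s ^ 2 * r) * (β * ν * r ^ 2) * (l * l) := by gcongr
        _ = _ := by ring
    have h2 : ε ^ 2 ≤ (1 / 22) ^ 2 := by gcongr
    have h3 : K ^ 2 * ε ^ 2 ≤ K ^ 2 * (1 / 22) ^ 2 := by gcongr
    have h4 : 0 < β * l := by positivity
    linarith
  have hyK2 : 340 ^ 2 * K ^ 2 ≤ y := by
    refine le_of_sq_le_sq ?_ hy0.le
    calc (340 ^ 2 * K ^ 2) ^ 2 = 340 * (340 * K) ^ 3 * K := by ring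
      _ ≤ 340 * x ^ 3 * K := by gcongr
      _ ≤ y ^ 2 := hyK
  have hy3 : 340 ^ 2 * x ^ 4 * K ^ 2 ≤ y ^ 3 := by
    refine le_of_sq_le_sq ?_ (by positivity)
    calc (340 ^ 2 * x ^ 4 * K ^ 2) ^ 2 = 340 ^ 3 * x ^ 8 * K ^ 3 * (340 * K) := by ring
      _ ≤ 340 ^ 3 * x ^ 8 * K ^ 3 * x := by gcongr
      _ = (340 * x ^ 3 * K) ^ 3 := by ring
      _ ≤ (y ^ 2) ^ 3 := by gcongr
      _ = (y ^ 3) ^ 2 := by ring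
  have hβl : 1 ≤ β * l := by nlinarith
  have hcl : (1 + β) * l ≤ 2 * (β * l) := by nlinarith
  -- The hypotheses force n ≥ 340⁴. K² contains the square of the logarithm and the target only its
  -- first power; the spare factor absorbs the numerical constant.
  have hl9 : 9 ≤ l := by
    refine log_ge_nine ?_
    have h1 : 1 ≤ K := by nlinarith
    have h2 : 340 ≤ x := by linarith
    have h3 : (340 : ℝ) ^ 4 ≤ x ^ 4 := by gcongr
    rw [← hx4]; linarith
  refine ⟨by linarith, by linarith, ?_⟩
  calc 256 * r ^ 2 * s ^ 2 * ((1 + β) * l) * (ν * r) * n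
      ≤ 256 * r ^ 2 * s ^ 2 * (2 * (β * l)) * (ν * r) * n := by gcongr
    _ = 512 * (s ^ 2 * (β * ν * r ^ 3) * l) * n := by ring
    _ ≤ 512 * (s ^ 2 * (β * ν * r ^ 3) * l) * n * (l / 9) :=
        le_mul_of_one_le_right (by positivity) (by linarith)
    _ = 512 / 9 * (s ^ 2 * (β * ν * r ^ 3) * l ^ 2) * n := by ring
    _ = 512 / 9 * (K ^ 2 * ε ^ 2) * x ^ 4 := by rw [hK2, hx4]
    _ ≤ 340 ^ 2 * x ^ 4 * K ^ 2 * (ε / 40) ^ 2 := by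
        have : 0 < x ^ 4 * K ^ 2 * ε ^ 2 := by positivity
        linarith
    _ ≤ y ^ 3 * (ε / 40) ^ 2 := by gcongr

end EDG

namespace EDG

open Matrix

variable {n m r : ℕ} {X : Matrix (Fin n) (Fin n) ℝ}

/-! ### Scale invariants of the ground truth -/

lemma opNorm_smul (c : ℝ) (A : Matrix (Fin n) (Fin n) ℝ) : opNorm (c • A) = |c| * opNorm A := by
  rw [opNorm, map_smul, norm_smul, Real.norm_eq_abs, opNorm]

lemma singularValue_le_opNorm (hX : X.IsSymm) (hr : 1 ≤ X.rank) :
    (Matrix.toEuclideanLin X).singularValues (X.rank - 1) ≤ opNorm X := by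
  have hP := isOrthProj_colProj X
  obtain ⟨i, hi⟩ : ∃ i, 0 < colProj X i i := by
    by_contra! h
    have h1 := Finset.sum_nonpos fun i (_ : i ∈ Finset.univ) => h i
    rw [sum_colProj_diag] at h1
    have : (1 : ℝ) ≤ X.rank := by exact_mod_cast hr
    linarith
  set z := colProj X *ᵥ Pi.single i 1 with hz
  have hPz : colProj X *ᵥ z = z := by rw [hz, Matrix.mulVec_mulVec, hP.idem]
  have hzz : 0 < z ⬝ᵥ z := by
    have h1 : z ⬝ᵥ z = ∑ k, colProj X i k ^ 2 := by
      rw [hz, Matrix.mulVec_single_one, dotProduct]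
      refine Finset.sum_congr rfl fun k _ => ?_
      rw [← sq, Matrix.col_apply, ← Matrix.transpose_apply (colProj X), hP.symm]
    rwa [h1, hP.sum_sq_row]
  have h1 := singularValue_mul_le hX hr z
  rw [hPz] at h1
  exact le_of_sq_le_sq (le_of_mul_le_mul_right (h1.trans (mulVec_dotProduct_self_le X z)) hzz)
    (opNorm_nonneg X)

lemma opNorm_le_of_abs_le {M : ℝ} (hM0 : 0 ≤ M) (hM : ∀ i j, |X i j| ≤ M) : opNorm X ≤ n * M := by
  refine (opNorm_le_frob X).trans (le_of_sq_le_sq ?_ (by positivity))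
  rw [frob_sq_eq_sum]
  calc _ ≤ ∑ _i : Fin n, ∑ _j : Fin n, M ^ 2 := by
        refine Finset.sum_le_sum fun i _ => Finset.sum_le_sum fun j _ => ?_
        exact sq_le_sq' (abs_le.1 (hM i j)).1 (abs_le.1 (hM i j)).2
    _ = _ := by simp; ring

/-- Thresholding commutes with scaling, so X_0 is a best rank-r approximation of p⁻¹R_Ω X. -/
lemma frob_init_sub_le {ω : Fin m → Pair n} {x : ℕ → Matrix (Fin n) (Fin n) ℝ}
    (hx : IsRun r ω X x) (hrank : X.rank ≤ r) (hN : 0 < numPairs n) (hm : 0 < m) {t : ℝ}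
    (ht : opNorm (sampling ω X - (m / numPairs n) • X) ≤ t) :
    frob (x 0 - X) ≤ 2 * √(2 * r) * (t / (m / numPairs n)) := by
  have hm0 : (0 : ℝ) < m := by positivity
  obtain ⟨Z, hZ, hx0⟩ := hx.init
  rw [hx0]
  refine ((hZ.smul (numPairs n / m)).frob_sub_le_opNorm hrank).trans ?_
  have h1 : (numPairs n / m) • sampling ω X - X
      = (numPairs n / m) • (sampling ω X - (m / numPairs n) • X) := by
    rw [smul_sub, smul_smul, div_mul_div_cancel₀ hm0.ne', div_self hN.ne', one_smul]
  rw [h1, opNorm_smul, abs_of_pos (by positivity), div_div_eq_mul_div, div_mul_eq_mul_div,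
    mul_comm (numPairs n)]
  gcongr

/-- A sample is good, and gives a good initial guess, with high probability. -/
theorem sampleLaw_goodSample_le {p ε Λ τ t c M ν : ℝ} (hn : 2 ≤ n) (hm : 0 < m)
    (hmL : (m : ℝ) ≤ numPairs n) (hr : 1 ≤ r) (hX : IsCentered X) (hrank : X.rank = r)
    (hν : IsIncoherent r ν X) (hM0 : 0 < M) (hM : ∀ i j, |X i j| ≤ M) (hpdef : p = m / numPairs n)
    (hε : 0 < ε) (hε1 : ε ≤ 1) (hc : 0 < c) (hrip : 5 * (ν ^ 2 * r ^ 2) * c ≤ 16 * n * p * ε ^ 2)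
    (hcp : 8 * c ≤ n * p) (hΛ0 : 0 ≤ Λ) (hΛ : 4 * (ν * r) * c ≤ p * Λ ^ 2) (ht : 0 ≤ t)
    (htM : 32 * (n * p) * M ^ 2 * c ≤ t ^ 2) (hτ : 2 ≤ τ)
    (hτc : 12 * (n * p) * (1 / (4 * τ)) - 1 / (4 * τ) * τ ^ 2 ≤ -c) :
    (sampleLaw n m).real {ω | ¬ (GoodSample ω X p ε Λ τ ∧ opNorm (sampling ω X - p • X) ≤ t)}
      ≤ 10 * n ^ 2 * Real.exp (-c) := by
  have := isProbabilityMeasure_sampleLaw hn m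
  subst hpdef
  have hA := sampleLaw_rip_le hν hn hm hr hrank hε hε1 hc hrip
  have hC := sampleLaw_diag_le hν hn hm hr hc (by linarith) hΛ0 hΛ
  have hB := sampleLaw_opNorm_le hX hn hm hM0 hM hc hcp ht htM
  have hR : ∀ i, (sampleLaw n m).real {ω | ¬ ∑ j, (mult ω i j : ℝ) ^ 2 ≤ τ ^ 2} ≤ Real.exp (-c) :=
    fun i => (sampleLaw_row_le hn hmL hτ rfl i).trans (Real.exp_le_exp.2 hτc)
  have hR' := (measureReal_iUnion_fintype_le (μ := sampleLaw n m)
    fun i => {ω | ¬ ∑ j, (mult ω i j : ℝ) ^ 2 ≤ τ ^ 2}).trans (Finset.sum_le_sum fun i _ => hR i)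
  rw [Finset.sum_const, Finset.card_univ, Fintype.card_fin, nsmul_eq_mul] at hR'
  have hsub : ∀ {s a b d e : Set (Fin m → Pair n)}, s ⊆ a ∪ (b ∪ (d ∪ e)) →
      (sampleLaw n m).real s ≤ (sampleLaw n m).real a + ((sampleLaw n m).real b
        + ((sampleLaw n m).real d + (sampleLaw n m).real e)) := fun {s a b d e} h => by
    refine (measureReal_mono h).trans ((measureReal_union_le _ _).trans ?_)
    gcongr
    refine (measureReal_union_le _ _).trans ?_
    gcongr
    exact measureReal_union_le _ _
  refine (hsub fun ω hω => ?_).trans ((add_le_add hA (add_le_add hC (add_le_add hB hR'))).trans ?_)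
  · by_contra hcon
    simp only [Set.mem_union, Set.mem_iUnion, Set.mem_ofPred_eq, not_or, not_not, not_exists]
      at hω hcon
    exact hω ⟨⟨hcon.1, hcon.2.1, hcon.2.2.2⟩, hcon.2.2.1⟩
  -- The four failure probabilities sum to (2n² + (n² + n) + 2n + n) e^{−c}.
  · have h1 : (2 : ℝ) ≤ n := by exact_mod_cast hn
    have h2 := Real.exp_pos (-c)
    nlinarith [mul_le_mul_of_nonneg_right (by nlinarith : (4 : ℝ) * n ≤ 2 * n ^ 2) h2.le,
      mul_pos (by positivity : (0 : ℝ) < n ^ 2) h2]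

/-- The algorithm converges linearly, with high probability, once the sampling rate `p` is large
against the size `M` of the entries of `X` relative to its smallest singular value `σ`. -/
theorem sampleLaw_linear_convergence_ge {ν β ε₀ σ M s p : ℝ} (hn : 3 ≤ n) (hr : 1 ≤ r)
    (hX : IsCentered X) (hrank : X.rank = r) (hν : IsIncoherent r ν X) (hβ : 1 < β)
    (hε₀ : 0 < ε₀) (hε₀' : ε₀ < 1 / 22) (hmpos : 0 < m) (hmL : (m : ℝ) ≤ numPairs n)
    (hpdef : p = m / numPairs n) (hσ : 0 < σ)
    (hσX : ∀ z, σ ^ 2 * ((colProj X *ᵥ z) ⬝ᵥ (colProj X *ᵥ z)) ≤ (X *ᵥ z) ⬝ᵥ (X *ᵥ z))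
    (hM0 : 0 < M) (hMX : ∀ i j, |X i j| ≤ M) (hs0 : 0 < s) (hsr : 1 ≤ s ^ 2 * r)
    (hsM : r * s ^ 2 * σ ^ 2 = n ^ 2 * M ^ 2)
    (hnp1 : 16 / 3 * (β * ν ^ 2 * r ^ 2) * Real.log n ≤ n * p * ε₀ ^ 2)
    (hnp2 : 340 * s * (n : ℝ) ^ (3 / 4 : ℝ) * √(β * ν * (r : ℝ) ^ 3) * Real.log n
      ≤ n * p * ε₀) :
    1 - 10 * (n : ℝ) ^ (1 - β) ≤
      (sampleLaw n m).real {ω | ∀ x : ℕ → Matrix (Fin n) (Fin n) ℝ, IsRun r ω X x →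
        ∀ l, frob (x (l + 1) - X) ≤ 18 * ε₀ / (1 - 4 * ε₀) * frob (x l - X)} := by
  have hn2 : 2 ≤ n := by omega
  have hn3 : (3 : ℝ) ≤ n := by exact_mod_cast hn
  have hr1 : (1 : ℝ) ≤ r := by exact_mod_cast hr
  have hν128 := hν.le_ν hn2 hr hrank
  have hn0 : (0 : ℝ) < n := by linarith
  have hN : 0 < numPairs n := by rw [numPairs]; nlinarith
  have hl : 0 < Real.log n := Real.log_pos (by linarith)
  have hm0 : (0 : ℝ) < m := by exact_mod_cast hmpos
  have hνr : 128 ≤ ν * r := hν128.trans (le_mul_of_one_le_right (by linarith) hr1)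
  have hp0 : 0 < p := by rw [hpdef]; positivity
  have hp1 : p ≤ 1 := by rw [hpdef, div_le_one hN]; exact hmL
  obtain ⟨hb1, hb2, hb3⟩ :=
    sample_size_bounds hn3 hp0 hp1 hr1 hν128 hβ hε₀ hε₀' hs0 hsr hnp2
  -- Chosen so that 10 n² e^{−c} = 10 n^{1−β}.
  obtain ⟨c, hc⟩ : ∃ c, c = (1 + β) * Real.log n := ⟨_, rfl⟩
  obtain ⟨y, hy⟩ : ∃ y, y = √(n * p) := ⟨_, rfl⟩
  rw [← hc, ← hy] at hb1 hb3
  rw [← hy] at hb2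
  have hc0 : 0 < c := by rw [hc]; positivity
  have hy0 : 0 < y := by linarith
  have hy2 : y ^ 2 = n * p := by rw [hy, Real.sq_sqrt (by positivity)]
  -- the parameters of a good sample
  obtain ⟨Λ, hΛ⟩ : ∃ Λ, Λ = √(4 * (ν * r) * c / p) := ⟨_, rfl⟩
  have hΛ2 : p * Λ ^ 2 = 4 * (ν * r) * c := by
    rw [hΛ, Real.sq_sqrt (by positivity)]; field_simp
  obtain ⟨t, ht⟩ : ∃ t, t = √(32 * (n * p) * M ^ 2 * c) := ⟨_, rfl⟩
  have ht2 : t ^ 2 = 32 * (n * p) * M ^ 2 * c := by rw [ht, Real.sq_sqrt (by positivity)]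
  have ht0 : 0 ≤ t := by rw [ht]; positivity
  -- The radius, in units of σ, that `frob_init_sub_le` guarantees for the initial guess.
  obtain ⟨η, hη⟩ : ∃ η, η = 2 * √(2 * r) * (t / p) / σ := ⟨_, rfl⟩
  have hη0 : 0 ≤ η := by rw [hη]; positivity
  have hη2 : η ^ 2 * y ^ 2 = 256 * r ^ 2 * s ^ 2 * c := by
    rw [hη, div_pow, mul_pow, mul_pow, div_pow, ht2, Real.sq_sqrt (by positivity), hy2]
    calc _ = 256 * r * c * (n ^ 2 * M ^ 2) / σ ^ 2 := by field_simp; ring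
      _ = _ := by rw [← hsM]; field_simp
  have hrad : GoodSample.SmallRadius p ε₀ Λ (8 * y) (ν * r / (128 * n)) η := by
    refine smallRadius_of_sq_le hp0 hp1 (by linarith) hy0 hy2 hνr hε₀ hε₀' hη0 ?_
      (by rw [hΛ]; positivity) hΛ2.le (by linarith)
    refine le_of_mul_le_mul_right ?_ (by positivity : 0 < y ^ 2)
    calc η ^ 2 * (ν * r) * n * y ^ 2 = η ^ 2 * y ^ 2 * (ν * r) * n := by ring
      _ = 256 * r ^ 2 * s ^ 2 * c * (ν * r) * n := by rw [hη2]
      _ ≤ y ^ 3 * (ε₀ / 40) ^ 2 := hb3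
      _ = _ := by ring
  have hbad := sampleLaw_goodSample_le (t := t) (τ := 8 * y) (Λ := Λ) (c := c) hn2 hmpos hmL hr hX
    hrank hν hM0 hMX hpdef hε₀ (by linarith) hc0
    (by
      have h1 : c ≤ 2 * β * Real.log n := by rw [hc]; gcongr; linarith
      have h2 : 5 * (ν ^ 2 * r ^ 2) * c ≤ 5 * (ν ^ 2 * r ^ 2) * (2 * β * Real.log n) := by gcongr
      have h3 : 0 ≤ β * ν ^ 2 * r ^ 2 * Real.log n := by positivity
      linarith)
    (by linarith [le_self_pow₀ hb2 two_ne_zero]) (by rw [hΛ]; positivity) hΛ2.ge ht0 ht2.ge (by linarith)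
    (by
      rw [← hy2]
      -- For τ = 8y the exponent is 3y/8 − 2y; the bound 8c ≤ y makes this at most −c.
      have : 12 * y ^ 2 * (1 / (4 * (8 * y))) - 1 / (4 * (8 * y)) * (8 * y) ^ 2 = -(13 / 8 * y) := by
        field_simp; norm_num
      linarith)
  have hexp : 10 * (n : ℝ) ^ 2 * Real.exp (-c) = 10 * (n : ℝ) ^ (1 - β) := by
    have h1 : Real.exp (-c) = (n : ℝ) ^ (-(1 + β)) := by
      rw [Real.rpow_def_of_pos hn0, hc]; congr 1; ring
    rw [h1, mul_assoc, ← Real.rpow_natCast, ← Real.rpow_add hn0]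
    congr 2; push_cast; ring
  rw [hexp] at hbad
  have := isProbabilityMeasure_sampleLaw hn2 m
  have hcompl : (sampleLaw n m).real {ω | GoodSample ω X p ε₀ Λ (8 * y)
      ∧ opNorm (sampling ω X - p • X) ≤ t} = 1 - (sampleLaw n m).real
        {ω | ¬ (GoodSample ω X p ε₀ Λ (8 * y) ∧ opNorm (sampling ω X - p • X) ≤ t)} := by
    rw [← probReal_compl_eq_one_sub (Set.toFinite _).measurableSet]
    congr 1
    ext ω
    simp only [Set.mem_compl_iff, Set.mem_ofPred_eq, not_not]
  refine le_trans ?_ (measureReal_mono (s₁ := {ω | GoodSample ω X p ε₀ Λ (8 * y)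
      ∧ opNorm (sampling ω X - p • X) ≤ t}) fun ω hω => ?_)
  · linarith
  · simp only [Set.mem_ofPred_eq] at hω ⊢
    intro x hx l
    refine hω.1.linear_convergence hrad hX (hν.colProj_diag_le hn2) hrank hσ
      hσX hx ?_ l
    have h1 := frob_init_sub_le hx hrank.le hN hmpos (hpdef ▸ hω.2)
    rw [← hpdef] at h1
    refine h1.trans (le_of_eq ?_)
    rw [hη]; field_simp

end EDG

/-! ### The main theorem: from the bound on the number of samples to the sampling rate -/

theorem theorem3 (n r m : ℕ) (hn : 3 ≤ n) (hr : 1 ≤ r)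
    (X : Matrix (Fin n) (Fin n) ℝ) (hX : EDG.IsCentered X) (hrank : X.rank = r)
    (ν μ₁ β ε₀ : ℝ) (hν : EDG.IsIncoherent r ν X)
    (hμ₁ : ∀ i j, |X i j| ≤ μ₁ * Real.sqrt ((r : ℝ) / (n : ℝ) ^ 2) * EDG.opNorm X)
    (hβ : 1 < β) (hε₀ : 0 < ε₀) (hε₀' : ε₀ < 1 / 22)
    (hmL : (m : ℝ) ≤ EDG.numPairs n)
    (hm : max (8 / 3 * (Real.sqrt (β * ν ^ 3 * r) / ε₀))
          (170 * EDG.condNumber r X * μ₁ * (n : ℝ) ^ (3 / 4 : ℝ))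
        * (Real.sqrt (β * ν * (r : ℝ) ^ 3) / ε₀) * n * Real.log n ≤ (m : ℝ)) :
    1 - 10 * (n : ℝ) ^ (1 - β) ≤
      (EDG.sampleLaw n m).real {ω | ∀ x : ℕ → Matrix (Fin n) (Fin n) ℝ, EDG.IsRun r ω X x →
        ∀ l, EDG.frob (x (l + 1) - X) ≤ 18 * ε₀ / (1 - 4 * ε₀) * EDG.frob (x l - X)} := by
  open EDG in
  have hn2 : 2 ≤ n := by omega
  have hn3 : (3 : ℝ) ≤ n := by exact_mod_cast hn
  have hr1 : (1 : ℝ) ≤ r := by exact_mod_cast hr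
  have hν128 := hν.le_ν hn2 hr hrank
  have hn0 : (0 : ℝ) < n := by linarith
  have hN : 0 < numPairs n := by rw [numPairs]; nlinarith
  have hl : 0 < Real.log n := Real.log_pos (by linarith)
  -- the scale of `X`
  obtain ⟨σ, hσdef⟩ : ∃ σ, σ = (Matrix.toEuclideanLin X).singularValues (r - 1) := ⟨_, rfl⟩
  have hσ : 0 < σ := by rw [hσdef, ← hrank]; exact singularValue_pos (hrank ▸ hr)
  have hσX : σ ≤ opNorm X := by
    rw [hσdef, ← hrank]; exact singularValue_le_opNorm hX.1 (hrank ▸ hr)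
  have hX0 : 0 < opNorm X := hσ.trans_le hσX
  have hκ : condNumber r X = opNorm X / σ := by rw [hσdef]; rfl
  obtain ⟨M, hMdef⟩ : ∃ M, M = μ₁ * √((r : ℝ) / (n : ℝ) ^ 2) * opNorm X := ⟨_, rfl⟩
  have hMX : ∀ i j, |X i j| ≤ M := fun i j => hMdef ▸ hμ₁ i j
  have hsqrt : √((r : ℝ) / (n : ℝ) ^ 2) = √r / n := by
    rw [Real.sqrt_div (by positivity), Real.sqrt_sq hn0.le]
  have hM0' : 0 ≤ M := (abs_nonneg _).trans (hMX ⟨0, by omega⟩ ⟨0, by omega⟩)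
  -- Positivity of μ₁ comes from the entry bound itself: ‖X‖ ≤ nM = μ₁√r ‖X‖ with X ≠ 0.
  have hμr : 1 ≤ μ₁ * √r := by
    have h1 := opNorm_le_of_abs_le hM0' hMX
    have h2 : n * M = μ₁ * √r * opNorm X := by rw [hMdef, hsqrt]; field_simp
    rw [h2] at h1
    exact le_of_mul_le_mul_right ((one_mul _).le.trans h1) hX0
  have hμ0 : 0 < μ₁ := pos_of_mul_pos_left (by linarith) (Real.sqrt_nonneg _)
  have hM0 : 0 < M := by rw [hMdef]; positivity
  obtain ⟨s, hsdef⟩ : ∃ s, s = condNumber r X * μ₁ := ⟨_, rfl⟩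
  have hκ1 : 1 ≤ condNumber r X := by rw [hκ, one_le_div hσ]; exact hσX
  have hs0 : 0 < s := by rw [hsdef]; positivity
  have hsr : 1 ≤ s ^ 2 * r := by
    have h1 : 1 ≤ s * √r := by
      rw [hsdef, mul_assoc]; exact one_le_mul_of_one_le_of_one_le hκ1 hμr
    have h2 : s ^ 2 * r = (s * √r) ^ 2 := by rw [mul_pow, Real.sq_sqrt (by linarith)]
    rw [h2]; exact one_le_pow₀ h1
  -- the two lower bounds on the number of samples
  obtain ⟨p, hpdef⟩ : ∃ p : ℝ, p = m / numPairs n := ⟨_, rfl⟩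
  have hfac : 0 ≤ √(β * ν * (r : ℝ) ^ 3) / ε₀ * (n * Real.log n) := by positivity
  have hm1 : 8 / 3 * (β * ν ^ 2 * r ^ 2) * (n * Real.log n) ≤ m * ε₀ ^ 2 := by
    have h1 := (mul_le_mul_of_nonneg_right (le_max_left (8 / 3 * (√(β * ν ^ 3 * r) / ε₀))
      (170 * condNumber r X * μ₁ * (n : ℝ) ^ (3 / 4 : ℝ))) hfac)
    have h2 : √(β * ν ^ 3 * r) * √(β * ν * (r : ℝ) ^ 3) = β * ν ^ 2 * r ^ 2 := by
      rw [← Real.sqrt_mul (by positivity)]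
      exact (congrArg _ (by ring)).trans (Real.sqrt_sq (by positivity : 0 ≤ β * ν ^ 2 * r ^ 2))
    have h3 : 8 / 3 * (β * ν ^ 2 * r ^ 2) * (n * Real.log n) = 8 / 3 * (√(β * ν ^ 3 * r) / ε₀)
        * (√(β * ν * (r : ℝ) ^ 3) / ε₀ * (n * Real.log n)) * ε₀ ^ 2 := by
      rw [← h2]; field_simp
    rw [h3]
    gcongr
    linarith
  have hm2 : 170 * s * (n : ℝ) ^ (3 / 4 : ℝ) * √(β * ν * (r : ℝ) ^ 3) * Real.log n * n
      ≤ m * ε₀ := by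
    have h1 := (mul_le_mul_of_nonneg_right (le_max_right (8 / 3 * (√(β * ν ^ 3 * r) / ε₀))
      (170 * condNumber r X * μ₁ * (n : ℝ) ^ (3 / 4 : ℝ))) hfac)
    have h3 : 170 * s * (n : ℝ) ^ (3 / 4 : ℝ) * √(β * ν * (r : ℝ) ^ 3) * Real.log n * n
        = 170 * condNumber r X * μ₁ * (n : ℝ) ^ (3 / 4 : ℝ)
          * (√(β * ν * (r : ℝ) ^ 3) / ε₀ * (n * Real.log n)) * ε₀ := by
      rw [hsdef]; field_simp
    rw [h3]
    gcongr
    linarith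
  have hm0 : (0 : ℝ) < m := by
    have : 0 < 8 / 3 * (β * ν ^ 2 * r ^ 2) * (n * Real.log n) := by positivity
    exact pos_of_mul_pos_left (this.trans_le hm1) (by positivity)
  have hmpos : 0 < m := by exact_mod_cast hm0
  have hp0 : 0 < p := by rw [hpdef]; positivity
  -- L ≤ n²/2, so passing from m to p doubles the constants 8/3 and 170.
  have hpm : 2 * m ≤ n * (n * p) := by
    have h1 : p * numPairs n = m := by rw [hpdef]; field_simp
    rw [← h1, numPairs]
    nlinarith [mul_pos hp0 hn0]
  have hnp1 : 16 / 3 * (β * ν ^ 2 * r ^ 2) * Real.log n ≤ n * p * ε₀ ^ 2 := by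
    refine le_of_mul_le_mul_left ?_ hn0
    have := mul_le_mul_of_nonneg_right hpm (sq_nonneg ε₀)
    linarith
  have hnp2 : 340 * s * (n : ℝ) ^ (3 / 4 : ℝ) * √(β * ν * (r : ℝ) ^ 3) * Real.log n
      ≤ n * p * ε₀ := by
    refine le_of_mul_le_mul_left ?_ hn0
    have := mul_le_mul_of_nonneg_right hpm hε₀.le
    linarith
  refine sampleLaw_linear_convergence_ge hn hr hX hrank hν hβ hε₀ hε₀' hmpos hmL hpdef hσ
    (fun z => ?_) hM0 hMX hs0 hsr ?_ hnp1 hnp2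
  · have := singularValue_mul_le hX.1 (hrank ▸ hr) z
    rwa [hrank, ← hσdef] at this
  -- Both sides equal r μ₁² ‖X‖².
  · rw [hMdef, hsdef, hκ, hsqrt, mul_pow, mul_pow, mul_pow, div_pow, div_pow,
      Real.sq_sqrt (by linarith)]
    field_simp
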